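/- **Setting.** Let $\mathcal{R}h_e\subset\mathbb{R}^2$ be the open equilateral rhombus with vertices $(0,0)$, $(1,0)$, $(\tfrac32,\tfrac{\sqrt3}2)$, $(\tfrac12,\tfrac{\sqrt3}2)$. Let $D$ (the longer one, joining $(0,0)$ and $(\tfrac32,\tfrac{\sqrt3}2)$) and $M$ (the shorter one, joining $(1,0)$ and $(\tfrac12,\tfrac{\sqrt3}2)$) be its diagonals; the letters $D$, $M$ also denote the mirror symmetries with respect to the lines supporting them, and $D^*\phi=\phi\circ D$, $M^*\phi=\phi\circ M$. The diagonal $M$ divides $\mathcal{R}h_e$ into two open equilateral triangles; $\mathcal{T}_e$ denotes either of them. The diagonals $D$ and $M$ divide $\mathcal{R}h_e$ into four open hemiequilateral triangles; $\mathcal{T}_h$ denotes any of them. For an open convex polygon $\Omega$ with open sides $\Gamma_1,\dots,\Gamma_k$ and a boundary condition $\mathfrak{b}=\mathfrak{b}_1\cdots\mathfrak{b}_k$, $\mathfrak{b}_j\in\{\mathfrak{d},\mathfrak{n}\}$ ($\mathfrak d$ for Dirichlet, $\mathfrak n$ for Neumann), let $H^1_{\mathfrak b}(\Omega)$ be the space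 of real-valued $u\in H^1(\Omega)$ whose trace vanishes on $\Gamma_j$ whenever $\mathfrak{b}_j=\mathfrak d$. For $\lambda\in\mathbb{R}$, let $$\mathcal{E}(\lambda,(\Omega,\mathfrak b))=\Big\{u\in H^1_{\mathfrak b}(\Omega) : \int_\Omega\nabla u\cdot\nabla v=\lambda\int_\Omega u\,v\ \text{ for all } v\in H^1_{\mathfrak b}(\Omega)\Big\}\subset L^2(\Omega).$$ The number $\lambda$ is an eigenvalue of $-\Delta$ for $(\Omega,\mathfrak b)$, written $\lambda\in\mathrm{sp}(\Omega,\mathfrak b)$, if this space is not $\{0\}$; the multiplicity of $\lambda$ is the dimension of this space (zero if $\lambda$ is not an eigenvalue). For the rhombus, $(\mathcal{R}h_e,\mathfrak a)$ means the condition $\mathfrak a$ on all four sides. For $\mathcal{T}_e$, $\mathfrak{aab}$ means $\mathfrak a$ on the two sides that are sides of the rhombus and $\mathfrak b$ on the side $M$. For $\mathcal{T}_h$, $\mathfrak{abc}$ means $\mathfrak a$ on the longest side (a side of the rhombus), $\mathfrak b$ on the second longest side (half of $D$) and $\mathfrak c$ on the shortest side (half of $M$). For $\sigma,\tau\in\{+,-\}$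 let $\mathcal{S}_{M,\tau}=\{\phi\in L^2(\mathcal{R}h_e): M^*\phi=\tau\phi\}$ and $\mathcal{S}_{\sigma,\tau}=\{\phi\in L^2(\mathcal{R}h_e): D^*\phi=\sigma\phi,\ M^*\phi=\tau\phi\}$, and put $\epsilon(\mathfrak n)=+$, $\epsilon(\mathfrak d)=-$. **Proposition (Reflection principle).** For any $\mathfrak a\in\{\mathfrak d,\mathfrak n\}$ and any $\lambda\in\mathbb{R}$ (in particular, for any $\lambda\in\mathrm{sp}(\mathcal{R}h_e,\mathfrak a)$): 1. $\mathcal{E}(\lambda,(\mathcal{R}h_e,\mathfrak a))\cap\mathcal{S}_{M,+}\neq\{0\}$ if and only if $\lambda\in\mathrm{sp}(\mathcal{T}_e,\mathfrak{aan})$, and the map $\phi\mapsto\phi|_{\mathcal{T}_e}$ is a bijection from $\mathcal{E}(\lambda,(\mathcal{R}h_e,\mathfrak a))\cap\mathcal{S}_{M,+}$ onto $\mathcal{E}(\lambda,(\mathcal{T}_e,\mathfrak{aan}))$. 2. $\mathcal{E}(\lambda,(\mathcal{R}h_e,\mathfrak a))\cap\mathcal{S}_{M,-}\neq\{0\}$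 if and only if $\lambda\in\mathrm{sp}(\mathcal{T}_e,\mathfrak{aad})$, and the map $\phi\mapsto\phi|_{\mathcal{T}_e}$ is a bijection from $\mathcal{E}(\lambda,(\mathcal{R}h_e,\mathfrak a))\cap\mathcal{S}_{M,-}$ onto $\mathcal{E}(\lambda,(\mathcal{T}_e,\mathfrak{aad}))$. 3. For any $\mathfrak b,\mathfrak c\in\{\mathfrak d,\mathfrak n\}$, $\mathcal{E}(\lambda,(\mathcal{R}h_e,\mathfrak a))\cap\mathcal{S}_{\epsilon(\mathfrak b),\epsilon(\mathfrak c)}\neq\{0\}$ if and only if $\lambda\in\mathrm{sp}(\mathcal{T}_h,\mathfrak{abc})$, and the map $\phi\mapsto\phi|_{\mathcal{T}_h}$ is a bijection from $\mathcal{E}(\lambda,(\mathcal{R}h_e,\mathfrak a))\cap\mathcal{S}_{\epsilon(\mathfrak b),\epsilon(\mathfrak c)}$ onto $\mathcal{E}(\lambda,(\mathcal{T}_h,\mathfrak{abc}))$. Furthermore, the multiplicity of $\lambda$ as eigenvalue of $(\mathcal{R}h_e,\mathfrak a)$ is the sum, over $\mathfrak b,\mathfrak c\in\{\mathfrak d,\mathfrak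 n\}$, of the multiplicities of $\lambda$ as eigenvalue of $(\mathcal{T}_h,\mathfrak{abc})$. -/

import Mathlib

open MeasureTheory Filter Topology
open scoped ENNReal Gradient ContDiff MeasureTheory

noncomputable section

namespace EquilateralRhombus

/-- The Euclidean plane. -/
abbrev Plane : Type := EuclideanSpace ℝ (Fin 2)

/-- Lebesgue measure on the domain `Ω`. -/
abbrev vol (Ω : Set Plane) : Measure Plane := volume.restrict Ω

/-- The real Hilbert space `L²(Ω)`. -/
abbrev L2 (Ω : Set Plane) : Type := Lp ℝ 2 (vol Ω)

/-- The real Hilbert space `L²(Ω; ℝ²)` of vector fields. -/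
abbrev L2Vec (Ω : Set Plane) : Type := Lp Plane 2 (vol Ω)

/-- The two boundary conditions: Dirichlet `d` and Neumann `n`. -/
inductive BC : Type
  | d : BC
  | n : BC
  deriving DecidableEq

instance : Fintype BC := ⟨{BC.d, BC.n}, fun x ↦ by cases x <;> simp⟩

/-- The sign attached to a boundary condition: `ε(n) = +1` and `ε(d) = -1`. -/
def BC.eps : BC → ℝ
  | .n => 1
  | .d => -1

/-! ### Sobolev space, traces and the variational eigenvalue problem -/

/-- `G` is the weak (distributional) gradient of `u` in the open set `Ω`. -/
def HasWeakGradient (Ω : Set Plane) (u : Plane → ℝ) (G : Plane → Plane) : Prop :=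
  ∀ φ : Plane → ℝ, ContDiff ℝ ∞ φ → HasCompactSupport φ → tsupport φ ⊆ Ω →
    ∫ x in Ω, u x • ∇ φ x = -∫ x in Ω, φ x • G x

/-- The function `u ∈ H¹(Ω)`, with weak gradient `G`, has trace `g` on the part `Γ` of the boundary
of the bounded open set `Ω`: there are functions `wₙ`, continuously differentiable up to the
boundary, which converge to `u` in `H¹(Ω)` and whose restrictions to `Γ` converge to `g` in
`L²(Γ)`, with respect to the length measure on `Γ`. -/
def HasTrace (Ω Γ : Set Plane) (u : Plane → ℝ) (G : Plane → Plane) (g : Plane → ℝ) : Prop :=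
  ∃ w : ℕ → Plane → ℝ, (∀ n, ContDiff ℝ 1 (w n)) ∧
    Tendsto (fun n ↦ eLpNorm (w n - u) 2 (vol Ω)) atTop (𝓝 0) ∧
    Tendsto (fun n ↦ eLpNorm (∇ (w n) - G) 2 (vol Ω)) atTop (𝓝 0) ∧
    Tendsto (fun n ↦ eLpNorm (w n - g) 2 ((Measure.hausdorffMeasure 1).restrict Γ)) atTop (𝓝 0)

lemma integrableOn_mul_test {F : Type*} [NormedAddCommGroup F] [NormedSpace ℝ F] {Ω : Set Plane}
    {f : Plane → F} (hf : MemLp f 2 (vol Ω)) {φ : Plane → ℝ} (h1 : Continuous φ)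
    (h2 : HasCompactSupport φ) : Integrable (fun x ↦ φ x • f x) (vol Ω) :=
  memLp_one_iff_integrable.mp (hf.smul ((h1.memLp_of_hasCompactSupport (p := 2) h2).restrict Ω))

lemma continuous_gradient {φ : Plane → ℝ} (h : ContDiff ℝ 1 φ) : Continuous (∇ φ) :=
  (InnerProductSpace.toDual ℝ Plane).symm.continuous.comp (h.continuous_fderiv one_ne_zero)

lemma integrableOn_smul_gradient {Ω : Set Plane} {u : Plane → ℝ} (hu : MemLp u 2 (vol Ω))
    {φ : Plane → ℝ} (h1 : ContDiff ℝ 1 φ) (h2 : HasCompactSupport φ) :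
    Integrable (fun x ↦ u x • ∇ φ x) (vol Ω) := by
  have hs : HasCompactSupport (∇ φ) := by
    have := h2.fderiv (𝕜 := ℝ)
    exact this.comp_left (g := (InnerProductSpace.toDual ℝ Plane).symm) (map_zero _)
  exact memLp_one_iff_integrable.mp
    ((((continuous_gradient h1).memLp_of_hasCompactSupport (p := 2) hs).restrict Ω).smul hu)

lemma HasWeakGradient.congr {Ω : Set Plane} {u u' : Plane → ℝ} {G G' : Plane → Plane}
    (h : HasWeakGradient Ω u G) (hu : u =ᵐ[vol Ω] u') (hG : G =ᵐ[vol Ω] G') :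
    HasWeakGradient Ω u' G' := by
  intro φ h1 h2 h3
  have e1 : ∫ x in Ω, u' x • ∇ φ x = ∫ x in Ω, u x • ∇ φ x :=
    integral_congr_ae (by filter_upwards [hu] with x hx; simp [hx])
  have e2 : ∫ x in Ω, φ x • G' x = ∫ x in Ω, φ x • G x :=
    integral_congr_ae (by filter_upwards [hG] with x hx; simp [hx])
  rw [e1, e2]
  exact h φ h1 h2 h3

lemma HasWeakGradient.add {Ω : Set Plane} {u u' : Plane → ℝ} {G G' : Plane → Plane}
    (h : HasWeakGradient Ω u G) (h' : HasWeakGradient Ω u' G')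
    (hu : MemLp u 2 (vol Ω)) (hu' : MemLp u' 2 (vol Ω))
    (hG : MemLp G 2 (vol Ω)) (hG' : MemLp G' 2 (vol Ω)) :
    HasWeakGradient Ω (u + u') (G + G') := by
  intro φ h1 h2 h3
  have hc : ContDiff ℝ 1 φ := h1.of_le (by exact_mod_cast le_top)
  simp only [Pi.add_apply, add_smul, smul_add]
  rw [integral_add (integrableOn_smul_gradient hu hc h2) (integrableOn_smul_gradient hu' hc h2),
    integral_add (integrableOn_mul_test hG h1.continuous h2)
      (integrableOn_mul_test hG' h1.continuous h2), h φ h1 h2 h3, h' φ h1 h2 h3]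
  abel

lemma HasWeakGradient.smul {Ω : Set Plane} {u : Plane → ℝ} {G : Plane → Plane}
    (h : HasWeakGradient Ω u G) (c : ℝ) : HasWeakGradient Ω (c • u) (c • G) := by
  intro φ h1 h2 h3
  have e1 : ∫ x in Ω, (c • u) x • ∇ φ x = c • ∫ x in Ω, u x • ∇ φ x := by
    rw [← integral_smul]
    simp [mul_smul]
  have e2 : ∫ x in Ω, φ x • (c • G) x = c • ∫ x in Ω, φ x • G x := by
    rw [← integral_smul]
    congr 1
    ext1 x
    exact smul_comm (φ x) c (G x)
  rw [e1, e2, h φ h1 h2 h3, smul_neg]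

lemma HasTrace.congr {Ω Γ : Set Plane} {u u' : Plane → ℝ} {G G' : Plane → Plane} {g : Plane → ℝ}
    (h : HasTrace Ω Γ u G g) (hu : u =ᵐ[vol Ω] u') (hG : G =ᵐ[vol Ω] G') :
    HasTrace Ω Γ u' G' g := by
  obtain ⟨w, h1, h2, h3, h4⟩ := h
  refine ⟨w, h1, ?_, ?_, h4⟩
  · refine h2.congr fun n ↦ eLpNorm_congr_ae ?_
    filter_upwards [hu] with x hx
    simp [hx]
  · refine h3.congr fun n ↦ eLpNorm_congr_ae ?_
    filter_upwards [hG] with x hx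
    simp [hx]

lemma tendsto_eLpNorm_add {F : Type*} [NormedAddCommGroup F] {μ : Measure Plane}
    {f f' : ℕ → Plane → F} {a a' : Plane → F}
    (hf : ∀ n, AEStronglyMeasurable (f n - a) μ) (hf' : ∀ n, AEStronglyMeasurable (f' n - a') μ)
    (h : Tendsto (fun n ↦ eLpNorm (f n - a) 2 μ) atTop (𝓝 0))
    (h' : Tendsto (fun n ↦ eLpNorm (f' n - a') 2 μ) atTop (𝓝 0)) :
    Tendsto (fun n ↦ eLpNorm (f n + f' n - (a + a')) 2 μ) atTop (𝓝 0) := by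
  refine tendsto_of_tendsto_of_tendsto_of_le_of_le tendsto_const_nhds (by simpa using h.add h')
    (fun _ ↦ zero_le) fun n ↦ ?_
  have : f n + f' n - (a + a') = (f n - a) + (f' n - a') := by abel
  simp only [this]
  exact eLpNorm_add_le (hf n) (hf' n) (by norm_num)

lemma tendsto_eLpNorm_smul {F : Type*} [NormedAddCommGroup F] [NormedSpace ℝ F]
    {μ : Measure Plane} {f : ℕ → Plane → F} {a : Plane → F} (c : ℝ)
    (h : Tendsto (fun n ↦ eLpNorm (f n - a) 2 μ) atTop (𝓝 0)) :
    Tendsto (fun n ↦ eLpNorm (c • f n - c • a) 2 μ) atTop (𝓝 0) := by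
  have : ∀ n, eLpNorm (c • f n - c • a) 2 μ = ‖c‖ₑ * eLpNorm (f n - a) 2 μ := fun n ↦ by
    rw [← smul_sub, eLpNorm_const_smul]
  simp only [this]
  simpa using ENNReal.Tendsto.const_mul h (Or.inr (by simp))

lemma HasTrace.add {Ω Γ : Set Plane} {u u' : Plane → ℝ} {G G' : Plane → Plane}
    (h : HasTrace Ω Γ u G 0) (h' : HasTrace Ω Γ u' G' 0)
    (hu : MemLp u 2 (vol Ω)) (hu' : MemLp u' 2 (vol Ω))
    (hG : MemLp G 2 (vol Ω)) (hG' : MemLp G' 2 (vol Ω)) :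
    HasTrace Ω Γ (u + u') (G + G') 0 := by
  obtain ⟨w, h1, h2, h3, h4⟩ := h
  obtain ⟨w', h1', h2', h3', h4'⟩ := h'
  have hgrad : ∀ n, ∇ (w n + w' n) = ∇ (w n) + ∇ (w' n) := fun n ↦ by
    ext1 x
    have := ((h1 n).differentiable one_ne_zero x).hasGradientAt.hasFDerivAt.add
      ((h1' n).differentiable one_ne_zero x).hasGradientAt.hasFDerivAt
    rw [← map_add] at this
    exact HasGradientAt.gradient (hasGradientAt_iff_hasFDerivAt.mpr this)
  refine ⟨fun n ↦ w n + w' n, fun n ↦ (h1 n).add (h1' n), ?_, ?_, ?_⟩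
  · exact tendsto_eLpNorm_add
      (fun n ↦ ((h1 n).continuous.aestronglyMeasurable).sub hu.aestronglyMeasurable)
      (fun n ↦ ((h1' n).continuous.aestronglyMeasurable).sub hu'.aestronglyMeasurable) h2 h2'
  · simp only [hgrad]
    exact tendsto_eLpNorm_add
      (fun n ↦ ((continuous_gradient (h1 n)).aestronglyMeasurable).sub hG.aestronglyMeasurable)
      (fun n ↦ ((continuous_gradient (h1' n)).aestronglyMeasurable).sub hG'.aestronglyMeasurable)
      h3 h3'
  · have := tendsto_eLpNorm_add (a := 0) (a' := 0)
      (fun n ↦ by rw [sub_zero]; exact (h1 n).continuous.aestronglyMeasurable)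
      (fun n ↦ by rw [sub_zero]; exact (h1' n).continuous.aestronglyMeasurable) h4 h4'
    simpa using this

lemma HasTrace.smul {Ω Γ : Set Plane} {u : Plane → ℝ} {G : Plane → Plane}
    (h : HasTrace Ω Γ u G 0) (c : ℝ) : HasTrace Ω Γ (c • u) (c • G) 0 := by
  obtain ⟨w, h1, h2, h3, h4⟩ := h
  have hgrad : ∀ n, ∇ (c • w n) = c • ∇ (w n) := fun n ↦ by
    ext1 x
    have := ((h1 n).differentiable one_ne_zero x).hasGradientAt.hasFDerivAt.const_smul c
    have e : c • (InnerProductSpace.toDual ℝ Plane) (∇ (w n) x) =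
        (InnerProductSpace.toDual ℝ Plane) (c • ∇ (w n) x) := by simp
    rw [e] at this
    exact HasGradientAt.gradient (hasGradientAt_iff_hasFDerivAt.mpr this)
  refine ⟨fun n ↦ c • w n, fun n ↦ contDiff_const.smul (h1 n), tendsto_eLpNorm_smul c h2, ?_, ?_⟩
  · simp only [hgrad]
    exact tendsto_eLpNorm_smul c h3
  · simpa using tendsto_eLpNorm_smul c h4

/-- The form domain `H¹_b(Ω) = {u ∈ H¹(Ω) | u|Γⱼ = 0 whenever bⱼ = d}`, for boundary parts `Γⱼ`
with boundary conditions `bⱼ`. It is realized as the space of the pairs `(u, ∇u)`, where `u` is in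
`L²(Ω)` and its weak gradient `∇u` is in `L²(Ω; ℝ²)`. -/
def H1 {ι : Type} (Ω : Set Plane) (Γ : ι → Set Plane) (b : ι → BC) :
    Submodule ℝ (L2 Ω × L2Vec Ω) where
  carrier := {p | HasWeakGradient Ω p.1 p.2 ∧ ∀ j, b j = BC.d → HasTrace Ω (Γ j) p.1 p.2 0}
  zero_mem' := by
    have e1 : (0 : Plane → ℝ) =ᵐ[vol Ω] ((0 : L2 Ω × L2Vec Ω).1 : Plane → ℝ) :=
      (Lp.coeFn_zero ℝ 2 (vol Ω)).symm
    have e2 : (0 : Plane → Plane) =ᵐ[vol Ω] ((0 : L2 Ω × L2Vec Ω).2 : Plane → Plane) :=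
      (Lp.coeFn_zero Plane 2 (vol Ω)).symm
    refine ⟨HasWeakGradient.congr (fun φ _ _ _ ↦ by simp) e1 e2, fun j _ ↦ ?_⟩
    have hgrad : ∇ (0 : Plane → ℝ) = 0 := by
      ext1 x
      exact gradient_const x (0 : ℝ)
    exact HasTrace.congr ⟨fun _ ↦ 0, fun _ ↦ contDiff_const, by simp, by simp [hgrad],
      by simp⟩ e1 e2
  add_mem' := by
    rintro p q ⟨hp, hp'⟩ ⟨hq, hq'⟩
    have e1 := (Lp.coeFn_add p.1 q.1).symm
    have e2 := (Lp.coeFn_add p.2 q.2).symm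
    exact ⟨(hp.add hq (Lp.memLp _) (Lp.memLp _) (Lp.memLp _) (Lp.memLp _)).congr e1 e2,
      fun j hj ↦ ((hp' j hj).add (hq' j hj) (Lp.memLp _) (Lp.memLp _) (Lp.memLp _)
        (Lp.memLp _)).congr e1 e2⟩
  smul_mem' := by
    rintro c p ⟨hp, hp'⟩
    have e1 := (Lp.coeFn_smul c p.1).symm
    have e2 := (Lp.coeFn_smul c p.2).symm
    exact ⟨(hp.smul c).congr e1 e2, fun j hj ↦ ((hp' j hj).smul c).congr e1 e2⟩

/-- The eigenspace `E(μ, (Ω, b))` of `-Δ` in `Ω` with boundary conditions `bⱼ` on `Γⱼ`: the space of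
all `u ∈ H¹_b(Ω)` such that `∫_Ω ∇u · ∇v = μ ∫_Ω u v` for all `v ∈ H¹_b(Ω)` (with `0`; it is `{0}`
when `μ` is not an eigenvalue). The inner products below are those of `L²(Ω; ℝ²)` and `L²(Ω)`. -/
def eigenspace {ι : Type} (Ω : Set Plane) (Γ : ι → Set Plane) (b : ι → BC) (μ : ℝ) :
    Submodule ℝ (L2 Ω) where
  carrier := {u | ∃ G : L2Vec Ω, (u, G) ∈ H1 Ω Γ b ∧
    ∀ v : L2 Ω, ∀ H : L2Vec Ω, (v, H) ∈ H1 Ω Γ b → inner ℝ G H = μ * inner ℝ u v}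
  zero_mem' := ⟨0, (H1 Ω Γ b).zero_mem, fun v H _ ↦ by simp⟩
  add_mem' := by
    rintro u u' ⟨G, h1, h2⟩ ⟨G', h1', h2'⟩
    refine ⟨G + G', (H1 Ω Γ b).add_mem h1 h1', fun v H h ↦ ?_⟩
    rw [inner_add_left, inner_add_left, h2 v H h, h2' v H h, mul_add]
  smul_mem' := by
    rintro c u ⟨G, h1, h2⟩
    refine ⟨c • G, (H1 Ω Γ b).smul_mem c h1, fun v H h ↦ ?_⟩
    rw [real_inner_smul_left, real_inner_smul_left, h2 v H h]
    ring

/-! ### Convex polygons -/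

section Polygon

variable {k : ℕ} [NeZero k]

/-- The open convex polygon with the given vertices. -/
def polygon (v : Fin k → Plane) : Set Plane := interior (convexHull ℝ (Set.range v))

/-- The `j`-th side joins the `j`-th vertex to the next one (cyclically). -/
def side (v : Fin k → Plane) (j : Fin k) : Set Plane := segment ℝ (v j) (v (j + 1))

/-- The eigenspace `E(μ, (P, b₀ b₁ ⋯))` of the convex polygon `P` with vertices `v`, with the
boundary condition `bⱼ` on the `j`-th side. -/
def polygonEigenspace (v : Fin k → Plane) (b : Fin k → BC) (μ : ℝ) : Submodule ℝ (L2 (polygon v)) :=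
  eigenspace (polygon v) (side v) b μ

/-- The set of eigenvalues of `-Δ` for `(P, b₀ b₁ ⋯)`. -/
def polygonSpectrum (v : Fin k → Plane) (b : Fin k → BC) : Set ℝ :=
  {μ | polygonEigenspace v b μ ≠ ⊥}

/-- The multiplicity of `μ` as eigenvalue for `(P, b₀ b₁ ⋯)`: the dimension of the eigenspace,
which is zero when `μ` is not an eigenvalue. -/
def polygonMult (v : Fin k → Plane) (b : Fin k → BC) (μ : ℝ) : Cardinal :=
  Module.rank ℝ (polygonEigenspace v b μ)

end Polygon

/-- Restriction `φ ↦ φ|T` of square integrable functions from `Ω` to a subset `T`. -/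
def restrictL2 {T Ω : Set Plane} (h : T ⊆ Ω) (φ : L2 Ω) : L2 T :=
  MemLp.toLp φ ((Lp.memLp φ).mono_measure (Measure.restrict_mono h le_rfl))

/-! ### The equilateral rhombus and its decompositions -/

/-- The end points of the longer diagonal `D` of the rhombus. -/
def dEnd : Fin 2 → Plane := ![!₂[0, 0], !₂[3 / 2, √3 / 2]]

/-- The end points of the shorter diagonal `M` of the rhombus. -/
def mEnd : Fin 2 → Plane := ![!₂[1, 0], !₂[1 / 2, √3 / 2]]

/-- The centre of the rhombus, where the diagonals meet. -/
def centre : Plane := !₂[3 / 4, √3 / 4]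

/-- The vertices of the equilateral rhombus, in cyclic order. -/
def rhombusV : Fin 4 → Plane := ![dEnd 0, mEnd 0, dEnd 1, mEnd 1]

/-- The two equilateral triangles into which `M` divides the rhombus. The last side is `M`, the
first two sides are sides of the rhombus. -/
def equiV (i : Fin 2) : Fin 3 → Plane := ![mEnd 0, dEnd i, mEnd 1]

/-- The four hemiequilateral triangles into which `D` and `M` divide the rhombus. The sides are
numbered in decreasing order of length: the first one (of length `1`) is a side of the rhombus, the
second one (of length `√3 / 2`) is half of `D`, the third one (of length `1 / 2`) half of `M`. -/
def hemiV (i j : Fin 2) : Fin 3 → Plane := ![mEnd j, dEnd i, centre]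

/-- The open equilateral rhombus. -/
abbrev rhombus : Set Plane := polygon rhombusV

/-- The eigenspace of the rhombus, with the boundary condition `a` on its whole boundary. -/
def rhombusEigenspace (a : BC) (μ : ℝ) : Submodule ℝ (L2 rhombus) :=
  polygonEigenspace rhombusV (fun _ ↦ a) μ

/-- The mirror symmetry with respect to the line supporting the diagonal `D`. -/
def reflD (x : Plane) : Plane := EuclideanGeometry.reflection (line[ℝ, dEnd 0, dEnd 1]) x

/-- The mirror symmetry with respect to the line supporting the diagonal `M`. -/
def reflM (x : Plane) : Plane := EuclideanGeometry.reflection (line[ℝ, mEnd 0, mEnd 1]) x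

/-- The functions `φ ∈ L²(Rh)` with `φ ∘ M = τ φ`. -/
def symM (τ : ℝ) : Set (L2 rhombus) := {φ | ∀ᵐ x ∂vol rhombus, φ (reflM x) = τ * φ x}

/-- The functions `φ ∈ L²(Rh)` with `φ ∘ D = σ φ` and `φ ∘ M = τ φ`. -/
def symDM (σ τ : ℝ) : Set (L2 rhombus) :=
  {φ | (∀ᵐ x ∂vol rhombus, φ (reflD x) = σ * φ x) ∧ ∀ᵐ x ∂vol rhombus, φ (reflM x) = τ * φ x}

lemma dEnd_mem (i : Fin 2) : dEnd i ∈ convexHull ℝ (Set.range rhombusV) :=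
  subset_convexHull ℝ _ (by fin_cases i; exacts [⟨0, rfl⟩, ⟨2, rfl⟩])

lemma mEnd_mem (i : Fin 2) : mEnd i ∈ convexHull ℝ (Set.range rhombusV) :=
  subset_convexHull ℝ _ (by fin_cases i; exacts [⟨1, rfl⟩, ⟨3, rfl⟩])

lemma centre_mem : centre ∈ convexHull ℝ (Set.range rhombusV) := by
  have h := convex_convexHull ℝ (Set.range rhombusV) (dEnd_mem 0) (dEnd_mem 1)
    (a := 1 / 2) (b := 1 / 2) (by norm_num) (by norm_num) (by norm_num)
  convert h using 1
  ext l
  fin_cases l <;> simp [centre, dEnd] <;> ring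

lemma equi_subset (i : Fin 2) : polygon (equiV i) ⊆ rhombus := by
  refine interior_mono (convexHull_min ?_ (convex_convexHull ℝ _))
  rintro _ ⟨l, rfl⟩
  fin_cases l
  exacts [mEnd_mem 0, dEnd_mem i, mEnd_mem 1]

lemma hemi_subset (i j : Fin 2) : polygon (hemiV i j) ⊆ rhombus := by
  refine interior_mono (convexHull_min ?_ (convex_convexHull ℝ _))
  rintro _ ⟨l, rfl⟩
  fin_cases l
  exacts [mEnd_mem j, dEnd_mem i, centre_mem]

end EquilateralRhombus

end

open EquilateralRhombus

namespace EquilateralRhombus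

/-! Let `Ω` be convex, symmetric under a mirror `σ`, and let `T` be one of its halves. For a sign
`τ`, two operators link `L²(T)` and `L²(Ω)`: the extension `E` by `u(σ x) = τ u(x)` (`ext`), and the
folding `F v = v + τ v ∘ σ` restricted to `T` (`fold`). They are adjoint (`inner_ext`), for
functions and also for gradients once the linear part of `σ` acts on the values. If both respect the
form domains, then `⟨∇Eu, ∇v⟩ = ⟨∇u, ∇Fv⟩ = μ⟨u, Fv⟩ = μ⟨Eu, v⟩` for an eigenfunction `u` on `T`, so
`E` carries eigenfunctions to eigenfunctions; reading the same identity from the other side, so does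
`F`. On functions of parity `τ`, `F` is twice the restriction and `E` inverts the restriction, which
gives the bijections (`bijOn_restrict`). Without any symmetry, the even and odd foldings together
identify an eigenspace on `Ω` with the product of two eigenspaces on `T`, so multiplicities add
(`rank_eigenspace_eq`).

The analytic work is that `E` and `F` preserve `H¹` and the Dirichlet conditions (`ext_mem_H1`,
`fold_mem_H1`). An extension could acquire a singular gradient on the mirror line. Tangential
derivatives produce none; the normal one produces none either, because the jump cancels in the even
case and the trace vanishes in the odd case (`hasWeakGradient_ext`). Zero traces are defined through
one approximating sequence, so they can be transported only if they do not depend on that sequence.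
This rests on the density of `C¹` functions in `H¹` of a convex domain (`exists_tendstoH1`) and on a
trace inequality (`trace_le_of_segment`).

The scheme is applied twice: `M` halves the rhombus into equilateral triangles, and `D` halves each
of these into hemiequilateral ones. As the two mirrors commute, `D`-parity of an `M`-symmetric
function can be read off on one equilateral triangle. Coordinates along the half diagonals turn both
mirrors into sign changes. -/

/-! ### Density of `C¹` functions in `H¹` of a convex domain -/

/-- The Jacobian in the plane is `s²`, so the `L²` norm is divided by `s`. A bound uniform for `s`
near `1` is all that is needed. -/
lemma eLpNorm_comp_affine_le {F : Type*} [NormedAddCommGroup F] {f : Plane → F}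
    (hf : AEStronglyMeasurable f volume) {s : ℝ} (hs : 1 / 2 ≤ s) (z : Plane) :
    AEStronglyMeasurable (fun x ↦ f (s • x + z)) volume ∧
      eLpNorm (fun x ↦ f (s • x + z)) 2 volume ≤ 2 * eLpNorm f 2 volume := by
  have hs0 : s ≠ 0 := by linarith
  have hmap : (volume : Measure Plane).map (fun x ↦ s • x + z) =
      ENNReal.ofReal |(s ^ 2)⁻¹| • volume := by
    have h1 := Measure.map_addHaar_smul (volume : Measure Plane) hs0
    have h2 : (fun x : Plane ↦ s • x + z) = (fun x ↦ x + z) ∘ (s • ·) := rfl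
    rw [h2, ← Measure.map_map (measurable_add_const z) (measurable_const_smul s), h1,
      Measure.map_smul, map_add_right_eq_self]
    simp
  have hm : AEMeasurable (fun x : Plane ↦ s • x + z) volume := by fun_prop
  have hf' : AEStronglyMeasurable f ((volume : Measure Plane).map (fun x ↦ s • x + z)) := by
    rw [hmap]
    exact hf.smul_measure _
  refine ⟨hf'.comp_aemeasurable hm, ?_⟩
  have := eLpNorm_map_measure (p := 2) hf' hm
  change _ = eLpNorm (fun x ↦ f (s • x + z)) 2 volume at this
  rw [← this, hmap, eLpNorm_smul_measure_of_ne_top (by norm_num), smul_eq_mul]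
  gcongr
  have h4 : ENNReal.ofReal |(s ^ 2)⁻¹| ≤ 2 ^ (2 : ℝ) := by
    rw [abs_of_nonneg (by positivity)]
    have : (2 : ℝ≥0∞) ^ (2 : ℝ) = ENNReal.ofReal 4 := by
      norm_num
    rw [this]
    apply ENNReal.ofReal_le_ofReal
    rw [inv_le_comm₀ (by positivity) (by norm_num)]
    nlinarith
  calc _ ≤ ((2 : ℝ≥0∞) ^ (2 : ℝ)) ^ (1 / (2 : ℝ≥0∞)).toReal := by gcongr
    _ = 2 := by
      rw [← ENNReal.rpow_mul]
      norm_num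

/-- Uniform continuity makes the difference uniformly small, and its support stays in a fixed ball
while the dilation and translation are close to the identity. -/
lemma tendsto_eLpNorm_affine_of_continuous {F : Type*} [NormedAddCommGroup F]
    {g : Plane → F} (hc : Continuous g) (hs : HasCompactSupport g) :
    Tendsto (fun q : ℝ × Plane ↦ eLpNorm (fun x ↦ g (q.1 • x + q.2) - g x) 2 volume)
      (𝓝 (1, 0)) (𝓝 0) := by
  obtain ⟨r, hr⟩ := hs.isCompact.isBounded.subset_closedBall (0 : Plane)
  have huc := Metric.uniformContinuous_iff.mp (hs.uniformContinuous_of_continuous hc)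
  -- If `‖x‖ > 2 (|r| + 1)`, a dilation by `s > 1/2` followed by a translation of length less than
  -- `1` still leaves the image at norm greater than `|r|`, outside the support of `g`.
  set K : Set Plane := Metric.closedBall 0 (2 * (|r| + 1)) with hK
  have hKfin : volume K ≠ ⊤ := (isCompact_closedBall _ _).measure_lt_top.ne
  have key : ∀ ε > 0, ∀ᶠ q : ℝ × Plane in 𝓝 (1, 0),
      eLpNorm (fun x ↦ g (q.1 • x + q.2) - g x) 2 volume
        ≤ volume K ^ (2 : ℝ≥0∞).toReal⁻¹ * ENNReal.ofReal ε := by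
    intro ε hε
    obtain ⟨δ, hδ, hu⟩ := huc ε hε
    have e1 : ∀ᶠ q : ℝ × Plane in 𝓝 (1, 0), |q.1 - 1| * (2 * (|r| + 1)) + ‖q.2‖ < δ := by
      have : ContinuousAt (fun q : ℝ × Plane ↦ |q.1 - 1| * (2 * (|r| + 1)) + ‖q.2‖) (1, 0) := by
        fun_prop
      exact this.eventually_lt_const (by simpa using hδ)
    have e2 : ∀ᶠ q : ℝ × Plane in 𝓝 (1, 0), 1 / 2 < q.1 :=
      continuousAt_fst.eventually_const_lt (by norm_num)
    have e3 : ∀ᶠ q : ℝ × Plane in 𝓝 (1, 0), ‖q.2‖ < 1 :=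
      (continuousAt_snd.norm).eventually_lt_const (by simp)
    filter_upwards [e1, e2, e3] with q h1 h2 h3
    have hzero : ∀ x, r < ‖x‖ → g x = 0 := fun x hx ↦ by
      by_contra h
      have := hr (subset_tsupport g h)
      rw [mem_closedBall_zero_iff] at this
      linarith
    have hsupp : Function.support (fun x ↦ g (q.1 • x + q.2) - g x) ⊆ K := by
      intro x hx
      by_contra hxK
      rw [hK, mem_closedBall_zero_iff, not_le] at hxK
      have := le_abs_self r
      have := abs_nonneg r
      have h4 : q.1 * ‖x‖ - ‖q.2‖ ≤ ‖q.1 • x + q.2‖ := by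
        have := norm_sub_le_norm_add (q.1 • x) q.2
        rwa [norm_smul, Real.norm_of_nonneg (by linarith)] at this
      refine hx ?_
      simp only
      rw [hzero x (by linarith), hzero (q.1 • x + q.2) (by nlinarith), sub_zero]
    rw [← eLpNorm_restrict_eq_of_support_subset hsupp]
    refine (eLpNorm_le_of_ae_bound (C := ε) ?_).trans (by simp)
    refine (ae_restrict_iff' Metric.isClosed_closedBall.measurableSet).mpr (.of_forall ?_)
    intro x hx
    rw [← dist_eq_norm]
    refine (hu ?_).le
    rw [dist_eq_norm]
    have : q.1 • x + q.2 - x = (q.1 - 1) • x + q.2 := by module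
    rw [this]
    refine (norm_add_le _ _).trans_lt (lt_of_le_of_lt ?_ h1)
    rw [norm_smul, Real.norm_eq_abs]
    gcongr
    exact mem_closedBall_zero_iff.mp hx
  rw [ENNReal.tendsto_nhds_zero]
  intro ε hε
  have hlim : Tendsto (fun t : ℝ ↦ volume K ^ (2 : ℝ≥0∞).toReal⁻¹ * ENNReal.ofReal t)
      (𝓝[>] 0) (𝓝 0) := by
    have h0 : Tendsto (fun t : ℝ ↦ ENNReal.ofReal t) (𝓝[>] 0) (𝓝 0) := by
      have := (ENNReal.continuous_ofReal.tendsto 0).mono_left (nhdsWithin_le_nhds (s := Set.Ioi 0))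
      simpa using this
    have := ENNReal.Tendsto.const_mul (a := volume K ^ (2 : ℝ≥0∞).toReal⁻¹) h0
      (Or.inr (ENNReal.rpow_ne_top_of_nonneg (by simp) hKfin))
    simpa using this
  obtain ⟨t, ht, ht0⟩ := ((ENNReal.tendsto_nhds_zero.mp hlim ε hε).and
    self_mem_nhdsWithin).exists
  exact (key t ht0).mono fun q hq ↦ hq.trans ht

/-- Continuity in `L²` by density of compactly supported continuous functions. The affine change of
variables at most doubles the approximation error, whence the budget `2 · ε/4 + ε/4 + ε/4`. -/
lemma tendsto_eLpNorm_affine {F : Type*} [NormedAddCommGroup F] [NormedSpace ℝ F]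
    {f : Plane → F} (hf : MemLp f 2 volume) :
    Tendsto (fun q : ℝ × Plane ↦ eLpNorm (fun x ↦ f (q.1 • x + q.2) - f x) 2 volume)
      (𝓝 (1, 0)) (𝓝 0) := by
  rw [ENNReal.tendsto_nhds_zero]
  intro ε hε
  have hε' : ε / 4 ≠ 0 := (ENNReal.div_pos hε.ne' (by norm_num)).ne'
  obtain ⟨g, hgs, hfg, hgc, hg⟩ := hf.exists_hasCompactSupport_eLpNorm_sub_le (by norm_num) hε'
  have e2 : ∀ᶠ q : ℝ × Plane in 𝓝 (1, 0), 1 / 2 < q.1 :=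
    continuousAt_fst.eventually_const_lt (by norm_num)
  filter_upwards [ENNReal.tendsto_nhds_zero.mp (tendsto_eLpNorm_affine_of_continuous hgc hgs)
    (ε / 4) (pos_iff_ne_zero.mpr hε'), e2] with q h1 h2
  obtain ⟨m1, b1⟩ := eLpNorm_comp_affine_le
    (hf.aestronglyMeasurable.sub hg.aestronglyMeasurable) h2.le q.2
  have m2 : AEStronglyMeasurable (fun x ↦ g (q.1 • x + q.2) - g x) volume := by
    exact ((hgc.comp (by fun_prop)).sub hgc).aestronglyMeasurable
  have m3 : AEStronglyMeasurable (fun x ↦ g x - f x) volume :=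
    hg.aestronglyMeasurable.sub hf.aestronglyMeasurable
  have h3 : eLpNorm (fun x ↦ g x - f x) 2 volume ≤ ε / 4 := by
    rw [show (fun x ↦ g x - f x) = g - f from rfl, eLpNorm_sub_comm]
    exact hfg
  have e : (fun x ↦ f (q.1 • x + q.2) - f x) = (fun x ↦ (f - g) (q.1 • x + q.2)) +
      ((fun x ↦ g (q.1 • x + q.2) - g x) + fun x ↦ g x - f x) := by
    ext1 x
    simp
  rw [e]
  refine (eLpNorm_add_le m1 (m2.add m3) (by norm_num)).trans ?_
  refine (add_le_add b1 ((eLpNorm_add_le m2 m3 (by norm_num)).trans (add_le_add h1 h3))).trans ?_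
  refine (add_le_add_left (mul_le_mul_right hfg 2) _).trans ?_
  rw [← two_mul, ← add_mul]
  norm_num
  rw [ENNReal.mul_div_cancel (by norm_num) (by norm_num)]

lemma eLpNorm_two_sq {α F : Type*} [MeasurableSpace α] [NormedAddCommGroup F] {μ : Measure α}
    (f : α → F) : eLpNorm f 2 μ ^ 2 = ∫⁻ x, ‖f x‖ₑ ^ 2 ∂μ := by
  have := eLpNorm_nnreal_pow_eq_lintegral (p := 2) (μ := μ) (f := f) two_ne_zero
  norm_num at this
  exact_mod_cast this

lemma enorm_integral_sq_le {α F : Type*} [MeasurableSpace α] [NormedAddCommGroup F]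
    [NormedSpace ℝ F] {μ : Measure α} [IsProbabilityMeasure μ] {f : α → F}
    (hf : AEStronglyMeasurable f μ) : ‖∫ x, f x ∂μ‖ₑ ^ 2 ≤ ∫⁻ x, ‖f x‖ₑ ^ 2 ∂μ := by
  rw [← eLpNorm_two_sq]
  gcongr
  refine (enorm_integral_le_lintegral_enorm f).trans ?_
  rw [← eLpNorm_one_eq_lintegral_enorm]
  exact eLpNorm_le_eLpNorm_of_exponent_le (by norm_num) hf

/-- Mollification of a function on the plane. -/
noncomputable abbrev mollify {F : Type*} [NormedAddCommGroup F] [NormedSpace ℝ F] (ρ : Plane → ℝ)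
    (f : Plane → F) : Plane → F :=
  convolution ρ f (ContinuousLinearMap.lsmul ℝ ℝ) volume

/-- A mollification is an average of translates for the probability measure `ρ dy`, so Jensen and
Tonelli bound its `L²` error by the worst error of a single translate. The affine map is included
because the approximants below are dilated as well as mollified. -/
lemma eLpNorm_mollify_sub_le {F : Type*} [NormedAddCommGroup F] [NormedSpace ℝ F]
    [CompleteSpace F]
    {f : Plane → F} (hm : StronglyMeasurable f) (hf : MemLp f 2 volume)
    {ρ : Plane → ℝ} (h0 : ∀ x, 0 ≤ ρ x) (hc : Continuous ρ) (hs : HasCompactSupport ρ)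
    (h1 : ∫ x, ρ x = 1) (s : ℝ) (b : Plane) {ε : ℝ≥0∞}
    (h : ∀ y, ρ y ≠ 0 → eLpNorm (fun x ↦ f (s • x + (b - y)) - f x) 2 volume ≤ ε) :
    eLpNorm (fun x ↦ mollify ρ f (s • x + b) - f x) 2 volume ≤ ε := by
  have hint : Integrable ρ volume := hc.integrable_of_hasCompactSupport hs
  have hmeas : Measurable (fun y ↦ ENNReal.ofReal (ρ y)) :=
    ENNReal.measurable_ofReal.comp hc.measurable
  set ν : Measure Plane := volume.withDensity (fun y ↦ ENNReal.ofReal (ρ y)) with hν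
  have hprob : IsProbabilityMeasure ν := by
    constructor
    rw [hν, withDensity_apply _ MeasurableSet.univ, Measure.restrict_univ,
      ← ofReal_integral_eq_lintegral_ofReal hint (.of_forall h0), h1, ENNReal.ofReal_one]
  have hconv : ConvolutionExists ρ f (ContinuousLinearMap.lsmul ℝ ℝ) volume :=
    hs.convolutionExists_left _ hc (hf.locallyIntegrable (by norm_num))
  have hrep : ∀ x, mollify ρ f (s • x + b) - f x =
      ∫ y, (f (s • x + (b - y)) - f x) ∂ν := fun x ↦ by
    rw [hν, integral_withDensity_eq_integral_toReal_smul hmeas (by simp)]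
    simp only [ENNReal.toReal_ofReal (h0 _), smul_sub]
    have e : ∀ y, s • x + (b - y) = s • x + b - y := fun y ↦ by abel
    simp only [e]
    rw [integral_sub, integral_smul_const, h1, one_smul]
    · rfl
    · exact hconv (s • x + b)
    · exact hint.smul_const (f x)
  -- Joint measurability in both variables, required for Tonelli, is the reason for assuming `f`
  -- strongly measurable and not merely so almost everywhere.
  have hjm : StronglyMeasurable (fun z : Plane × Plane ↦ f (s • z.1 + (b - z.2)) - f z.1) := by
    refine StronglyMeasurable.sub (hm.comp_measurable (by fun_prop)) (hm.comp_measurable (by fun_prop))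
  have : eLpNorm (fun x ↦ mollify ρ f (s • x + b) - f x) 2 volume ^ 2 ≤ ε ^ 2 := by
    rw [eLpNorm_two_sq]
    calc _ ≤ ∫⁻ x, ∫⁻ y, ‖f (s • x + (b - y)) - f x‖ₑ ^ 2 ∂ν := by
          refine lintegral_mono fun x ↦ ?_
          simp only [hrep]
          exact enorm_integral_sq_le
            (hjm.comp_measurable measurable_prodMk_left).aestronglyMeasurable
      _ = ∫⁻ y, (∫⁻ x, ‖f (s • x + (b - y)) - f x‖ₑ ^ 2) ∂ν := by
          exact lintegral_lintegral_swap
            (f := fun x y ↦ ‖f (s • x + (b - y)) - f x‖ₑ ^ 2)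
            (hjm.enorm.pow_const 2).aemeasurable
      _ ≤ ∫⁻ y, ε ^ 2 ∂ν := by
          refine lintegral_mono_ae (μ := ν)
            (g := fun _ ↦ ε ^ 2) ?_
          rw [hν, ae_withDensity_iff hmeas]
          refine .of_forall fun y hy ↦ ?_
          rw [← eLpNorm_two_sq]
          gcongr
          exact h y (by rintro h; simp [h] at hy)
      _ = ε ^ 2 := by simp
  exact (ENNReal.pow_le_pow_left_iff two_ne_zero).mp this

lemma gradient_comp_affine {w : Plane → ℝ} {s : ℝ} {b x g : Plane}
    (h : HasGradientAt w g (s • x + b)) :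
    HasGradientAt (fun x ↦ w (s • x + b)) (s • g) x := by
  rw [hasGradientAt_iff_hasFDerivAt] at h ⊢
  have h2 : HasFDerivAt (fun x : Plane ↦ s • x + b) (s • ContinuousLinearMap.id ℝ Plane) x :=
    ((hasFDerivAt_id x).const_smul s).add_const b
  refine (h.comp x h2).congr_fderiv ?_
  ext v
  simp

lemma mollify_contDiff {ρ : Plane → ℝ} (hρ : ContDiff ℝ ∞ ρ) (hs : HasCompactSupport ρ)
    {u : Plane → ℝ} (hu : LocallyIntegrable u volume) : ContDiff ℝ 1 (mollify ρ u) :=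
  (hs.contDiff_convolution_left _ hρ hu).of_le (by exact_mod_cast le_top)

/-- The function `y ↦ ρ (x - y)` is an admissible test function exactly because its support lies in
`Ω`; the weak gradient identity then moves the derivative from `ρ` to `u`. -/
lemma hasGradientAt_mollify {Ω : Set Plane} (hΩ : MeasurableSet Ω) {u : Plane → ℝ}
    {G : Plane → Plane} (hu : MemLp u 2 (vol Ω))
    (h : HasWeakGradient Ω u G) {ρ : Plane → ℝ}
    (hρ : ContDiff ℝ ∞ ρ) (hs : HasCompactSupport ρ) {x : Plane}
    (hx : ∀ y ∈ tsupport ρ, x - y ∈ Ω) :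
    HasGradientAt (mollify ρ (Ω.indicator u)) (mollify ρ (Ω.indicator G) x) x := by
  have hu' : LocallyIntegrable (Ω.indicator u) volume :=
    ((memLp_indicator_iff_restrict hΩ).mpr hu).locallyIntegrable (by norm_num)
  have hρ1 : ContDiff ℝ 1 ρ := hρ.of_le (by exact_mod_cast le_top)
  have hd := hs.hasFDerivAt_convolution_left (ContinuousLinearMap.lsmul ℝ ℝ) hρ1 hu' x
  rw [hasGradientAt_iff_hasFDerivAt]
  refine hd.congr_fderiv ?_
  symm
  set φ : Plane → ℝ := fun y ↦ ρ (x - y) with hφ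
  have c1 : ContDiff ℝ ∞ φ := hρ.comp (contDiff_const.sub contDiff_id)
  have hcl : IsClosedMap (fun y : Plane ↦ x - y) := (Homeomorph.subLeft x).isClosedMap
  have c2 : HasCompactSupport φ := hs.comp_homeomorph (Homeomorph.subLeft x)
  have c3 : tsupport φ ⊆ Ω := by
    intro y hy
    have h2 := tsupport_comp_subset_preimage ρ (f := fun y : Plane ↦ x - y) (by fun_prop) hy
    have := hx _ h2
    simpa using this
  have key := h φ c1 c2 c3
  have hgr : ∀ y, ∇ φ y = -∇ ρ (x - y) := fun y ↦ by
    have h1 := (hρ1.differentiable one_ne_zero (x - y)).hasGradientAt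
    have h2 := gradient_comp_affine (w := ρ) (s := -1) (b := x) (x := y) (g := ∇ ρ (x - y))
      (by convert h1 using 1; module)
    have h3 := h2.gradient
    rw [neg_one_smul] at h3
    rw [← h3, hφ]
    congr 1
    ext1 z
    congr 1
    module
  have k1 : mollify ρ (Ω.indicator G) x = ∫ y in Ω, φ y • G y := by
    rw [mollify, convolution_eq_swap, ← integral_indicator hΩ]
    congr 1
    ext1 y
    by_cases hy : y ∈ Ω <;> simp [hy, hφ]
  rw [k1, ← neg_eq_iff_eq_neg.mpr key]
  have hfc : HasCompactSupport (fderiv ℝ ρ) := hs.fderiv (𝕜 := ℝ)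
  have hfd : Continuous (fderiv ℝ ρ) := hρ1.continuous_fderiv one_ne_zero
  have hce := hfc.convolutionExists_left
    ((ContinuousLinearMap.lsmul ℝ ℝ : ℝ →L[ℝ] ℝ →L[ℝ] ℝ).precompL Plane) hfd hu' x
  have i2 : Integrable (fun y ↦ u y • ∇ φ y) (vol Ω) := integrableOn_smul_gradient hu
    (c1.of_le (by exact_mod_cast le_top)) c2
  ext v
  rw [convolution_eq_swap, ContinuousLinearMap.integral_apply hce.integrable_swap]
  rw [map_neg, neg_apply, InnerProductSpace.toDual_apply_apply, real_inner_comm, ← integral_inner i2,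
    ← integral_neg, ← integral_indicator hΩ]
  congr 1
  ext1 y
  by_cases hy : y ∈ Ω
  · simp only [hy, Set.indicator_of_mem, hgr, smul_neg, inner_neg_right, neg_neg,
      ContinuousLinearMap.precompL_apply, ContinuousLinearMap.lsmul_apply, real_inner_smul_right]
    have := (hρ1.differentiable one_ne_zero (x - y)).hasGradientAt.hasFDerivAt.fderiv
    rw [this]
    simp [mul_comm]
  · simp [hy]

/-- `w n → u` in `H¹(Ω)`, where `G` is the gradient of `u`. -/
def TendstoH1 (Ω : Set Plane) (w : ℕ → Plane → ℝ) (u : Plane → ℝ) (G : Plane → Plane) : Prop :=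
  (∀ n, ContDiff ℝ 1 (w n)) ∧
    Tendsto (fun n ↦ eLpNorm (w n - u) 2 (vol Ω)) atTop (𝓝 0) ∧
    Tendsto (fun n ↦ eLpNorm (∇ (w n) - G) 2 (vol Ω)) atTop (𝓝 0)

-- Near the boundary a mollification would see the jump of the extension of `u` by zero. Contracting
-- first towards an interior point `c`, by `x ↦ (1 - t) x + t c`, leaves room of order `t` around
-- every image by convexity, and mollifying at a smaller scale gives a function that is `C¹` on the
-- whole plane with the right gradient throughout `Ω`.
set_option maxHeartbeats 1000000 in
lemma exists_contDiff_eLpNorm_sub_le {Ω : Set Plane} (hΩ : IsOpen Ω) (hconv : Convex ℝ Ω)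
    (hne : Ω.Nonempty) (u : L2 Ω) (G : L2Vec Ω) (h : HasWeakGradient Ω u G) {ε : ℝ≥0∞}
    (hε : ε ≠ 0) :
    ∃ w : Plane → ℝ, ContDiff ℝ 1 w ∧ eLpNorm (w - (u : Plane → ℝ)) 2 (vol Ω) ≤ ε ∧
      eLpNorm (∇ w - (G : Plane → Plane)) 2 (vol Ω) ≤ ε := by
  obtain ⟨c, hc⟩ := hne
  obtain ⟨r, hr, hball⟩ := Metric.isOpen_iff.mp hΩ c hc
  have hm := hΩ.measurableSet
  set u' : Plane → ℝ := Ω.indicator u with hu'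
  set G' : Plane → Plane := Ω.indicator G with hG'
  have mu : MemLp u' 2 volume := (memLp_indicator_iff_restrict hm).mpr (Lp.memLp u)
  have mG : MemLp G' 2 volume := (memLp_indicator_iff_restrict hm).mpr (Lp.memLp G)
  have su : StronglyMeasurable u' := (Lp.stronglyMeasurable u).indicator hm
  have sG : StronglyMeasurable G' := (Lp.stronglyMeasurable G).indicator hm
  have hε2 : 0 < ε / 4 := ENNReal.div_pos hε (by norm_num)
  have t1 := ENNReal.tendsto_nhds_zero.mp (tendsto_eLpNorm_affine mu) (ε / 4) hε2
  have t2 := ENNReal.tendsto_nhds_zero.mp (tendsto_eLpNorm_affine mG) (ε / 4) hε2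
  have t3 : ∀ᶠ q : ℝ × Plane in 𝓝 (1, 0), ‖q.1 - 1‖ₑ * eLpNorm G' 2 volume ≤ ε / 4 := by
    have h0 : Tendsto (fun q : ℝ × Plane ↦ ‖q.1 - 1‖ₑ) (𝓝 (1, 0)) (𝓝 0) := by
      have : ContinuousAt (fun q : ℝ × Plane ↦ ‖q.1 - 1‖ₑ) (1, 0) := by fun_prop
      simpa [ContinuousAt] using this
    have := ENNReal.Tendsto.mul_const (b := eLpNorm G' 2 volume) h0 (Or.inr mG.eLpNorm_ne_top)
    rw [zero_mul] at this
    exact ENNReal.tendsto_nhds_zero.mp this (ε / 4) hε2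
  obtain ⟨η, hη, hall⟩ := Metric.eventually_nhds_iff.mp ((t1.and t2).and t3)
  -- The bound on `t` keeps every pair `(1 - t, t c - y)` with `‖y‖ ≤ t r / 2` within `η` of the
  -- identity `(1, 0)`.
  obtain ⟨t, ht0, ht1, ht2⟩ : ∃ t : ℝ, 0 < t ∧ t < 1 ∧ t * (1 + ‖c‖ + r) < η := by
    have hp : 0 < 1 + ‖c‖ + r := by positivity
    refine ⟨min (1 / 2) (η / (2 * (1 + ‖c‖ + r))), by positivity,
      (min_le_left _ _).trans_lt (by norm_num), ?_⟩
    calc _ ≤ η / (2 * (1 + ‖c‖ + r)) * (1 + ‖c‖ + r) := by gcongr; exact min_le_right _ _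
      _ = η / 2 := by field_simp
      _ < η := by linarith
  let β : ContDiffBump (0 : Plane) := ⟨t * r / 4, t * r / 2, by positivity, by
    have : 0 < t * r := by positivity
    linarith⟩
  set ρ : Plane → ℝ := β.normed volume with hρ
  have cρ : ContDiff ℝ ∞ ρ := β.contDiff_normed
  have sρ : HasCompactSupport ρ := β.hasCompactSupport_normed
  have pρ : ∀ x, 0 ≤ ρ x := β.nonneg_normed
  have iρ : ∫ x, ρ x = 1 := β.integral_normed
  have tρ : tsupport ρ = Metric.closedBall 0 (t * r / 2) := β.tsupport_normed_eq
  have hq : ∀ y ∈ tsupport ρ, dist ((1 - t, t • c - y) : ℝ × Plane) (1, 0) < η := by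
    intro y hy
    rw [tρ, mem_closedBall_zero_iff] at hy
    have h3 : ‖t • c - y‖ ≤ t * ‖c‖ + t * r / 2 := by
      refine (norm_sub_le _ _).trans ?_
      rw [norm_smul, Real.norm_of_nonneg ht0.le]
      gcongr
    have : 0 < t * r := by positivity
    have : 0 ≤ t * ‖c‖ := by positivity
    rw [Prod.dist_eq, max_lt_iff, dist_eq_norm, dist_eq_norm]
    constructor
    · simp only [sub_sub_cancel_left, norm_neg, Real.norm_of_nonneg ht0.le]
      linarith
    · simp only [sub_zero]
      linarith
  have b1 := eLpNorm_mollify_sub_le su mu pρ cρ.continuous sρ iρ (1 - t) (t • c)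
    (fun y hy ↦ (hall (hq y (subset_tsupport ρ hy))).1.1)
  have b2 := eLpNorm_mollify_sub_le sG mG pρ cρ.continuous sρ iρ (1 - t) (t • c)
    (fun y hy ↦ (hall (hq y (subset_tsupport ρ hy))).1.2)
  have b3 := (hall (hq 0 (by rw [tρ]; simp; positivity))).2
  have hle : ε / 4 + ε / 4 ≤ ε := by
    rw [← two_mul, ← mul_div_assoc, ENNReal.div_le_iff (by norm_num) (by norm_num), mul_comm]
    gcongr
    norm_num
  have hle' : ε / 4 ≤ ε := le_trans (by simp) hle
  have mw := mollify_contDiff cρ sρ (mu.locallyIntegrable (by norm_num))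
  have mwG : Continuous (mollify ρ G') :=
    sρ.continuous_convolution_left _ cρ.continuous (mG.locallyIntegrable (by norm_num))
  refine ⟨fun x ↦ mollify ρ u' ((1 - t) • x + t • c), mw.comp (by fun_prop), ?_, ?_⟩
  · refine le_trans (le_of_eq_of_le (eLpNorm_congr_ae ?_) (eLpNorm_mono_measure _
      (Measure.restrict_le_self))) (b1.trans hle')
    refine (ae_restrict_iff' hm).mpr (.of_forall fun x hx ↦ ?_)
    simp [hu', hx]
  · have hgr : ∀ x ∈ Ω, ∇ (fun x ↦ mollify ρ u' ((1 - t) • x + t • c)) x =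
        (1 - t) • mollify ρ G' ((1 - t) • x + t • c) := by
      intro x hx
      refine (gradient_comp_affine (hasGradientAt_mollify hm (Lp.memLp u) h cρ sρ ?_)).gradient
      intro y hy
      rw [tρ, mem_closedBall_zero_iff] at hy
      -- The point `(1 - t) x + t c - y` is the convex combination of `x` and `c - y / t`, and the
      -- latter lies in the ball around `c` since `‖y‖ ≤ t r / 2`.
      have h5 : c - t⁻¹ • y ∈ Ω := by
        refine hball ?_
        rw [Metric.mem_ball, dist_eq_norm, sub_sub_cancel_left, norm_neg, norm_smul, norm_inv,
          Real.norm_of_nonneg ht0.le, inv_mul_lt_iff₀ ht0]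
        have : 0 < t * r := by positivity
        linarith
      have := hconv hx h5 (a := 1 - t) (b := t) (by linarith) ht0.le (by ring)
      convert this using 1
      rw [smul_sub, smul_inv_smul₀ ht0.ne']
      abel
    -- The chain rule costs a factor `1 - t`; it is split off as an error `-t G'`, controlled by
    -- `b3`.
    have e : eLpNorm (∇ (fun x ↦ mollify ρ u' ((1 - t) • x + t • c)) - (G : Plane → Plane)) 2
          (vol Ω) =
        eLpNorm ((1 - t) • (fun x ↦ mollify ρ G' ((1 - t) • x + t • c) - G' x) + (-t) • G') 2
          (vol Ω) := by
      refine eLpNorm_congr_ae ((ae_restrict_iff' hm).mpr (.of_forall fun x hx ↦ ?_))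
      simp only [Pi.sub_apply, hgr x hx, Pi.add_apply, Pi.smul_apply, hG', Set.indicator_of_mem hx]
      module
    have m1 : AEStronglyMeasurable
        (fun x ↦ mollify ρ G' ((1 - t) • x + t • c) - G' x) volume :=
      (mwG.comp (by fun_prop)).aestronglyMeasurable.sub sG.aestronglyMeasurable
    rw [e]
    refine (eLpNorm_mono_measure _ Measure.restrict_le_self).trans ?_
    refine (eLpNorm_add_le (m1.const_smul _) (sG.aestronglyMeasurable.const_smul _)
      (by norm_num)).trans (le_trans (add_le_add ?_ ?_) hle)
    · rw [eLpNorm_const_smul]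
      refine le_trans ?_ b2
      refine mul_le_of_le_one_left' ?_
      rw [← ofReal_norm, ENNReal.ofReal_le_one, Real.norm_of_nonneg (by linarith)]
      linarith
    · rw [eLpNorm_const_smul]
      simpa using b3

lemma exists_tendstoH1 {Ω : Set Plane} (hΩ : IsOpen Ω) (hconv : Convex ℝ Ω)
    (hne : Ω.Nonempty) (u : L2 Ω) (G : L2Vec Ω) (h : HasWeakGradient Ω u G) :
    ∃ w, TendstoH1 Ω w u G := by
  have hpos : ∀ n : ℕ, ((n : ℝ≥0∞))⁻¹ ≠ 0 := fun n ↦ by simp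
  choose w h1 h2 h3 using fun n : ℕ ↦
    exists_contDiff_eLpNorm_sub_le hΩ hconv hne u G h (hpos n)
  have ht := ENNReal.tendsto_inv_nat_nhds_zero
  exact ⟨w, h1, tendsto_of_tendsto_of_tendsto_of_le_of_le tendsto_const_nhds ht
    (fun _ ↦ zero_le) h2, tendsto_of_tendsto_of_tendsto_of_le_of_le tendsto_const_nhds ht
    (fun _ ↦ zero_le) h3⟩

/-! ### Trace inequality on a segment in the closure of a convex domain -/

/-- Uniqueness of Haar measure: Lebesgue measure in oblique coordinates is a multiple of the
standard one. Only positivity, finiteness and independence of the base point matter, so the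
determinant is never computed. -/
lemma exists_volume_eq_smul_map {e f : Plane} (h : ∀ a b : ℝ, a • e + b • f = 0 → a = 0 ∧ b = 0) :
    ∃ κ : ℝ≥0∞, κ ≠ 0 ∧ κ ≠ ⊤ ∧ ∀ p : Plane, (volume : Measure Plane) =
      κ • (volume : Measure (ℝ × ℝ)).map (fun z ↦ p + (z.1 • e + z.2 • f)) := by
  let Φ₀ : ℝ × ℝ →ₗ[ℝ] Plane :=
    (LinearMap.toSpanSingleton ℝ Plane e).coprod (LinearMap.toSpanSingleton ℝ Plane f)
  have hΦ : ∀ z, Φ₀ z = z.1 • e + z.2 • f := fun z ↦ by simp [Φ₀]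
  have hinj : Function.Injective Φ₀ := by
    rw [← LinearMap.ker_eq_bot, LinearMap.ker_eq_bot']
    intro z hz
    rw [hΦ] at hz
    exact Prod.ext (h _ _ hz).1 (h _ _ hz).2
  let Φ : (ℝ × ℝ) ≃L[ℝ] Plane :=
    (LinearMap.linearEquivOfInjective Φ₀ hinj (by simp)).toContinuousLinearEquiv
  have hΦ' : (Φ : ℝ × ℝ → Plane) = fun z ↦ z.1 • e + z.2 • f := by
    ext1 z
    exact hΦ z
  have hH : ((volume : Measure (ℝ × ℝ)).map Φ).IsAddHaarMeasure :=
    ContinuousLinearEquiv.isAddHaarMeasure_map Φ _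
  refine ⟨(volume : Measure Plane).addHaarScalarFactor ((volume : Measure (ℝ × ℝ)).map Φ),
    ?_, ENNReal.coe_ne_top, fun p ↦ ?_⟩
  · exact_mod_cast (Measure.addHaarScalarFactor_pos_of_isAddHaarMeasure _ _).ne'
  · have h1 := Measure.isAddLeftInvariant_eq_smul (volume : Measure Plane)
      ((volume : Measure (ℝ × ℝ)).map Φ)
    have h2 : (fun z : ℝ × ℝ ↦ p + (z.1 • e + z.2 • f)) = (fun x ↦ p + x) ∘ Φ := by
      rw [hΦ']
      rfl
    rw [h2, ← Measure.map_map (measurable_const_add p) Φ.continuous.measurable]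
    conv_lhs => rw [← map_add_left_eq_self (volume : Measure Plane) p, h1]
    rw [Measure.map_smul]
    rfl

lemma isometry_line {e : Plane} (he : ‖e‖ = 1) (p : Plane) : Isometry (fun a : ℝ ↦ p + a • e) :=
  Isometry.of_dist_eq fun a b ↦ by
    rw [dist_add_left, dist_eq_norm, ← sub_smul, norm_smul, he, mul_one, ← dist_eq_norm]

lemma hausdorffMeasure_restrict_line {e : Plane} (he : ‖e‖ = 1) (p : Plane) {S : Set Plane}
    (hS : S ⊆ Set.range (fun a : ℝ ↦ p + a • e)) :
    (Measure.hausdorffMeasure 1).restrict S =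
      ((volume : Measure ℝ).restrict ((fun a : ℝ ↦ p + a • e) ⁻¹' S)).map
        (fun a : ℝ ↦ p + a • e) := by
  have hi := isometry_line he p
  have hme := hi.isClosedEmbedding.measurableEmbedding
  rw [← hme.restrict_map, ← hausdorffMeasure_real, hi.map_hausdorffMeasure (Or.inl zero_le_one),
    Measure.restrict_restrict_of_subset hS]

/-- Integrating the derivative of `-(1 - b) g²`, which vanishes at `b = 1`, expresses `g(0)²` as an
integral; the cross term is absorbed by Young's inequality. -/
lemma sq_le_integral_of_contDiff {g : ℝ → ℝ} (hg : ContDiff ℝ 1 g) :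
    g 0 ^ 2 ≤ ∫ b in (0 : ℝ)..1, (2 * g b ^ 2 + deriv g b ^ 2) := by
  have hc := hg.continuous
  have hc' := hg.continuous_deriv le_rfl
  have hd : ∀ b, HasDerivAt (fun b ↦ -((1 - b) * g b ^ 2))
      (g b ^ 2 - 2 * (1 - b) * g b * deriv g b) b := fun b ↦ by
    have h1 := ((hg.differentiable one_ne_zero b).hasDerivAt).pow 2
    have h2 := (((hasDerivAt_id b).const_sub 1).mul h1).neg
    refine h2.congr_deriv ?_
    simp
    ring
  have h := intervalIntegral.integral_eq_sub_of_hasDerivAt (a := 0) (b := 1)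
    (fun b _ ↦ hd b) (Continuous.intervalIntegrable (by fun_prop) _ _)
  have : g 0 ^ 2 = ∫ b in (0 : ℝ)..1, (g b ^ 2 - 2 * (1 - b) * g b * deriv g b) := by
    rw [h]
    simp
  rw [this]
  refine intervalIntegral.integral_mono_on zero_le_one
    (Continuous.intervalIntegrable (by fun_prop) _ _)
    (Continuous.intervalIntegrable (by fun_prop) _ _) fun b hb ↦ ?_
  have h1 : 0 ≤ 1 - b := by linarith [hb.2]
  have h2 : 1 - b ≤ 1 := by linarith [hb.1]
  nlinarith [sq_nonneg ((1 - b) * g b + deriv g b), mul_le_mul h2 h2 h1 zero_le_one,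
    sq_nonneg (g b)]

lemma hasDerivAt_line {w : Plane → ℝ} (hw : ContDiff ℝ 1 w) (p f : Plane) (b : ℝ) :
    HasDerivAt (fun b : ℝ ↦ w (p + b • f)) (inner ℝ (∇ w (p + b • f)) f) b := by
  have h1 := (hw.differentiable one_ne_zero (p + b • f)).hasGradientAt.hasFDerivAt
  have h2 : HasDerivAt (fun b : ℝ ↦ p + b • f) f b := by
    simpa using ((hasDerivAt_id b).smul_const f).const_add p
  exact h1.comp_hasDerivAt b h2

lemma enorm_sq_le_lintegral_line {w : Plane → ℝ} (hw : ContDiff ℝ 1 w) (p f : Plane) :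
    ‖w p‖ₑ ^ 2 ≤ ∫⁻ b in Set.Ioc (0 : ℝ) 1,
      (2 * ‖w (p + b • f)‖ₑ ^ 2 + ‖f‖ₑ ^ 2 * ‖∇ w (p + b • f)‖ₑ ^ 2) := by
  have hg : ContDiff ℝ 1 (fun b : ℝ ↦ w (p + b • f)) := hw.comp (by fun_prop)
  have h := sq_le_integral_of_contDiff hg
  have hcg := hg.continuous
  have hcg' := hg.continuous_deriv le_rfl
  rw [intervalIntegral.integral_of_le zero_le_one] at h
  have h2 := ENNReal.ofReal_le_ofReal h
  rw [ofReal_integral_eq_lintegral_ofReal ((Continuous.intervalIntegrable (by fun_prop) 0 1).1)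
    (.of_forall fun b ↦ by simp only [Pi.zero_apply]; positivity)] at h2
  have e : ‖w p‖ₑ ^ 2 = ENNReal.ofReal (w (p + (0 : ℝ) • f) ^ 2) := by
    rw [zero_smul, add_zero, ← ofReal_norm, ← ENNReal.ofReal_pow (norm_nonneg _), Real.norm_eq_abs,
      sq_abs]
  rw [e]
  refine h2.trans (lintegral_mono fun b ↦ ?_)
  simp only [(hasDerivAt_line hw p f b).deriv]
  rw [ENNReal.ofReal_add (by positivity) (by positivity), ENNReal.ofReal_mul (by norm_num)]
  refine add_le_add (mul_le_mul' (by simp) ?_) ?_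
  · rw [← ofReal_norm, ← ENNReal.ofReal_pow (norm_nonneg _), Real.norm_eq_abs, sq_abs]
  · rw [← mul_pow, ← ofReal_norm, ← ofReal_norm, ← ENNReal.ofReal_mul (norm_nonneg _),
      ← ENNReal.ofReal_pow (by positivity)]
    apply ENNReal.ofReal_le_ofReal
    rw [sq_le_sq, abs_of_nonneg (a := ‖f‖ * _) (by positivity), mul_comm]
    exact abs_real_inner_le_norm _ _

/-- The one-dimensional inequality in direction `f` is integrated along the base of the
parallelogram. The value `b = 0` is left out of `hsub` so that the base may lie on the boundary. -/
lemma trace_le_of_parallelogram {Ω : Set Plane} {p e f : Plane} {ℓ : ℝ}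
    (he : ‖e‖ = 1) (hef : ∀ a b : ℝ, a • e + b • f = 0 → a = 0 ∧ b = 0)
    (hΩ : IsOpen Ω) (hsub : ∀ a ∈ Set.Icc 0 ℓ, ∀ b ∈ Set.Ioc (0 : ℝ) 1, p + (a • e + b • f) ∈ Ω) :
    ∃ C : ℝ≥0∞, C ≠ ⊤ ∧ ∀ w : Plane → ℝ, ContDiff ℝ 1 w →
      ∫⁻ x in (fun a : ℝ ↦ p + a • e) '' Set.Icc 0 ℓ, ‖w x‖ₑ ^ 2 ∂(Measure.hausdorffMeasure 1) ≤
        C * ((∫⁻ x in Ω, ‖w x‖ₑ ^ 2) + ∫⁻ x in Ω, ‖∇ w x‖ₑ ^ 2) := by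
  obtain ⟨κ, hκ0, hκ, hvol⟩ := exists_volume_eq_smul_map hef
  refine ⟨κ⁻¹ * (2 + ‖f‖ₑ ^ 2), ENNReal.mul_ne_top (ENNReal.inv_ne_top.mpr hκ0)
    (by finiteness), fun w hw ↦ ?_⟩
  have hcw := hw.continuous
  have hcg := continuous_gradient hw
  have hi := isometry_line he p
  rw [hausdorffMeasure_restrict_line he p (Set.image_subset_range _ _),
    hi.injective.preimage_image, hi.isClosedEmbedding.measurableEmbedding.lintegral_map]
  set F : Plane → ℝ≥0∞ := fun x ↦ 2 * ‖w x‖ₑ ^ 2 + ‖f‖ₑ ^ 2 * ‖∇ w x‖ₑ ^ 2 with hF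
  have mF : Measurable F := by
    have : Measurable w := hcw.measurable
    have : Measurable (∇ w) := hcg.measurable
    fun_prop
  set Φ : ℝ × ℝ → Plane := fun z ↦ p + (z.1 • e + z.2 • f) with hΦ
  have mΦ : Measurable Φ := by fun_prop
  calc _ ≤ ∫⁻ a in Set.Icc 0 ℓ, ∫⁻ b in Set.Ioc (0 : ℝ) 1, F (Φ (a, b)) := by
        refine lintegral_mono fun a ↦ ?_
        have := enorm_sq_le_lintegral_line hw (p + a • e) f
        simpa only [hF, hΦ, add_assoc] using this
    _ = ∫⁻ z in Set.Icc 0 ℓ ×ˢ Set.Ioc (0 : ℝ) 1, F (Φ z) := by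
        rw [Measure.volume_eq_prod, ← Measure.prod_restrict, lintegral_prod (fun z ↦ F (Φ z))
          (mF.comp mΦ).aemeasurable]
    _ ≤ ∫⁻ z in Φ ⁻¹' Ω, F (Φ z) :=
        lintegral_mono_set fun z hz ↦ hsub _ hz.1 _ hz.2
    _ = ∫⁻ x in Ω, F x ∂((volume : Measure (ℝ × ℝ)).map Φ) := by
        rw [setLIntegral_map hΩ.measurableSet mF mΦ]
    _ = κ⁻¹ * ∫⁻ x in Ω, F x := by
        conv_rhs => rw [hvol p, Measure.restrict_smul, lintegral_smul_measure, smul_eq_mul]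
        rw [← mul_assoc, ENNReal.inv_mul_cancel hκ0 hκ, one_mul]
    _ ≤ _ := by
        rw [hF, mul_assoc, lintegral_add_left (by have := hcw.measurable; fun_prop),
          lintegral_const_mul _ (by have := hcw.measurable; fun_prop),
          lintegral_const_mul _ (by have := hcg.measurable; fun_prop)]
        gcongr κ⁻¹ * ?_
        rw [mul_add]
        gcongr <;> simp

lemma exists_normal {v : Plane} (hv : v ≠ 0) : ∃ n : Plane, n ≠ 0 ∧ inner ℝ n v = 0 := by
  refine ⟨!₂[-(v 1), v 0], fun h ↦ hv ?_, ?_⟩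
  · have h0 := congrArg (fun x : Plane ↦ x 0) h
    have h1 := congrArg (fun x : Plane ↦ x 1) h
    simp at h0 h1
    ext i
    fin_cases i <;> simp [h0, h1]
  · simp [PiLp.inner_apply, Fin.sum_univ_two]
    ring

/-- A nonempty open set is not contained in a line: if the chosen point happens to lie on it, a
small push along the normal helps. -/
lemma exists_mem_independent {Ω : Set Plane} (hΩ : IsOpen Ω) (hne : Ω.Nonempty) {v : Plane}
    (hv : v ≠ 0) (p : Plane) :
    ∃ c ∈ Ω, ∀ a b : ℝ, a • v + b • (c - p) = 0 → a = 0 ∧ b = 0 := by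
  obtain ⟨n, hn, hnv⟩ := exists_normal hv
  suffices h : ∃ c ∈ Ω, inner ℝ n (c - p) ≠ 0 by
    obtain ⟨c, hc, hcp⟩ := h
    refine ⟨c, hc, fun a b hab ↦ ?_⟩
    have := congrArg (inner ℝ n) hab
    rw [inner_add_right, real_inner_smul_right, real_inner_smul_right, hnv, mul_zero, zero_add,
      inner_zero_right, mul_eq_zero, or_iff_left hcp] at this
    rw [this, zero_smul, add_zero, smul_eq_zero, or_iff_left hv] at hab
    exact ⟨hab, this⟩
  obtain ⟨c, hc⟩ := hne
  by_cases h0 : inner ℝ n (c - p) = 0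
  · have : Tendsto (fun t : ℝ ↦ c + t • n) (𝓝[>] 0) (𝓝 c) := by
      have h : ContinuousAt (fun t : ℝ ↦ c + t • n) 0 := by fun_prop
      simpa using h.tendsto.mono_left (nhdsWithin_le_nhds (s := Set.Ioi 0))
    obtain ⟨t, ht, ht0⟩ := ((this.eventually (hΩ.mem_nhds hc)).and self_mem_nhdsWithin).exists
    refine ⟨_, ht, ?_⟩
    rw [add_sub_right_comm, inner_add_right, h0, zero_add, real_inner_smul_right]
    exact mul_ne_zero (ne_of_gt ht0) (inner_self_ne_zero.mpr hn)
  · exact ⟨c, hc, h0⟩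

/-- A parallelogram on the whole segment may leave `Ω`, but the one spanned by half the segment and
half the vector from `p` to an interior point `c` does not. -/
lemma trace_le_of_half_segment {Ω : Set Plane} (hΩ : IsOpen Ω) (hconv : Convex ℝ Ω)
    (hne : Ω.Nonempty) {p q : Plane} (hpq : p ≠ q) (hp : p ∈ closure Ω) (hq : q ∈ closure Ω) :
    ∃ C : ℝ≥0∞, C ≠ ⊤ ∧ ∀ w : Plane → ℝ, ContDiff ℝ 1 w →
      ∫⁻ x in (fun a : ℝ ↦ p + a • (q - p)) '' Set.Icc 0 (1 / 2),
        ‖w x‖ₑ ^ 2 ∂(Measure.hausdorffMeasure 1) ≤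
        C * ((∫⁻ x in Ω, ‖w x‖ₑ ^ 2) + ∫⁻ x in Ω, ‖∇ w x‖ₑ ^ 2) := by
  have hv : q - p ≠ 0 := sub_ne_zero.mpr hpq.symm
  have hn : ‖q - p‖ ≠ 0 := norm_ne_zero_iff.mpr hv
  have hn0 : 0 < ‖q - p‖ := norm_pos_iff.mpr hv
  obtain ⟨c, hc, hind⟩ := exists_mem_independent hΩ hne hv p
  have himg : (fun a : ℝ ↦ p + a • (q - p)) '' Set.Icc 0 (1 / 2) =
      (fun a : ℝ ↦ p + a • (‖q - p‖⁻¹ • (q - p))) '' Set.Icc 0 (‖q - p‖ / 2) := by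
    ext x
    constructor
    · rintro ⟨a, ⟨ha0, ha1⟩, rfl⟩
      refine ⟨a * ‖q - p‖, ⟨by positivity, by nlinarith⟩, ?_⟩
      simp only [smul_smul, mul_assoc, mul_inv_cancel₀ hn, mul_one]
    · rintro ⟨a, ⟨ha0, ha1⟩, rfl⟩
      refine ⟨a * ‖q - p‖⁻¹, ⟨by positivity, ?_⟩, ?_⟩
      · rw [← div_eq_mul_inv, div_le_iff₀ hn0]
        linarith
      · simp only [smul_smul]
  rw [himg]
  refine trace_le_of_parallelogram (f := (1 / 2 : ℝ) • (c - p)) ?_ ?_ hΩ ?_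
  · rw [norm_smul, norm_inv, norm_norm, inv_mul_cancel₀ hn]
  · intro a b hab
    rw [smul_smul, smul_smul] at hab
    have := hind _ _ hab
    simpa [hn, hv] using this
  · rintro a ⟨ha0, ha1⟩ b ⟨hb0, hb1⟩
    set t := a * ‖q - p‖⁻¹ with ht
    have ht0 : 0 ≤ t := by positivity
    have ht1 : t ≤ 1 / 2 := by
      rw [ht, ← div_eq_mul_inv, div_le_iff₀ hn0]
      linarith
    -- The point `p + t (q - p) + (b/2) (c - p)` combines `c`, with weight `b/2`, and the point of
    -- the segment with parameter `t / (1 - b/2)`, which is at most `1` because `t ≤ 1/2` and `b ≤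
    -- 1`.
    have hy : AffineMap.lineMap p q (t / (1 - b / 2)) ∈ closure Ω :=
      hconv.closure.lineMap_mem hp hq ⟨div_nonneg ht0 (by linarith),
        (div_le_one (by linarith)).mpr (by linarith)⟩
    have := hconv.combo_interior_closure_mem_interior (by rwa [hΩ.interior_eq]) hy
      (a := b / 2) (b := 1 - b / 2) (by linarith) (by linarith) (by ring)
    rw [hΩ.interior_eq] at this
    convert this using 1
    rw [AffineMap.lineMap_apply, vsub_eq_sub, vadd_eq_add, smul_add, smul_smul (1 - b / 2),
      mul_div_cancel₀ _ (by linarith : 1 - b / 2 ≠ 0), smul_smul a, ← ht]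
    module

/-- The two halves are treated from their respective end points. A degenerate segment has length
zero. -/
lemma trace_le_of_segment {Ω : Set Plane} (hΩ : IsOpen Ω) (hconv : Convex ℝ Ω)
    (hne : Ω.Nonempty) {p q : Plane} (hp : p ∈ closure Ω) (hq : q ∈ closure Ω) :
    ∃ C : ℝ≥0∞, C ≠ ⊤ ∧ ∀ w : Plane → ℝ, ContDiff ℝ 1 w →
      eLpNorm w 2 ((Measure.hausdorffMeasure 1).restrict (segment ℝ p q)) ≤
        C * (eLpNorm w 2 (vol Ω) + eLpNorm (∇ w) 2 (vol Ω)) := by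
  by_cases hpq : p = q
  · refine ⟨0, by simp, fun w _ ↦ ?_⟩
    have := Measure.nullSingletonClass_hausdorff Plane (d := 1) one_pos
    simp [hpq]
  obtain ⟨C₁, hC₁, h₁⟩ := trace_le_of_half_segment hΩ hconv hne hpq hp hq
  obtain ⟨C₂, hC₂, h₂⟩ := trace_le_of_half_segment hΩ hconv hne (Ne.symm hpq) hq hp
  -- This dominates the square root of `C₁ + C₂`, which avoids taking one.
  refine ⟨1 + (C₁ + C₂), by finiteness, fun w hw ↦ ?_⟩
  rw [← ENNReal.pow_le_pow_left_iff two_ne_zero, eLpNorm_two_sq]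
  have hsub : segment ℝ p q ⊆ ((fun a : ℝ ↦ p + a • (q - p)) '' Set.Icc 0 (1 / 2)) ∪
      ((fun a : ℝ ↦ q + a • (p - q)) '' Set.Icc 0 (1 / 2)) := by
    rw [segment_eq_image']
    rintro _ ⟨a, ⟨ha0, ha1⟩, rfl⟩
    rcases le_total a (1 / 2) with h | h
    · exact Or.inl ⟨a, ⟨ha0, h⟩, rfl⟩
    · refine Or.inr ⟨1 - a, ⟨by linarith, by linarith⟩, ?_⟩
      module
  refine (lintegral_mono_set hsub).trans ((lintegral_union_le _ _ _).trans ?_)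
  refine (add_le_add (h₁ w hw) (h₂ w hw)).trans ?_
  rw [← add_mul, ← eLpNorm_two_sq, ← eLpNorm_two_sq, mul_pow]
  refine mul_le_mul' ?_ ?_
  · calc C₁ + C₂ ≤ 1 + (C₁ + C₂) := le_add_self
      _ ≤ (1 + (C₁ + C₂)) ^ 2 := le_self_pow₀ le_self_add two_ne_zero
  · rw [add_sq]
    gcongr
    exact le_self_add

lemma gradient_sub_of_contDiff {w w' : Plane → ℝ} (h : ContDiff ℝ 1 w) (h' : ContDiff ℝ 1 w') :
    ∇ (w - w') = ∇ w - ∇ w' := by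
  ext1 x
  have := ((h.differentiable one_ne_zero x).hasGradientAt.hasFDerivAt).sub
    ((h'.differentiable one_ne_zero x).hasGradientAt.hasFDerivAt)
  rw [← map_sub] at this
  exact HasGradientAt.gradient (hasGradientAt_iff_hasFDerivAt.mpr this)

lemma tendsto_eLpNorm_sub {α F : Type*} [MeasurableSpace α] [NormedAddCommGroup F] {μ : Measure α}
    {f g : ℕ → α → F} {a : α → F} (hf : ∀ n, AEStronglyMeasurable (f n - a) μ)
    (hg : ∀ n, AEStronglyMeasurable (g n - a) μ)
    (h : Tendsto (fun n ↦ eLpNorm (f n - a) 2 μ) atTop (𝓝 0))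
    (h' : Tendsto (fun n ↦ eLpNorm (g n - a) 2 μ) atTop (𝓝 0)) :
    Tendsto (fun n ↦ eLpNorm (f n - g n) 2 μ) atTop (𝓝 0) := by
  refine tendsto_of_tendsto_of_tendsto_of_le_of_le tendsto_const_nhds (by simpa using h.add h')
    (fun _ ↦ zero_le) fun n ↦ ?_
  have : f n - g n = (f n - a) - (g n - a) := by abel
  simp only [this]
  exact eLpNorm_sub_le (hf n) (hg n) (by norm_num)

/-- A zero trace on a segment is a property of the function, not of the approximating sequence. -/
lemma tendsto_trace_of_tendstoH1 {Ω : Set Plane} (hΩ : IsOpen Ω) (hconv : Convex ℝ Ω)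
    (hne : Ω.Nonempty) {p q : Plane} (hp : p ∈ closure Ω) (hq : q ∈ closure Ω)
    {w : ℕ → Plane → ℝ} {u : Plane → ℝ} {G : Plane → Plane}
    (hu : AEStronglyMeasurable u (vol Ω)) (hG : AEStronglyMeasurable G (vol Ω))
    (h : TendstoH1 Ω w u G) (ht : HasTrace Ω (segment ℝ p q) u G 0) :
    Tendsto (fun n ↦ eLpNorm (w n) 2 ((Measure.hausdorffMeasure 1).restrict (segment ℝ p q)))
      atTop (𝓝 0) := by
  obtain ⟨w', h0', h1', h2', h3'⟩ := ht
  obtain ⟨h0, h1, h2⟩ := h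
  obtain ⟨C, hC, htr⟩ := trace_le_of_segment hΩ hconv hne hp hq
  have d1 := tendsto_eLpNorm_sub (fun n ↦ (h0 n).continuous.aestronglyMeasurable.sub hu)
    (fun n ↦ (h0' n).continuous.aestronglyMeasurable.sub hu) h1 h1'
  have d2 := tendsto_eLpNorm_sub
    (fun n ↦ (continuous_gradient (h0 n)).aestronglyMeasurable.sub hG)
    (fun n ↦ (continuous_gradient (h0' n)).aestronglyMeasurable.sub hG) h2 h2'
  have d3 := (ENNReal.Tendsto.const_mul (a := C) (d1.add d2) (Or.inr hC)).add h3'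
  simp only [add_zero, mul_zero, sub_zero] at d3
  refine tendsto_of_tendsto_of_tendsto_of_le_of_le tendsto_const_nhds d3
    (fun _ ↦ zero_le) fun n ↦ ?_
  -- Both sequences tend to `u` in `H¹`, so the trace inequality makes `w n - w' n` small on the
  -- segment.
  have e : w n = (w n - w' n) + w' n := by abel
  conv_lhs => rw [e]
  refine (eLpNorm_add_le ((h0 n).continuous.sub (h0' n).continuous).aestronglyMeasurable
    (h0' n).continuous.aestronglyMeasurable (by norm_num)).trans ?_
  gcongr
  rw [← gradient_sub_of_contDiff (h0 n) (h0' n)]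
  exact htr _ ((h0 n).sub (h0' n))

/-! ### Mirror symmetries -/

/-- The linear part of the reflection with unit normal `ν`. -/
noncomputable def mirrorLin (ν : Plane) : Plane ≃ₗᵢ[ℝ] Plane := (ℝ ∙ ν)ᗮ.reflection

/-- The reflection in the line through `c` with normal `ν`. -/
noncomputable def mirror (c ν : Plane) (x : Plane) : Plane := mirrorLin ν (x - c) + c

@[simp] lemma mirrorLin_mirrorLin (ν v : Plane) : mirrorLin ν (mirrorLin ν v) = v :=
  Submodule.reflection_reflection _ v

@[simp] lemma mirror_mirror (c ν x : Plane) : mirror c ν (mirror c ν x) = x := by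
  simp [mirror]

lemma mirrorLin_normal (ν : Plane) : mirrorLin ν ν = -ν :=
  Submodule.reflection_orthogonalComplement_singleton_eq_neg ν

lemma mirrorLin_of_inner_eq_zero {ν v : Plane} (h : inner ℝ ν v = 0) : mirrorLin ν v = v :=
  Submodule.reflection_mem_subspace_eq_self (Submodule.mem_orthogonal_singleton_iff_inner_right.mpr h)

lemma inner_mirrorLin (ν v w : Plane) : inner ℝ (mirrorLin ν v) w = inner ℝ v (mirrorLin ν w) := by
  rw [← (mirrorLin ν).inner_map_map, mirrorLin_mirrorLin]

/-- The signed distance to the line through `c` with unit normal `ν`. -/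
noncomputable abbrev height (c ν x : Plane) : ℝ := inner ℝ ν (x - c)

lemma continuous_height (c ν : Plane) : Continuous (height c ν) := by
  unfold height
  fun_prop

lemma height_mirror (c ν x : Plane) : height c ν (mirror c ν x) = -height c ν x := by
  rw [height, mirror, add_sub_cancel_right, ← inner_mirrorLin, mirrorLin_normal, inner_neg_left]

lemma mirror_of_height_eq_zero {c ν x : Plane} (h : height c ν x = 0) : mirror c ν x = x := by
  rw [mirror, mirrorLin_of_inner_eq_zero h, sub_add_cancel]

lemma contDiff_mirror (c ν : Plane) {n : WithTop ℕ∞} : ContDiff ℝ n (mirror c ν) :=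
  ((mirrorLin ν).contDiff.comp (contDiff_id.sub contDiff_const)).add contDiff_const

lemma isometry_mirror (c ν : Plane) : Isometry (mirror c ν) :=
  Isometry.of_dist_eq fun x y ↦ by simp [mirror]

/-- The reflection as a homeomorphism. -/
noncomputable def mirrorHomeo (c ν : Plane) : Plane ≃ₜ Plane where
  toFun := mirror c ν
  invFun := mirror c ν
  left_inv := mirror_mirror c ν
  right_inv := mirror_mirror c ν
  continuous_toFun := (isometry_mirror c ν).continuous
  continuous_invFun := (isometry_mirror c ν).continuous

lemma measurableEmbedding_mirror (c ν : Plane) : MeasurableEmbedding (mirror c ν) :=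
  (mirrorHomeo c ν).measurableEmbedding

lemma measurePreserving_mirror (c ν : Plane) :
    MeasurePreserving (mirror c ν) (volume : Measure Plane) volume :=
  (measurePreserving_add_right volume c).comp
    ((mirrorLin ν).measurePreserving.comp (measurePreserving_sub_right volume c))

lemma image_mirror_eq_preimage (c ν : Plane) (S : Set Plane) :
    mirror c ν '' S = mirror c ν ⁻¹' S :=
  (mirrorHomeo c ν).toEquiv.image_eq_preimage_symm S

lemma volume_height_eq_zero {c ν : Plane} (hν : ‖ν‖ = 1) :
    volume {x : Plane | height c ν x = 0} = 0 := by
  have hs : (ℝ ∙ ν)ᗮ ≠ ⊤ := fun h ↦ by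
    have h1 : ν ∈ (ℝ ∙ ν)ᗮ := h ▸ Submodule.mem_top
    rw [Submodule.mem_orthogonal_singleton_iff_inner_right, inner_self_eq_zero] at h1
    simp [h1] at hν
  have h := Measure.addHaar_submodule (volume : Measure Plane) _ hs
  have e : {x : Plane | height c ν x = 0} =
      (fun x : Plane ↦ x + -c) ⁻¹' ((ℝ ∙ ν)ᗮ : Submodule ℝ Plane) := by
    ext x
    simp [Submodule.mem_orthogonal_singleton_iff_inner_right, sub_eq_add_neg, height]
  rw [e, measure_preimage_add_right, h]

/-- The convex open set `Ω` is symmetric with respect to the line through `c` with normal `ν`, and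
`T` is the half of `Ω` on the side of `ν`. -/
structure Folding (Ω T : Set Plane) (c ν : Plane) : Prop where
  norm_normal : ‖ν‖ = 1
  isOpen : IsOpen Ω
  convex : Convex ℝ Ω
  isBounded : Bornology.IsBounded Ω
  mirror_mem : ∀ x ∈ Ω, mirror c ν x ∈ Ω
  half_eq : T = {x ∈ Ω | 0 < height c ν x}
  nonempty : T.Nonempty

/-! ### Integration over a domain and its half; extension and folding in `L²` -/

namespace Folding

variable {Ω T : Set Plane} {c ν : Plane}

lemma half_subset (h : Folding Ω T c ν) : T ⊆ Ω := h.half_eq ▸ Set.sep_subset _ _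

lemma height_pos (h : Folding Ω T c ν) {x : Plane} (hx : x ∈ T) : 0 < height c ν x :=
  (h.half_eq ▸ hx).2

lemma isOpen_half (h : Folding Ω T c ν) : IsOpen T := by
  rw [h.half_eq]
  exact h.isOpen.inter (isOpen_lt continuous_const (continuous_height c ν))

lemma convex_half (h : Folding Ω T c ν) : Convex ℝ T := by
  rw [h.half_eq]
  refine h.convex.inter (s := Ω) (t := {x | 0 < height c ν x}) fun x hx y hy a b ha hb hab ↦ ?_
  have e : a • x + b • y - c = a • (x - c) + b • (y - c) := by
    rw [← eq_sub_iff_add_eq] at hab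
    rw [hab]
    module
  simp only [Set.mem_ofPred_eq, height, e, inner_add_right, real_inner_smul_right] at hx hy ⊢
  rcases ha.eq_or_lt with rfl | ha
  · obtain rfl : b = 1 := by linarith
    simpa using hy
  · have := mul_pos ha hx
    have := mul_nonneg hb hy.le
    linarith

lemma mirror_mem_iff (h : Folding Ω T c ν) {x : Plane} : mirror c ν x ∈ Ω ↔ x ∈ Ω :=
  ⟨fun hx ↦ by simpa using h.mirror_mem _ hx, h.mirror_mem x⟩

lemma measurePreserving_mirror (h : Folding Ω T c ν) :
    MeasurePreserving (mirror c ν) (vol Ω) (vol Ω) := by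
  have := (EquilateralRhombus.measurePreserving_mirror c ν).restrict_preimage
    h.isOpen.measurableSet
  rwa [show mirror c ν ⁻¹' Ω = Ω from Set.ext fun x ↦ h.mirror_mem_iff] at this

/-- The half and its mirror image are disjoint, and together they miss only points of the mirror
line, which is null. -/
lemma vol_eq (h : Folding Ω T c ν) : vol Ω = vol T + (vol T).map (mirror c ν) := by
  have hT := h.isOpen_half.measurableSet
  have hm := (isometry_mirror c ν).continuous.measurable
  have h1 : (vol T).map (mirror c ν) = vol (mirror c ν ⁻¹' T) := by
    have := (EquilateralRhombus.measurePreserving_mirror c ν).restrict_preimage (hm hT)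
    rw [← Set.preimage_comp, show mirror c ν ∘ mirror c ν = id from funext (mirror_mirror c ν),
      Set.preimage_id] at this
    exact this.map_eq
  have hdisj : Disjoint T (mirror c ν ⁻¹' T) := by
    rw [Set.disjoint_left]
    intro x hx hx'
    have h1 := h.height_pos hx
    have h2 := h.height_pos hx'
    rw [height_mirror] at h2
    linarith
  rw [h1, ← Measure.restrict_union hdisj (hm hT)]
  refine Measure.restrict_congr_set ?_
  have h0 : ∀ᵐ x : Plane, height c ν x ≠ 0 := by
    rw [ae_iff]
    simpa using volume_height_eq_zero h.norm_normal
  filter_upwards [h0] with x hx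
  apply propext
  change x ∈ Ω ↔ x ∈ T ∪ mirror c ν ⁻¹' T
  rw [Set.mem_union, Set.mem_preimage, h.half_eq]
  simp only [Set.mem_ofPred_eq, h.mirror_mem_iff, height_mirror]
  rcases lt_or_gt_of_ne hx with h3 | h3
  · simp [h3, h3.le]
  · simp [h3, h3.le]

lemma ae_iff (h : Folding Ω T c ν) {P : Plane → Prop} :
    (∀ᵐ x ∂vol Ω, P x) ↔ (∀ᵐ x ∂vol T, P x) ∧ ∀ᵐ x ∂vol T, P (mirror c ν x) := by
  rw [h.vol_eq, ae_add_measure_iff, (measurableEmbedding_mirror c ν).ae_map_iff]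

lemma integral_eq (h : Folding Ω T c ν) {F : Type*} [NormedAddCommGroup F] [NormedSpace ℝ F]
    {f : Plane → F} (hf : Integrable f (vol Ω)) :
    ∫ x in Ω, f x = ∫ x in T, (f x + f (mirror c ν x)) := by
  have hm := measurableEmbedding_mirror c ν
  rw [h.vol_eq, integrable_add_measure, hm.integrable_map_iff] at hf
  change ∫ x, f x ∂(vol Ω) = _
  rw [h.vol_eq, integral_add_measure hf.1 (hm.integrable_map_iff.mpr hf.2), hm.integral_map]
  exact (integral_add hf.1 hf.2).symm

lemma eLpNorm_sq (h : Folding Ω T c ν) {F : Type*} [NormedAddCommGroup F] (f : Plane → F) :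
    eLpNorm f 2 (vol Ω) ^ 2 =
      eLpNorm f 2 (vol T) ^ 2 + eLpNorm (f ∘ mirror c ν) 2 (vol T) ^ 2 := by
  rw [eLpNorm_two_sq, h.vol_eq, lintegral_add_measure,
    (measurableEmbedding_mirror c ν).lintegral_map, eLpNorm_two_sq, eLpNorm_two_sq]
  rfl

lemma memLp_iff (h : Folding Ω T c ν) {F : Type*} [NormedAddCommGroup F] (f : Plane → F) :
    MemLp f 2 (vol Ω) ↔ MemLp f 2 (vol T) ∧ MemLp (f ∘ mirror c ν) 2 (vol T) := by
  have hm := measurableEmbedding_mirror c ν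
  constructor
  · intro hf
    rw [h.vol_eq] at hf
    exact ⟨hf.mono_measure (Measure.le_add_right le_rfl),
      hm.memLp_map_measure_iff.mp (hf.mono_measure (Measure.le_add_left le_rfl))⟩
  · rintro ⟨h1, h2⟩
    refine ⟨?_, ?_⟩
    · rw [h.vol_eq]
      exact h1.aestronglyMeasurable.add_measure (hm.memLp_map_measure_iff.mpr h2).aestronglyMeasurable
    · have : eLpNorm f 2 (vol Ω) ^ 2 < ⊤ := by
        rw [h.eLpNorm_sq]
        exact ENNReal.add_lt_top.mpr ⟨ENNReal.pow_lt_top h1.2, ENNReal.pow_lt_top h2.2⟩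
      exact (ENNReal.pow_lt_top_iff.mp this).resolve_right two_ne_zero

lemma ext_unique (h : Folding Ω T c ν) {F : Type*} [NormedAddCommGroup F]
    {f g : Lp F 2 (vol Ω)} (h1 : ∀ᵐ x ∂vol T, f x = g x)
    (h2 : ∀ᵐ x ∂vol T, f (mirror c ν x) = g (mirror c ν x)) : f = g :=
  Lp.ext (h.ae_iff.mpr ⟨h1, h2⟩)

section Operators

variable {F : Type*} [NormedAddCommGroup F] [InnerProductSpace ℝ F] (L : F ≃ₗᵢ[ℝ] F) (τ : ℝ)

/-- The extension of `f` from `T` to `Ω` which is even (`τ = 1`) or odd (`τ = -1`) with respect to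
the reflection, where `L` acts on the values. -/
noncomputable def extFun (c ν : Plane) (f : Plane → F) (x : Plane) : F :=
  open Classical in if 0 < height c ν x then f x else τ • L (f (mirror c ν x))

lemma extFun_ae (h : Folding Ω T c ν) (f : Plane → F) :
    (∀ᵐ x ∂vol T, extFun L τ c ν f x = f x) ∧
      ∀ᵐ x ∂vol T, extFun L τ c ν f (mirror c ν x) = τ • L (f x) := by
  constructor <;>
  · refine (ae_restrict_iff' h.isOpen_half.measurableSet).mpr (.of_forall fun x hx ↦ ?_)
    have h1 := h.height_pos hx
    have h2 : ¬ 0 < height c ν (mirror c ν x) := by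
      rw [height_mirror]
      linarith
    simp [extFun, h1, h2]

lemma memLp_extFun (h : Folding Ω T c ν) (f : Lp F 2 (vol T)) :
    MemLp (extFun L τ c ν f) 2 (vol Ω) := by
  obtain ⟨h1, h2⟩ := h.extFun_ae L τ f
  have hf := Lp.memLp f
  have hLf : MemLp (fun x ↦ L (f x)) 2 (vol T) :=
    (L.toContinuousLinearEquiv : F →L[ℝ] F).comp_memLp' hf
  exact (h.memLp_iff _).mpr ⟨(memLp_congr_ae h1).mpr hf,
    (memLp_congr_ae h2).mpr (hLf.const_smul τ)⟩

/-- Extension by reflection, on `L²`. -/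
noncomputable def ext (h : Folding Ω T c ν) (f : Lp F 2 (vol T)) : Lp F 2 (vol Ω) :=
  (h.memLp_extFun L τ f).toLp

lemma ext_ae (h : Folding Ω T c ν) (f : Lp F 2 (vol T)) :
    (∀ᵐ x ∂vol T, h.ext L τ f x = f x) ∧
      ∀ᵐ x ∂vol T, h.ext L τ f (mirror c ν x) = τ • L (f x) := by
  obtain ⟨h1, h2⟩ := h.ae_iff.mp (h.memLp_extFun L τ f).coeFn_toLp
  obtain ⟨h3, h4⟩ := h.extFun_ae L τ f
  constructor
  · filter_upwards [h1, h3] with x hx hx'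
    exact hx.trans hx'
  · filter_upwards [h2, h4] with x hx hx'
    exact hx.trans hx'

lemma memLp_foldFun (h : Folding Ω T c ν) (f : Lp F 2 (vol Ω)) :
    MemLp (fun x ↦ f x + τ • L (f (mirror c ν x))) 2 (vol T) := by
  obtain ⟨h1, h2⟩ := (h.memLp_iff _).mp (Lp.memLp f)
  have h3 : MemLp (fun x ↦ L (f (mirror c ν x))) 2 (vol T) :=
    (L.toContinuousLinearEquiv : F →L[ℝ] F).comp_memLp' h2
  exact h1.add (h3.const_smul τ)

/-- The adjoint of the extension by reflection. -/
noncomputable def fold (h : Folding Ω T c ν) : Lp F 2 (vol Ω) →ₗ[ℝ] Lp F 2 (vol T) where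
  toFun f := (h.memLp_foldFun L τ f).toLp
  map_add' f g := by
    rw [← MemLp.toLp_add]
    refine MemLp.toLp_congr _ _ ?_
    obtain ⟨h1, h2⟩ := h.ae_iff.mp (Lp.coeFn_add f g)
    filter_upwards [h1, h2] with x hx hx'
    simp only [hx, hx', Pi.add_apply, map_add, smul_add]
    abel
  map_smul' a f := by
    rw [RingHom.id_apply, ← MemLp.toLp_const_smul]
    refine MemLp.toLp_congr _ _ ?_
    obtain ⟨h1, h2⟩ := h.ae_iff.mp (Lp.coeFn_smul a f)
    filter_upwards [h1, h2] with x hx hx'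
    simp only [hx, hx', Pi.smul_apply, map_smul, smul_add]
    rw [smul_comm]

lemma fold_ae (h : Folding Ω T c ν) (f : Lp F 2 (vol Ω)) :
    ∀ᵐ x ∂vol T, h.fold L τ f x = f x + τ • L (f (mirror c ν x)) :=
  (h.memLp_foldFun L τ f).coeFn_toLp

/-- Folding the integral over `Ω` onto `T` leaves the term `τ ⟨L f, g ∘ σ⟩`, in which the isometric
involution `L` moves to the other factor. This adjunction transports the weak eigenvalue equation.
-/
lemma inner_ext (h : Folding Ω T c ν) (hL : ∀ v, L (L v) = v) (f : Lp F 2 (vol T))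
    (g : Lp F 2 (vol Ω)) : inner ℝ (h.ext L τ f) g = inner ℝ f (h.fold L τ g) := by
  rw [L2.inner_def, L2.inner_def, h.integral_eq (L2.integrable_inner _ _)]
  refine integral_congr_ae ?_
  obtain ⟨h1, h2⟩ := h.ext_ae L τ f
  filter_upwards [h1, h2, h.fold_ae L τ g] with x hx hx' hx''
  rw [hx, hx', hx'', inner_add_right, real_inner_smul_left, real_inner_smul_right]
  congr 2
  rw [← L.inner_map_map, hL]



/-- For signs the factor is `2` or `0`: folding with the opposite parity kills an extension. -/
lemma fold_ext (h : Folding Ω T c ν) (hL : ∀ v, L (L v) = v) (τ' : ℝ) (f : Lp F 2 (vol T)) :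
    h.fold L τ (h.ext L τ' f) = (1 + τ * τ') • f := by
  refine Lp.ext ?_
  obtain ⟨h1, h2⟩ := h.ext_ae L τ' f
  filter_upwards [h1, h2, h.fold_ae L τ (h.ext L τ' f), Lp.coeFn_smul (1 + τ * τ') f]
    with x hx hx' hx'' hs
  rw [hx'', hx, hx', hs, Pi.smul_apply, map_smul, hL, smul_smul, add_smul, one_smul]

end Operators

end Folding

/-! ### The weak gradient of an extension by reflection -/

/-- The component in the direction `e` of `∫_T (u ∇φ + φ G)`. -/
noncomputable def green (T : Set Plane) (u : Plane → ℝ) (G : Plane → Plane) (φ : Plane → ℝ)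
    (e : Plane) : ℝ :=
  ∫ x in T, (u x * inner ℝ (∇ φ x) e + φ x * inner ℝ (G x) e)

lemma memLp_inner_gradient {φ : Plane → ℝ} (h1 : ContDiff ℝ 1 φ) (h2 : HasCompactSupport φ)
    (e : Plane) : MemLp (fun x ↦ inner ℝ (∇ φ x) e) 2 (volume : Measure Plane) := by
  have hs : HasCompactSupport (fun x ↦ inner ℝ (∇ φ x) e) := by
    have := h2.fderiv (𝕜 := ℝ)
    exact this.comp_left (g := fun l ↦ inner ℝ ((InnerProductSpace.toDual ℝ Plane).symm l) e)
      (by simp)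
  have := continuous_gradient h1
  exact Continuous.memLp_of_hasCompactSupport (by fun_prop) hs

lemma MemLp.integrable_green {T : Set Plane} {u : Plane → ℝ} {G : Plane → Plane}
    (hu : MemLp u 2 (vol T)) (hG : MemLp G 2 (vol T)) {φ : Plane → ℝ} (h1 : ContDiff ℝ 1 φ)
    (h2 : HasCompactSupport φ) (e : Plane) :
    Integrable (fun x ↦ u x * inner ℝ (∇ φ x) e + φ x * inner ℝ (G x) e) (vol T) :=
  (memLp_one_iff_integrable.mp (((memLp_inner_gradient h1 h2 e).restrict T).mul hu)).add
    (integrableOn_mul_test (hG.inner_const e) h1.continuous h2)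

/-- The scalar form allows the directions tangential and normal to the mirror to be treated
separately. -/
lemma hasWeakGradient_iff {T : Set Plane} {u : Plane → ℝ} {G : Plane → Plane}
    (hu : MemLp u 2 (vol T)) (hG : MemLp G 2 (vol T)) :
    HasWeakGradient T u G ↔ ∀ φ : Plane → ℝ, ContDiff ℝ ∞ φ → HasCompactSupport φ →
      tsupport φ ⊆ T → ∀ e, green T u G φ e = 0 := by
  refine forall_congr' fun φ ↦ forall_congr' fun h1 ↦ forall_congr' fun h2 ↦
    forall_congr' fun h3 ↦ ?_
  have hc : ContDiff ℝ 1 φ := h1.of_le (by exact_mod_cast le_top)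
  have i1 := integrableOn_smul_gradient hu hc h2
  have i2 := integrableOn_mul_test hG h1.continuous h2
  have key : ∀ e, green T u G φ e =
      inner ℝ e ((∫ x in T, u x • ∇ φ x) + ∫ x in T, φ x • G x) := fun e ↦ by
    rw [← integral_add i1 i2,
      ← integral_inner (f := fun x ↦ u x • ∇ φ x + φ x • G x) (i1.add i2), green]
    simp only [inner_add_right, real_inner_smul_right, real_inner_comm e]
  simp only [key, eq_neg_iff_add_eq_zero]
  exact ⟨fun h e ↦ by rw [h, inner_zero_right], fun h ↦ inner_self_eq_zero.mp (h _)⟩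

lemma green_sub_left {T : Set Plane} {u : Plane → ℝ} {G : Plane → Plane}
    (hu : MemLp u 2 (vol T)) (hG : MemLp G 2 (vol T)) {φ ψ : Plane → ℝ} (h1 : ContDiff ℝ 1 φ)
    (h2 : HasCompactSupport φ) (h1' : ContDiff ℝ 1 ψ) (h2' : HasCompactSupport ψ) (e : Plane) :
    green T u G (φ - ψ) e = green T u G φ e - green T u G ψ e := by
  rw [green, green, green, ← integral_sub (MemLp.integrable_green hu hG h1 h2 e)
    (MemLp.integrable_green hu hG h1' h2' e), gradient_sub_of_contDiff h1 h1']
  congr 1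
  ext1 x
  simp only [Pi.sub_apply, inner_sub_left]
  ring

lemma green_decompose {T : Set Plane} {u : Plane → ℝ} {G : Plane → Plane}
    (hu : MemLp u 2 (vol T)) (hG : MemLp G 2 (vol T)) {φ : Plane → ℝ} (h1 : ContDiff ℝ 1 φ)
    (h2 : HasCompactSupport φ) (ν e : Plane) (a : ℝ) :
    green T u G φ e = green T u G φ (e - a • ν) + a * green T u G φ ν := by
  rw [green, green, green, ← integral_const_mul,
    ← integral_add (MemLp.integrable_green hu hG h1 h2 (e - a • ν))
      ((MemLp.integrable_green hu hG h1 h2 ν).const_mul a)]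
  congr 1
  ext1 x
  simp only [inner_sub_right, real_inner_smul_right]
  ring

/-- A smooth function which is `0` on `(-∞, 1]` and `1` on `[2, ∞)`. -/
noncomputable def cutoff (t : ℝ) : ℝ := Real.smoothTransition (t - 1)

lemma contDiff_cutoff {n : ℕ∞} : ContDiff ℝ n cutoff :=
  Real.smoothTransition.contDiff.comp (contDiff_id.sub contDiff_const)

lemma cutoff_of_le_one {t : ℝ} (h : t ≤ 1) : cutoff t = 0 :=
  Real.smoothTransition.zero_of_nonpos (by linarith)

lemma cutoff_of_two_le {t : ℝ} (h : 2 ≤ t) : cutoff t = 1 :=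
  Real.smoothTransition.one_of_one_le (by linarith)

lemma deriv_cutoff_of_two_lt {t : ℝ} (h : 2 < t) : deriv cutoff t = 0 := by
  have : cutoff =ᶠ[𝓝 t] fun _ ↦ 1 := by
    filter_upwards [lt_mem_nhds h] with x hx using cutoff_of_two_le (le_of_lt hx)
  rw [this.deriv_eq, deriv_const]

lemma deriv_cutoff_of_lt_one {t : ℝ} (h : t < 1) : deriv cutoff t = 0 := by
  have : cutoff =ᶠ[𝓝 t] fun _ ↦ 0 := by
    filter_upwards [gt_mem_nhds h] with x hx using cutoff_of_le_one (le_of_lt hx)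
  rw [this.deriv_eq, deriv_const]

lemma continuous_deriv_cutoff : Continuous (deriv cutoff) :=
  (contDiff_cutoff (n := 1)).continuous_deriv le_rfl

/-- The derivative is supported in `[1, 2]`. The factor `t` reflects its use: a test function of
size `O(|h|)` multiplied by `k η'(k h)` stays bounded uniformly in `k`. -/
lemma exists_bound_mul_deriv_cutoff : ∃ C : ℝ, ∀ t, |t * deriv cutoff t| ≤ C := by
  obtain ⟨C, hC⟩ := (isCompact_Icc (a := (1 : ℝ)) (b := 2)).exists_bound_of_continuousOn
    (f := fun t ↦ t * deriv cutoff t) (continuous_id.mul continuous_deriv_cutoff).continuousOn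
  have hC0 : 0 ≤ C := (norm_nonneg _).trans (hC 1 (by simp))
  refine ⟨C, fun t ↦ ?_⟩
  rcases lt_or_ge t 1 with h | h
  · simpa [deriv_cutoff_of_lt_one h] using hC0
  rcases lt_or_ge 2 t with h' | h'
  · simpa [deriv_cutoff_of_two_lt h'] using hC0
  exact hC t ⟨h, h'⟩

lemma hasGradientAt_cutoff_mul {φ : Plane → ℝ} (h1 : ContDiff ℝ 1 φ) (c ν x : Plane) (k : ℝ) :
    HasGradientAt (fun x ↦ cutoff (k * height c ν x) * φ x)
      (cutoff (k * height c ν x) • ∇ φ x +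
        (φ x * (k * deriv cutoff (k * height c ν x))) • ν) x := by
  have hφ := (h1.differentiable one_ne_zero x).hasGradientAt.hasFDerivAt
  have hη : HasDerivAt cutoff (deriv cutoff (k * height c ν x)) (k * height c ν x) :=
    ((contDiff_cutoff (n := 1)).differentiable one_ne_zero _).hasDerivAt
  have hh : HasFDerivAt (fun x ↦ k * height c ν x) (k • innerSL ℝ ν) x := by
    have := ((innerSL ℝ ν).hasFDerivAt (x := x - c)).comp x ((hasFDerivAt_id x).sub_const c)
    exact this.const_mul k
  rw [hasGradientAt_iff_hasFDerivAt]
  refine ((hη.comp_hasFDerivAt x hh).mul hφ).congr_fderiv ?_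
  ext v
  simp
  ring

namespace Folding

variable {Ω T : Set Plane} {c ν : Plane}

lemma memLp_finite (h : Folding Ω T c ν) : IsFiniteMeasure (vol T) :=
  ⟨by
    rw [Measure.restrict_apply_univ]
    exact (h.isBounded.subset h.half_subset).measure_lt_top⟩

/-- A test function on `Ω` need not vanish near the mirror, so it is not admissible on `T`;
multiplying it by a cutoff that is zero within `1/k` of the mirror makes it so, at the cost of the
term with the derivative of the cutoff. -/
lemma integral_cutoff_mul (h : Folding Ω T c ν) {u : Plane → ℝ} {G : Plane → Plane}
    (hu : MemLp u 2 (vol T)) (hG : MemLp G 2 (vol T)) (hw : HasWeakGradient T u G) {φ : Plane → ℝ}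
    (h1 : ContDiff ℝ ∞ φ) (h2 : HasCompactSupport φ) (h3 : tsupport φ ⊆ Ω) (e : Plane) {k : ℝ}
    (hk : 0 < k) :
    ∫ x in T, cutoff (k * height c ν x) * (u x * inner ℝ (∇ φ x) e + φ x * inner ℝ (G x) e) +
      u x * (φ x * (k * deriv cutoff (k * height c ν x)) * inner ℝ ν e) = 0 := by
  have hc : ContDiff ℝ 1 φ := h1.of_le (by exact_mod_cast le_top)
  have hη : ContDiff ℝ ∞ (fun x ↦ cutoff (k * height c ν x)) := by
    exact contDiff_cutoff.comp (contDiff_const.mul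
      (contDiff_const.inner ℝ (contDiff_id.sub contDiff_const)))
  have hsub : tsupport (fun x ↦ cutoff (k * height c ν x) * φ x) ⊆
      tsupport φ ∩ {x | 1 ≤ k * height c ν x} := by
    refine closure_minimal (fun x hx ↦ ⟨subset_tsupport φ (right_ne_zero_of_mul hx), ?_⟩)
      ((isClosed_tsupport φ).inter (isClosed_le continuous_const
        ((continuous_height c ν).const_mul k)))
    by_contra hlt
    exact left_ne_zero_of_mul hx (cutoff_of_le_one (not_le.mp hlt).le)
  have := (hasWeakGradient_iff hu hG).mp hw (fun x ↦ cutoff (k * height c ν x) * φ x)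
    (hη.mul h1) (h2.mul_left) (fun x hx ↦ ?_) e
  · rw [← this, green]
    congr 1
    ext1 x
    rw [(hasGradientAt_cutoff_mul hc c ν x k).gradient, inner_add_left, real_inner_smul_left,
      real_inner_smul_left]
    ring
  · rw [h.half_eq]
    obtain ⟨hx1, hx2⟩ := hsub hx
    exact ⟨h3 hx1, pos_of_mul_pos_right (lt_of_lt_of_le one_pos hx2) hk.le⟩

lemma tendsto_cutoff (h : Folding Ω T c ν) {x : Plane} (hx : x ∈ T) :
    ∀ᶠ n : ℕ in atTop, 2 < ((n : ℝ) + 1) * height c ν x := by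
  have h0 := h.height_pos hx
  have : Tendsto (fun n : ℕ ↦ ((n : ℝ) + 1) * height c ν x) atTop atTop :=
    (tendsto_atTop_add_const_right _ _ tendsto_natCast_atTop_atTop).atTop_mul_const h0
  exact this.eventually_gt_atTop 2

lemma tendsto_integral_cutoff (h : Folding Ω T c ν) {f : Plane → ℝ} (hf : Integrable f (vol T)) :
    Tendsto (fun n : ℕ ↦ ∫ x in T, cutoff (((n : ℝ) + 1) * height c ν x) * f x) atTop
      (𝓝 (∫ x in T, f x)) := by
  have hm : ∀ n : ℕ, Continuous fun x ↦ cutoff (((n : ℝ) + 1) * height c ν x) := fun n ↦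
    (contDiff_cutoff (n := 0)).continuous.comp ((continuous_height c ν).const_mul _)
  refine tendsto_integral_of_dominated_convergence (fun x ↦ ‖f x‖)
    (fun n ↦ (hm n).aestronglyMeasurable.mul hf.aestronglyMeasurable) hf.norm
    (fun n ↦ .of_forall fun x ↦ ?_) ?_
  · rw [norm_mul]
    refine mul_le_of_le_one_left (norm_nonneg _) ?_
    rw [cutoff, Real.norm_of_nonneg (Real.smoothTransition.nonneg _)]
    exact Real.smoothTransition.le_one _
  · refine (ae_restrict_iff' h.isOpen_half.measurableSet).mpr (.of_forall fun x hx ↦ ?_)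
    refine tendsto_const_nhds.congr' ?_
    filter_upwards [h.tendsto_cutoff hx] with n hn
    rw [cutoff_of_two_le hn.le, one_mul]

/-- The gradient of the cutoff is normal to the mirror, so the extra term is zero in a tangential
direction, whatever `u` does on the mirror. -/
lemma green_tangential (h : Folding Ω T c ν) {u : Plane → ℝ} {G : Plane → Plane}
    (hu : MemLp u 2 (vol T)) (hG : MemLp G 2 (vol T)) (hw : HasWeakGradient T u G) {φ : Plane → ℝ}
    (h1 : ContDiff ℝ ∞ φ) (h2 : HasCompactSupport φ) (h3 : tsupport φ ⊆ Ω) {e : Plane}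
    (he : inner ℝ ν e = 0) : green T u G φ e = 0 := by
  have hc : ContDiff ℝ 1 φ := h1.of_le (by exact_mod_cast le_top)
  refine tendsto_nhds_unique
    (h.tendsto_integral_cutoff (MemLp.integrable_green hu hG hc h2 e)) ?_
  refine tendsto_const_nhds.congr fun n ↦ ?_
  rw [← h.integral_cutoff_mul hu hG hw h1 h2 h3 e (k := n + 1) (by positivity)]
  simp [he]

/-- Since `φ` is Lipschitz and zero on the mirror, it is `O(|h|)`, which compensates the factor `k`
in the derivative of the cutoff. The extra term is then dominated by a multiple of `|u|` and
vanishes pointwise for large `k`. -/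
lemma green_of_vanishing (h : Folding Ω T c ν) {u : Plane → ℝ} {G : Plane → Plane}
    (hu : MemLp u 2 (vol T)) (hG : MemLp G 2 (vol T)) (hw : HasWeakGradient T u G) {φ : Plane → ℝ}
    (h1 : ContDiff ℝ ∞ φ) (h2 : HasCompactSupport φ) (h3 : tsupport φ ⊆ Ω)
    (h4 : ∀ x, height c ν x = 0 → φ x = 0) (e : Plane) : green T u G φ e = 0 := by
  have hc : ContDiff ℝ 1 φ := h1.of_le (by exact_mod_cast le_top)
  have i := MemLp.integrable_green hu hG hc h2 e
  obtain ⟨K, hK⟩ := hc.lipschitzWith_of_hasCompactSupport h2 one_ne_zero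
  obtain ⟨C, hC⟩ := exists_bound_mul_deriv_cutoff
  have hC0 : 0 ≤ C := (abs_nonneg _).trans (hC 0)
  have hφ : ∀ x, |φ x| ≤ K * |height c ν x| := fun x ↦ by
    -- The foot of the perpendicular from `x` to the mirror line, where `φ` vanishes.
    have e1 : height c ν (x - height c ν x • ν) = 0 := by
      have e2 : x - height c ν x • ν - c = (x - c) - height c ν x • ν := by abel
      rw [height, e2, inner_sub_right, real_inner_smul_right, real_inner_self_eq_norm_sq,
        h.norm_normal]
      simp
    have e3 := hK.dist_le_mul x (x - height c ν x • ν)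
    rwa [h4 _ e1, dist_zero_right, Real.norm_eq_abs, dist_eq_norm, sub_sub_cancel, norm_smul,
      h.norm_normal, mul_one, Real.norm_eq_abs] at e3
  have hfin := h.memLp_finite
  have iu : Integrable u (vol T) := hu.integrable (by norm_num)
  have hcont : ∀ n : ℕ, Continuous fun x ↦ φ x * (((n : ℝ) + 1) *
      deriv cutoff (((n : ℝ) + 1) * height c ν x)) * inner ℝ ν e := fun n ↦ by
    have h5 : Continuous fun x ↦ deriv cutoff (((n : ℝ) + 1) * height c ν x) :=
      continuous_deriv_cutoff.comp ((continuous_height c ν).const_mul _)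
    have h6 := h1.continuous
    fun_prop
  have hbound : ∀ (n : ℕ) (x : Plane), ‖u x * (φ x * (((n : ℝ) + 1) *
      deriv cutoff (((n : ℝ) + 1) * height c ν x)) * inner ℝ ν e)‖ ≤
        ‖u x‖ * (K * C * |inner ℝ ν e|) := fun n x ↦ by
    rw [norm_mul, norm_mul, norm_mul, Real.norm_eq_abs (inner ℝ ν e), Real.norm_eq_abs (φ x)]
    refine mul_le_mul_of_nonneg_left (mul_le_mul_of_nonneg_right ?_ (abs_nonneg _)) (norm_nonneg _)
    calc |φ x| * ‖((n : ℝ) + 1) * deriv cutoff (((n : ℝ) + 1) * height c ν x)‖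
        ≤ K * |height c ν x| * ‖((n : ℝ) + 1) * deriv cutoff (((n : ℝ) + 1) * height c ν x)‖ := by
          gcongr
          exact hφ x
      _ = K * |((n : ℝ) + 1) * height c ν x * deriv cutoff (((n : ℝ) + 1) * height c ν x)| := by
          rw [Real.norm_eq_abs, mul_assoc, ← abs_mul]
          congr 2
          ring
      _ ≤ K * C := by
          gcongr
          exact hC _
  have lim2 : Tendsto (fun n : ℕ ↦ ∫ x in T, u x * (φ x * (((n : ℝ) + 1) *
      deriv cutoff (((n : ℝ) + 1) * height c ν x)) * inner ℝ ν e)) atTop (𝓝 0) := by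
    have := tendsto_integral_of_dominated_convergence (μ := vol T) (f := fun _ ↦ (0 : ℝ))
      (F := fun (n : ℕ) x ↦ u x * (φ x * (((n : ℝ) + 1) *
        deriv cutoff (((n : ℝ) + 1) * height c ν x)) * inner ℝ ν e))
      (fun x ↦ ‖u x‖ * (K * C * |inner ℝ ν e|))
      (fun n ↦ hu.aestronglyMeasurable.mul (hcont n).aestronglyMeasurable)
      (iu.norm.mul_const _) (fun n ↦ .of_forall (hbound n))
      ((ae_restrict_iff' h.isOpen_half.measurableSet).mpr (.of_forall fun x hx ↦
        tendsto_const_nhds.congr' ?_))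
    · simpa using this
    · filter_upwards [h.tendsto_cutoff hx] with n hn
      simp [deriv_cutoff_of_two_lt hn]
  have lim := (h.tendsto_integral_cutoff i).add lim2
  rw [add_zero] at lim
  refine tendsto_nhds_unique lim (tendsto_const_nhds.congr fun n ↦ ?_)
  rw [← h.integral_cutoff_mul hu hG hw h1 h2 h3 e (k := n + 1) (by positivity)]
  refine integral_add ?_ ?_
  · refine i.bdd_mul (c := 1) ?_ (.of_forall fun x ↦ ?_)
    · exact ((contDiff_cutoff (n := 0)).continuous.comp
        ((continuous_height c ν).const_mul _)).aestronglyMeasurable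
    · rw [cutoff, Real.norm_of_nonneg (Real.smoothTransition.nonneg _)]
      exact Real.smoothTransition.le_one _
  · exact (iu.norm.mul_const _).mono' (hu.aestronglyMeasurable.mul (hcont n).aestronglyMeasurable)
      (.of_forall (hbound n))

end Folding

/-! ### Green's formula in the normal direction -/

lemma exists_unit_tangent {ν : Plane} (hν : ‖ν‖ = 1) : ∃ e : Plane, ‖e‖ = 1 ∧ inner ℝ ν e = 0 := by
  obtain ⟨n, hn, hnv⟩ := exists_normal (v := ν) (by rintro rfl; simp at hν)
  refine ⟨‖n‖⁻¹ • n, ?_, ?_⟩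
  · rw [norm_smul, norm_inv, norm_norm, inv_mul_cancel₀ (norm_ne_zero_iff.mpr hn)]
  · rw [real_inner_smul_right, real_inner_comm, hnv, mul_zero]

lemma height_coordinates {ν e : Plane} (hν : ‖ν‖ = 1) (he : inner ℝ ν e = 0) (c : Plane)
    (a b : ℝ) : height c ν (c + (a • e + b • ν)) = b := by
  rw [height, add_sub_cancel_left, inner_add_right, real_inner_smul_right, real_inner_smul_right,
    he, real_inner_self_eq_norm_sq, hν]
  ring

/-- Fubini in coordinates along `e` and `ν`, with the fundamental theorem of calculus on each normal
half-line. The constant is minus the Jacobian factor, and its value plays no role. -/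
lemma exists_integral_halfPlane_eq {ν e : Plane} (hν : ‖ν‖ = 1) (he : ‖e‖ = 1)
    (hνe : inner ℝ ν e = 0) (c : Plane) :
    ∃ κ : ℝ, ∀ f : Plane → ℝ, ContDiff ℝ 1 f → HasCompactSupport f →
      ∫ x in {x | 0 < height c ν x}, inner ℝ (∇ f x) ν = κ * ∫ a : ℝ, f (c + a • e) := by
  have hind : ∀ a b : ℝ, a • e + b • ν = 0 → a = 0 ∧ b = 0 := by
    intro a b h
    have h1 := congrArg (inner ℝ ν) h
    have h2 := congrArg (inner ℝ e) h
    simp only [inner_add_right, real_inner_smul_right, hνe, real_inner_self_eq_norm_sq, hν, he,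
      real_inner_comm ν e, inner_zero_right] at h1 h2
    constructor <;> linarith
  obtain ⟨κ, hκ0, hκ, hvol⟩ := exists_volume_eq_smul_map hind
  refine ⟨-κ.toReal, fun f h1 h2 ↦ ?_⟩
  set Φ : ℝ × ℝ → Plane := fun z ↦ c + (z.1 • e + z.2 • ν) with hΦ
  have mΦ : Measurable Φ := by fun_prop
  have hS : MeasurableSet {x | 0 < height c ν x} :=
    (isOpen_lt continuous_const (continuous_height c ν)).measurableSet
  set F : Plane → ℝ := {x | 0 < height c ν x}.indicator (fun x ↦ inner ℝ (∇ f x) ν) with hF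
  have hcg : Continuous fun x ↦ inner ℝ (∇ f x) ν := by
    have := continuous_gradient h1
    fun_prop
  have hs : HasCompactSupport (fun x ↦ inner ℝ (∇ f x) ν) := by
    have := h2.fderiv (𝕜 := ℝ)
    exact this.comp_left (g := fun l ↦ inner ℝ ((InnerProductSpace.toDual ℝ Plane).symm l) ν)
      (by simp)
  have mF : StronglyMeasurable F := hcg.stronglyMeasurable.indicator hS
  have iF : Integrable F volume := (hcg.integrable_of_hasCompactSupport hs).indicator hS
  have hFΦ : ∀ a b, F (Φ (a, b)) =
      (Set.Ioi 0).indicator (fun b ↦ inner ℝ (∇ f (c + a • e + b • ν)) ν) b := fun a b ↦ by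
    simp only [hF, Set.indicator_apply, hΦ, Set.mem_ofPred_eq, height_coordinates hν hνe,
      Set.mem_Ioi, add_assoc]
  have iFΦ : Integrable (fun z ↦ F (Φ z)) (volume.prod volume) := by
    rw [hvol c, integrable_smul_measure hκ0 hκ,
      integrable_map_measure mF.aestronglyMeasurable mΦ.aemeasurable] at iF
    exact iF
  have hline : ∀ a : ℝ, ∫ b, F (Φ (a, b)) = -f (c + a • e) := fun a ↦ by
    simp only [hFΦ]
    rw [integral_indicator measurableSet_Ioi]
    have hfl : ContDiff ℝ 1 (fun b : ℝ ↦ f (c + a • e + b • ν)) := h1.comp (by fun_prop)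
    have hcl : HasCompactSupport (fun b : ℝ ↦ f (c + a • e + b • ν)) :=
      h2.comp_isClosedEmbedding (isometry_line hν (c + a • e)).isClosedEmbedding
    have := hcl.integral_Ioi_deriv_eq hfl 0
    simp only [(hasDerivAt_line h1 _ ν _).deriv, zero_smul, add_zero] at this
    exact this
  calc ∫ x in {x | 0 < height c ν x}, inner ℝ (∇ f x) ν = ∫ x, F x :=
        (integral_indicator hS).symm
    _ = κ.toReal * ∫ z, F (Φ z) := by
        conv_lhs => rw [hvol c, integral_smul_measure,
          integral_map mΦ.aemeasurable mF.aestronglyMeasurable, smul_eq_mul]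
    _ = -κ.toReal * ∫ a : ℝ, f (c + a • e) := by
        rw [Measure.volume_eq_prod, integral_prod _ iFΦ]
        simp only [hline]
        rw [integral_neg]
        ring

lemma tendsto_integral_mul_of_eLpNorm {α : Type*} [MeasurableSpace α] {μ : Measure α}
    {f : ℕ → α → ℝ} {a g : α → ℝ} (hf : ∀ n, AEStronglyMeasurable (f n) μ) (ha : MemLp a 2 μ)
    (hg : MemLp g 2 μ) (h : Tendsto (fun n ↦ eLpNorm (f n - a) 2 μ) atTop (𝓝 0)) :
    Tendsto (fun n ↦ ∫ x, f n x * g x ∂μ) atTop (𝓝 (∫ x, a x * g x ∂μ)) := by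
  have hev : ∀ᶠ n in atTop, MemLp (f n) 2 μ := by
    filter_upwards [h.eventually_lt_const (ENNReal.zero_lt_top)] with n hn
    have h1 : MemLp (f n - a) 2 μ := ⟨(hf n).sub ha.1, hn⟩
    simpa using h1.add ha
  refine tendsto_integral_of_L1 _ (memLp_one_iff_integrable.mp (hg.mul ha)).1
    (hev.mono fun n hn ↦ memLp_one_iff_integrable.mp (hg.mul hn)) ?_
  have hlim := ENNReal.Tendsto.mul_const (b := eLpNorm g 2 μ) h (Or.inr hg.eLpNorm_ne_top)
  rw [zero_mul] at hlim
  refine tendsto_of_tendsto_of_tendsto_of_le_of_le tendsto_const_nhds hlim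
    (fun _ ↦ zero_le) fun n ↦ ?_
  have := eLpNorm_smul_le_mul_eLpNorm (p := 2) (q := 2) (r := 1) hg.1 ((hf n).sub ha.1)
  rw [eLpNorm_one_eq_lintegral_enorm] at this
  simpa [sub_mul] using this

namespace Folding

variable {Ω T : Set Plane} {c ν : Plane}

lemma integral_half_eq (h : Folding Ω T c ν) {f : Plane → ℝ} (hs : tsupport f ⊆ Ω) :
    ∫ x in T, inner ℝ (∇ f x) ν = ∫ x in {x | 0 < height c ν x}, inner ℝ (∇ f x) ν := by
  have hS : MeasurableSet {x | 0 < height c ν x} :=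
    (isOpen_lt continuous_const (continuous_height c ν)).measurableSet
  refine (setIntegral_eq_of_subset_of_forall_sdiff_eq_zero hS
    (fun x hx ↦ h.height_pos hx) fun x hx ↦ ?_).symm
  have hx' : x ∉ tsupport f := fun hxs ↦ hx.2 (h.half_eq ▸ ⟨hs hxs, hx.1⟩)
  have : ∇ f x = 0 := by
    rw [gradient, fderiv_of_notMem_tsupport (𝕜 := ℝ) hx', map_zero]
  rw [this, inner_zero_left]

/-- For the smooth approximants `w n` the expression is a boundary integral of `w n φ` along the
mirror line. As `φ` is supported in `Ω`, only points of `Γ` contribute, and there `w n` tends to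
zero in `L²`. -/
lemma green_normal (h : Folding Ω T c ν) {Γ : Set Plane} {u : Plane → ℝ} {G : Plane → Plane}
    (hu : MemLp u 2 (vol T)) (hG : MemLp G 2 (vol T)) (hΓ : ∀ x ∈ Ω, height c ν x = 0 → x ∈ Γ)
    (ht : HasTrace T Γ u G 0) {φ : Plane → ℝ}
    (h1 : ContDiff ℝ 1 φ) (h2 : HasCompactSupport φ) (h3 : tsupport φ ⊆ Ω) :
    green T u G φ ν = 0 := by
  obtain ⟨e, he, hνe⟩ := exists_unit_tangent h.norm_normal
  obtain ⟨κ, hκ⟩ := exists_integral_halfPlane_eq h.norm_normal he hνe c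
  obtain ⟨w, hw, l1, l2, l3⟩ := ht
  have hcw := fun n ↦ (hw n).continuous
  have hcg := fun n ↦ continuous_gradient (hw n)
  have hφ2 : MemLp φ 2 (vol T) := (h1.continuous.memLp_of_hasCompactSupport h2).restrict T
  have hgφ : MemLp (fun x ↦ inner ℝ (∇ φ x) ν) 2 (vol T) :=
    (memLp_inner_gradient h1 h2 ν).restrict T
  have hfin := h.memLp_finite
  have l2' : Tendsto (fun n ↦ eLpNorm ((fun x ↦ inner ℝ (∇ (w n) x) ν) -
      fun x ↦ inner ℝ (G x) ν) 2 (vol T)) atTop (𝓝 0) := by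
    refine tendsto_of_tendsto_of_tendsto_of_le_of_le tendsto_const_nhds l2
      (fun _ ↦ zero_le) fun n ↦ eLpNorm_mono fun x ↦ ?_
    rw [Pi.sub_apply, ← inner_sub_left, Pi.sub_apply]
    simpa [h.norm_normal] using norm_inner_le_norm (𝕜 := ℝ) (∇ (w n) x - G x) ν
  have t1 := tendsto_integral_mul_of_eLpNorm (fun n ↦ (hcw n).aestronglyMeasurable) hu hgφ l1
  have t2 := tendsto_integral_mul_of_eLpNorm (fun n ↦ by
    have := hcg n
    exact Continuous.aestronglyMeasurable (by fun_prop)) (hG.inner_const ν) hφ2 l2'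
  have t3 := t1.add t2
  have elim : green T u G φ ν = (∫ x in T, u x * inner ℝ (∇ φ x) ν) +
      ∫ x in T, inner ℝ (G x) ν * φ x := by
    have i1 : Integrable (fun x ↦ u x * inner ℝ (∇ φ x) ν) (vol T) :=
      memLp_one_iff_integrable.mp (hgφ.mul hu)
    have i2 : Integrable (fun x ↦ inner ℝ (G x) ν * φ x) (vol T) :=
      memLp_one_iff_integrable.mp (hφ2.mul (hG.inner_const ν))
    rw [← integral_add i1 i2, green]
    simp only [mul_comm]
  rw [← elim] at t3
  set γ : ℝ → Plane := fun a ↦ c + a • e with hγ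
  have hγi : Isometry γ := isometry_line he c
  -- The intersection with the range of `γ` is taken because `Γ` is not assumed to lie on the mirror
  -- line.
  have eseq : ∀ n, (∫ x in T, w n x * inner ℝ (∇ φ x) ν) + ∫ x in T, inner ℝ (∇ (w n) x) ν * φ x =
      κ * ∫ a in γ ⁻¹' (Γ ∩ Set.range γ), w n (γ a) * φ (γ a) := by
    intro n
    have hcφ := h1.continuous
    have hcgφ := continuous_gradient h1
    have hsg : HasCompactSupport (fun x ↦ inner ℝ (∇ φ x) ν) := by
      have := h2.fderiv (𝕜 := ℝ)
      exact this.comp_left (g := fun l ↦ inner ℝ ((InnerProductSpace.toDual ℝ Plane).symm l) ν)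
        (by simp)
    have c1 : Continuous (∇ (w n)) := hcg n
    have i1 : Integrable (fun x ↦ w n x * inner ℝ (∇ φ x) ν) (vol T) :=
      (((hcw n).mul (by fun_prop)).integrable_of_hasCompactSupport hsg.mul_left).restrict
    have i2 : Integrable (fun x ↦ inner ℝ (∇ (w n) x) ν * φ x) (vol T) :=
      (Continuous.integrable_of_hasCompactSupport (by fun_prop) h2.mul_left).restrict
    have hgr : ∀ x, w n x * inner ℝ (∇ φ x) ν + inner ℝ (∇ (w n) x) ν * φ x =
        inner ℝ (∇ (fun x ↦ w n x * φ x) x) ν := fun x ↦ by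
      have d1 := ((hw n).differentiable one_ne_zero x).hasGradientAt.hasFDerivAt
      have d2 := (h1.differentiable one_ne_zero x).hasGradientAt.hasFDerivAt
      have d3 : HasGradientAt (fun x ↦ w n x * φ x) (w n x • ∇ φ x + φ x • ∇ (w n) x) x := by
        rw [hasGradientAt_iff_hasFDerivAt]
        refine (d1.mul d2).congr_fderiv ?_
        simp
      rw [d3.gradient, inner_add_left, real_inner_smul_left, real_inner_smul_left]
      ring
    rw [← integral_add i1 i2]
    simp only [hgr]
    rw [h.integral_half_eq ((closure_mono (Function.support_mul_subset_right _ _)).trans h3),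
      hκ _ ((hw n).mul h1) h2.mul_left]
    congr 1
    refine (setIntegral_eq_integral_of_forall_compl_eq_zero fun a ha ↦ ?_).symm
    have : φ (γ a) = 0 := by
      by_contra hne
      refine ha ⟨hΓ _ (h3 (subset_tsupport φ hne)) ?_, a, rfl⟩
      simpa using height_coordinates h.norm_normal hνe c a 0
    change w n (γ a) * φ (γ a) = 0
    rw [this, mul_zero]
  have l3' : Tendsto (fun n ↦ eLpNorm ((fun a ↦ w n (γ a)) - 0) 2
      (volume.restrict (γ ⁻¹' (Γ ∩ Set.range γ)))) atTop (𝓝 0) := by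
    refine tendsto_of_tendsto_of_tendsto_of_le_of_le tendsto_const_nhds l3
      (fun _ ↦ zero_le) fun n ↦ ?_
    rw [sub_zero, sub_zero]
    have e1 := hausdorffMeasure_restrict_line he c (S := Γ ∩ Set.range γ) Set.inter_subset_right
    calc eLpNorm (fun a ↦ w n (γ a)) 2 (volume.restrict (γ ⁻¹' (Γ ∩ Set.range γ)))
        = eLpNorm (w n) 2 ((Measure.hausdorffMeasure 1).restrict (Γ ∩ Set.range γ)) := by
          rw [e1, eLpNorm_map_measure (hcw n).aestronglyMeasurable hγi.continuous.aemeasurable]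
          rfl
      _ ≤ _ := eLpNorm_mono_measure _ (Measure.restrict_mono Set.inter_subset_left le_rfl)
  have hφγ : MemLp (fun a ↦ φ (γ a)) 2 (volume.restrict (γ ⁻¹' (Γ ∩ Set.range γ))) :=
    (Continuous.memLp_of_hasCompactSupport (h1.continuous.comp hγi.continuous)
      (h2.comp_isClosedEmbedding hγi.isClosedEmbedding)).restrict _
  have t4 := tendsto_integral_mul_of_eLpNorm
    (fun n ↦ ((hcw n).comp hγi.continuous).aestronglyMeasurable) (MemLp.zero) hφγ l3'
  have t5 := t4.const_mul κ
  simp only [Pi.zero_apply, zero_mul, integral_zero, mul_zero] at t5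
  exact tendsto_nhds_unique t3 (t5.congr fun n ↦ (eseq n).symm)

end Folding

/-! ### Convergence in `H¹` and traces under restriction and reflection -/

lemma hasGradientAt_comp_mirror {w : Plane → ℝ} (hw : ContDiff ℝ 1 w) (c ν x : Plane) :
    HasGradientAt (w ∘ mirror c ν) (mirrorLin ν (∇ w (mirror c ν x))) x := by
  have h1 := (hw.differentiable one_ne_zero (mirror c ν x)).hasGradientAt.hasFDerivAt
  have h2 : HasFDerivAt (mirror c ν)
      ((mirrorLin ν).toContinuousLinearEquiv : Plane →L[ℝ] Plane) x := by
    have := ((mirrorLin ν).toContinuousLinearEquiv.hasFDerivAt (x := x - c)).comp x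
      ((hasFDerivAt_id x).sub_const c)
    exact this.add_const c
  rw [hasGradientAt_iff_hasFDerivAt]
  refine (h1.comp x h2).congr_fderiv ?_
  ext v
  simp [inner_mirrorLin]

lemma gradient_comp_mirror {w : Plane → ℝ} (hw : ContDiff ℝ 1 w) (c ν x : Plane) :
    ∇ (w ∘ mirror c ν) x = mirrorLin ν (∇ w (mirror c ν x)) :=
  (hasGradientAt_comp_mirror hw c ν x).gradient

lemma eLpNorm_hausdorff_comp_mirror (c ν : Plane) (S : Set Plane) {w : Plane → ℝ}
    (hw : Continuous w) :
    eLpNorm (w ∘ mirror c ν) 2 ((Measure.hausdorffMeasure 1).restrict (mirror c ν ⁻¹' S)) =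
      eLpNorm w 2 ((Measure.hausdorffMeasure 1).restrict S) := by
  have h1 : MeasurePreserving (mirror c ν) (Measure.hausdorffMeasure 1 : Measure Plane)
      (Measure.hausdorffMeasure 1) :=
    (IsometryEquiv.mk (mirrorHomeo c ν).toEquiv
      (isometry_mirror c ν)).measurePreserving_hausdorffMeasure 1
  exact eLpNorm_comp_measurePreserving hw.aestronglyMeasurable
    (h1.restrict_preimage_emb (measurableEmbedding_mirror c ν) S)

lemma TendstoH1.mono {Ω T : Set Plane} {w : ℕ → Plane → ℝ} {u : Plane → ℝ} {G : Plane → Plane}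
    (h : TendstoH1 Ω w u G) (hT : T ⊆ Ω) : TendstoH1 T w u G :=
  ⟨h.1, tendsto_of_tendsto_of_tendsto_of_le_of_le tendsto_const_nhds h.2.1 (fun _ ↦ zero_le)
      fun _ ↦ eLpNorm_mono_measure _ (Measure.restrict_mono hT le_rfl),
    tendsto_of_tendsto_of_tendsto_of_le_of_le tendsto_const_nhds h.2.2 (fun _ ↦ zero_le)
      fun _ ↦ eLpNorm_mono_measure _ (Measure.restrict_mono hT le_rfl)⟩

lemma TendstoH1.congr {Ω : Set Plane} {w : ℕ → Plane → ℝ} {u u' : Plane → ℝ}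
    {G G' : Plane → Plane} (h : TendstoH1 Ω w u G) (hu : u =ᵐ[vol Ω] u') (hG : G =ᵐ[vol Ω] G') :
    TendstoH1 Ω w u' G' := by
  refine ⟨h.1, h.2.1.congr fun n ↦ eLpNorm_congr_ae ?_, h.2.2.congr fun n ↦ eLpNorm_congr_ae ?_⟩
  · filter_upwards [hu] with x hx
    simp [hx]
  · filter_upwards [hG] with x hx
    simp [hx]

lemma HasTrace.mono {Ω T Γ Γ' : Set Plane} {u : Plane → ℝ} {G : Plane → Plane}
    (h : HasTrace Ω Γ u G 0) (hT : T ⊆ Ω) (hΓ : Γ' ⊆ Γ) : HasTrace T Γ' u G 0 := by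
  obtain ⟨w, h1, h2, h3, h4⟩ := h
  obtain ⟨h1', h2', h3'⟩ := TendstoH1.mono ⟨h1, h2, h3⟩ hT
  exact ⟨w, h1', h2', h3', tendsto_of_tendsto_of_tendsto_of_le_of_le tendsto_const_nhds h4
    (fun _ ↦ zero_le) fun _ ↦ eLpNorm_mono_measure _ (Measure.restrict_mono hΓ le_rfl)⟩

lemma HasWeakGradient.mono {Ω T : Set Plane} (hΩ : MeasurableSet Ω) {u : Plane → ℝ}
    {G : Plane → Plane} (h : HasWeakGradient Ω u G) (hT : T ⊆ Ω) : HasWeakGradient T u G := by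
  intro φ h1 h2 h3
  have := h φ h1 h2 (h3.trans hT)
  have hφ : ∀ x ∈ Ω \ T, φ x = 0 := fun x hx ↦
    image_eq_zero_of_notMem_tsupport fun hx' ↦ hx.2 (h3 hx')
  have hg : ∀ x ∈ Ω \ T, ∇ φ x = 0 := fun x hx ↦ by
    rw [gradient, fderiv_of_notMem_tsupport (𝕜 := ℝ) fun hx' ↦ hx.2 (h3 hx'), map_zero]
  rwa [setIntegral_eq_of_subset_of_forall_sdiff_eq_zero hΩ hT fun x hx ↦ by simp [hg x hx],
    setIntegral_eq_of_subset_of_forall_sdiff_eq_zero hΩ hT fun x hx ↦ by simp [hφ x hx]] at this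

namespace Folding

variable {Ω T : Set Plane} {c ν : Plane}

lemma tendstoH1_comp_mirror (h : Folding Ω T c ν) {w : ℕ → Plane → ℝ} {u : Plane → ℝ}
    {G : Plane → Plane} (hu : AEStronglyMeasurable u (vol Ω)) (hG : AEStronglyMeasurable G (vol Ω))
    (hw : TendstoH1 Ω w u G) :
    TendstoH1 Ω (fun n ↦ w n ∘ mirror c ν) (u ∘ mirror c ν)
      (fun x ↦ mirrorLin ν (G (mirror c ν x))) := by
  obtain ⟨h1, h2, h3⟩ := hw
  have hp := h.measurePreserving_mirror
  refine ⟨fun n ↦ (h1 n).comp (contDiff_mirror c ν), h2.congr fun n ↦ ?_, h3.congr fun n ↦ ?_⟩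
  · exact (eLpNorm_comp_measurePreserving ((h1 n).continuous.aestronglyMeasurable.sub hu) hp).symm
  · rw [← eLpNorm_comp_measurePreserving
      ((continuous_gradient (h1 n)).aestronglyMeasurable.sub hG) hp]
    refine eLpNorm_congr_norm_ae (.of_forall fun x ↦ ?_)
    rw [Pi.sub_apply, gradient_comp_mirror (h1 n), ← map_sub, LinearIsometryEquiv.norm_map]
    rfl

lemma hasTrace_comp_mirror (h : Folding Ω T c ν) {Γ : Set Plane} {u : Plane → ℝ}
    {G : Plane → Plane} (hu : AEStronglyMeasurable u (vol Ω)) (hG : AEStronglyMeasurable G (vol Ω))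
    (ht : HasTrace Ω Γ u G 0) :
    HasTrace Ω (mirror c ν ⁻¹' Γ) (u ∘ mirror c ν)
      (fun x ↦ mirrorLin ν (G (mirror c ν x))) 0 := by
  obtain ⟨w, h1, h2, h3, h4⟩ := ht
  obtain ⟨h1', h2', h3'⟩ := h.tendstoH1_comp_mirror hu hG ⟨h1, h2, h3⟩
  refine ⟨_, h1', h2', h3', h4.congr fun n ↦ ?_⟩
  rw [sub_zero, sub_zero, eLpNorm_hausdorff_comp_mirror c ν Γ (h1 n).continuous]

lemma memLp_comp_mirror (h : Folding Ω T c ν) {u : Plane → ℝ} (hu : MemLp u 2 (vol Ω)) :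
    MemLp (u ∘ mirror c ν) 2 (vol Ω) :=
  hu.comp_measurePreserving h.measurePreserving_mirror

lemma memLp_mirrorLin_comp_mirror (h : Folding Ω T c ν) {G : Plane → Plane}
    (hG : MemLp G 2 (vol Ω)) : MemLp (fun x ↦ mirrorLin ν (G (mirror c ν x))) 2 (vol Ω) :=
  ((mirrorLin ν).toContinuousLinearEquiv : Plane →L[ℝ] Plane).comp_memLp'
    (hG.comp_measurePreserving h.measurePreserving_mirror)

lemma hasWeakGradient_comp_mirror (h : Folding Ω T c ν) {u : Plane → ℝ} {G : Plane → Plane}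
    (hu : MemLp u 2 (vol Ω)) (hG : MemLp G 2 (vol Ω)) (hw : HasWeakGradient Ω u G) :
    HasWeakGradient Ω (u ∘ mirror c ν) (fun x ↦ mirrorLin ν (G (mirror c ν x))) := by
  rw [hasWeakGradient_iff hu hG] at hw
  rw [hasWeakGradient_iff (h.memLp_comp_mirror hu) (h.memLp_mirrorLin_comp_mirror hG)]
  intro φ h1 h2 h3 e
  have hsub : tsupport (φ ∘ mirror c ν) ⊆ Ω := fun x hx ↦ by
    have := tsupport_comp_subset_preimage φ (isometry_mirror c ν).continuous hx
    exact h.mirror_mem_iff.mp (h3 this)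
  rw [← hw (φ ∘ mirror c ν) (h1.comp (contDiff_mirror c ν)) (h2.comp_homeomorph (mirrorHomeo c ν))
    hsub (mirrorLin ν e), green, green,
    ← h.measurePreserving_mirror.integral_comp (measurableEmbedding_mirror c ν)]
  congr 1
  ext1 x
  rw [gradient_comp_mirror (h1.of_le (by exact_mod_cast le_top))]
  simp [inner_mirrorLin]

/-- Extension by reflection of functions in `L²(T)`. -/
noncomputable abbrev extS (h : Folding Ω T c ν) (τ : ℝ) (u : L2 T) : L2 Ω :=
  h.ext (LinearIsometryEquiv.refl ℝ ℝ) τ u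

/-- The corresponding extension of gradients. -/
noncomputable abbrev extV (h : Folding Ω T c ν) (τ : ℝ) (G : L2Vec T) : L2Vec Ω :=
  h.ext (mirrorLin ν) τ G

/-- The adjoint of the extension of functions. -/
noncomputable abbrev foldS (h : Folding Ω T c ν) (τ : ℝ) : L2 Ω →ₗ[ℝ] L2 T :=
  h.fold (LinearIsometryEquiv.refl ℝ ℝ) τ

/-- The adjoint of the extension of gradients. -/
noncomputable abbrev foldV (h : Folding Ω T c ν) (τ : ℝ) : L2Vec Ω →ₗ[ℝ] L2Vec T :=
  h.fold (mirrorLin ν) τ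

/-- Folding the integral onto `T` pairs `φ` with its mirror image `ψ`. Tangential contributions
vanish separately. The normal one is the Green term of `φ` minus `τ` times that of `ψ`: for `τ = 1`
it involves only `φ - ψ`, which is zero on the mirror, and otherwise both terms vanish by the zero
trace. -/
lemma hasWeakGradient_ext (h : Folding Ω T c ν) {τ : ℝ} {u : L2 T} {G : L2Vec T}
    (hw : HasWeakGradient T u G)
    (hτ : τ = 1 ∨ ∃ Γ, (∀ x ∈ Ω, height c ν x = 0 → x ∈ Γ) ∧ HasTrace T Γ u G 0) :
    HasWeakGradient Ω (h.extS τ u) (h.extV τ G) := by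
  have hu := Lp.memLp u
  have hG := Lp.memLp G
  rw [hasWeakGradient_iff (Lp.memLp _) (Lp.memLp _)]
  intro φ h1 h2 h3 e
  have hc : ContDiff ℝ 1 φ := h1.of_le (by exact_mod_cast le_top)
  set ψ := φ ∘ mirror c ν with hψ
  have h1' : ContDiff ℝ ∞ ψ := h1.comp (contDiff_mirror c ν)
  have hc' : ContDiff ℝ 1 ψ := h1'.of_le (by exact_mod_cast le_top)
  have h2' : HasCompactSupport ψ := h2.comp_homeomorph (mirrorHomeo c ν)
  have h3' : tsupport ψ ⊆ Ω := fun x hx ↦ by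
    have := tsupport_comp_subset_preimage φ (isometry_mirror c ν).continuous hx
    exact h.mirror_mem_iff.mp (h3 this)
  have key : ∀ e, green Ω (h.extS τ u) (h.extV τ G) φ e =
      green T u G φ e + τ * green T u G ψ (mirrorLin ν e) := fun e ↦ by
    rw [green, h.integral_eq (MemLp.integrable_green (Lp.memLp _) (Lp.memLp _) hc h2 e), green,
      green, ← integral_const_mul, ← integral_add (MemLp.integrable_green hu hG hc h2 e)
      ((MemLp.integrable_green hu hG hc' h2' _).const_mul τ)]
    refine integral_congr_ae ?_
    obtain ⟨a1, a2⟩ := h.ext_ae (LinearIsometryEquiv.refl ℝ ℝ) τ u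
    obtain ⟨a3, a4⟩ := h.ext_ae (mirrorLin ν) τ G
    filter_upwards [a1, a2, a3, a4] with x b1 b2 b3 b4
    rw [b1, b2, b3, b4, hψ, gradient_comp_mirror hc, ← inner_mirrorLin, mirrorLin_mirrorLin,
      real_inner_smul_left, inner_mirrorLin]
    simp
    ring
  rw [green_decompose (Lp.memLp _) (Lp.memLp _) hc h2 ν e (inner ℝ ν e)]
  have ht : inner ℝ ν (e - inner ℝ ν e • ν) = 0 := by
    rw [inner_sub_right, real_inner_smul_right, real_inner_self_eq_norm_sq, h.norm_normal]
    ring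
  rw [key, key, mirrorLin_of_inner_eq_zero ht, h.green_tangential hu hG hw h1 h2 h3 ht,
    h.green_tangential hu hG hw h1' h2' h3' ht, mirrorLin_normal]
  have hneg : green T u G ψ (-ν) = -green T u G ψ ν := by
    rw [green, green, ← integral_neg]
    congr 1
    ext1 x
    simp only [inner_neg_right]
    ring
  rw [hneg]
  rcases hτ with rfl | ⟨Γ, hΓ, htr⟩
  · have := h.green_of_vanishing hu hG hw (φ := φ - ψ) (h1.sub h1') (h2.sub h2')
      ((tsupport_sub φ ψ).trans (Set.union_subset h3 h3')) (fun x hx ↦ by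
        simp [hψ, mirror_of_height_eq_zero hx]) ν
    rw [green_sub_left hu hG hc h2 hc' h2'] at this
    linear_combination inner ℝ ν e * this
  · rw [h.green_normal hu hG hΓ htr hc h2 h3, h.green_normal hu hG hΓ htr hc' h2' h3']
    ring

end Folding

/-! ### Folding of eigenspaces -/

lemma eLpNorm_restrict_union_le {F : Type*} [NormedAddCommGroup F] {m : Measure Plane}
    (f : Plane → F) (A B : Set Plane) :
    eLpNorm f 2 (m.restrict (A ∪ B)) ≤ eLpNorm f 2 (m.restrict A) + eLpNorm f 2 (m.restrict B) := by
  rw [← ENNReal.pow_le_pow_left_iff two_ne_zero, eLpNorm_two_sq]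
  refine (lintegral_union_le _ _ _).trans ?_
  rw [← eLpNorm_two_sq, ← eLpNorm_two_sq, add_sq]
  gcongr
  exact le_self_add

namespace Folding

variable {Ω T : Set Plane} {c ν : Plane}

/-- Approximants of the extension restrict to approximants of `u` on `T`, and their mirror images to
approximants of `τ u`. Zero traces being independent of the sequence, both tend to zero on the side
of `T`, hence the original ones do on the side and its reflection. -/
lemma hasTrace_ext (h : Folding Ω T c ν) {τ : ℝ} {u : L2 T} {G : L2Vec T}
    (hw : HasWeakGradient Ω (h.extS τ u) (h.extV τ G)) {p q : Plane} (hp : p ∈ closure T)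
    (hq : q ∈ closure T) (ht : HasTrace T (segment ℝ p q) u G 0) {Γ : Set Plane}
    (hΓ : Γ ⊆ segment ℝ p q ∪ mirror c ν ⁻¹' segment ℝ p q) :
    HasTrace Ω Γ (h.extS τ u) (h.extV τ G) 0 := by
  obtain ⟨w, hH⟩ := exists_tendstoH1 h.isOpen h.convex (h.nonempty.mono h.half_subset) _ _ hw
  obtain ⟨a1, a2⟩ := h.ext_ae (LinearIsometryEquiv.refl ℝ ℝ) τ u
  obtain ⟨a3, a4⟩ := h.ext_ae (mirrorLin ν) τ G
  have t1 := tendsto_trace_of_tendstoH1 h.isOpen_half h.convex_half h.nonempty hp hq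
    (Lp.aestronglyMeasurable u) (Lp.aestronglyMeasurable G)
    ((hH.mono h.half_subset).congr a1 a3) ht
  have hH' := (h.tendstoH1_comp_mirror (Lp.aestronglyMeasurable _) (Lp.aestronglyMeasurable _)
    hH).mono h.half_subset
  have t2 := tendsto_trace_of_tendstoH1 h.isOpen_half h.convex_half h.nonempty hp hq
    ((Lp.aestronglyMeasurable u).const_smul τ) ((Lp.aestronglyMeasurable G).const_smul τ)
    (hH'.congr (u' := τ • (u : Plane → ℝ)) (G' := τ • (G : Plane → Plane)) (by
      filter_upwards [a2] with x hx
      simpa using hx) (by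
      filter_upwards [a4] with x hx
      rw [hx]
      simp)) (ht.smul τ)
  refine ⟨w, hH.1, hH.2.1, hH.2.2, ?_⟩
  have t3 := t1.add t2
  rw [add_zero] at t3
  refine tendsto_of_tendsto_of_tendsto_of_le_of_le tendsto_const_nhds t3 (fun _ ↦ zero_le)
    fun n ↦ ?_
  rw [sub_zero]
  refine (eLpNorm_mono_measure _ (Measure.restrict_mono hΓ le_rfl)).trans
    ((eLpNorm_restrict_union_le _ _ _).trans ?_)
  refine add_le_add_right (le_of_eq ?_) _
  rw [← eLpNorm_hausdorff_comp_mirror c ν _ (hH.1 n).continuous, ← Set.preimage_comp,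
    show mirror c ν ∘ mirror c ν = id from funext (mirror_mirror c ν), Set.preimage_id]

lemma fold_ae_eq (h : Folding Ω T c ν) (τ : ℝ) (u : L2 Ω) (G : L2Vec Ω) :
    ((u : Plane → ℝ) + τ • (u ∘ mirror c ν) =ᵐ[vol T] h.foldS τ u) ∧
      (G : Plane → Plane) + τ • (fun x ↦ mirrorLin ν (G (mirror c ν x))) =ᵐ[vol T]
        h.foldV τ G := by
  constructor
  · filter_upwards [h.fold_ae (LinearIsometryEquiv.refl ℝ ℝ) τ u] with x hx
    rw [hx]
    simp
  · filter_upwards [h.fold_ae (mirrorLin ν) τ G] with x hx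
    rw [hx]
    simp

lemma hasWeakGradient_fold (h : Folding Ω T c ν) (τ : ℝ) {u : L2 Ω} {G : L2Vec Ω}
    (hw : HasWeakGradient Ω u G) : HasWeakGradient T (h.foldS τ u) (h.foldV τ G) := by
  have mu := Lp.memLp u
  have mG := Lp.memLp G
  obtain ⟨e1, e2⟩ := h.fold_ae_eq τ u G
  exact ((hw.add ((h.hasWeakGradient_comp_mirror mu mG hw).smul τ) mu
    ((h.memLp_comp_mirror mu).const_smul τ) mG
    ((h.memLp_mirrorLin_comp_mirror mG).const_smul τ)).mono h.isOpen.measurableSet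
    h.half_subset).congr e1 e2

lemma hasTrace_fold (h : Folding Ω T c ν) (τ : ℝ) {u : L2 Ω} {G : L2Vec Ω} {Γ Γ₁ Γ₂ : Set Plane}
    (h1 : HasTrace Ω Γ₁ u G 0) (h2 : HasTrace Ω Γ₂ u G 0) (hΓ₁ : Γ ⊆ Γ₁)
    (hΓ₂ : Γ ⊆ mirror c ν ⁻¹' Γ₂) : HasTrace T Γ (h.foldS τ u) (h.foldV τ G) 0 := by
  have mu := Lp.memLp u
  have mG := Lp.memLp G
  obtain ⟨e1, e2⟩ := h.fold_ae_eq τ u G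
  exact (((h1.mono le_rfl hΓ₁).add (((h.hasTrace_comp_mirror mu.1 mG.1 h2).mono le_rfl hΓ₂).smul τ)
    mu ((h.memLp_comp_mirror mu).const_smul τ) mG
    ((h.memLp_mirrorLin_comp_mirror mG).const_smul τ)).mono h.half_subset le_rfl).congr e1 e2

/-- The odd part `w - w ∘ σ` of an approximant is identically zero on the mirror, so no boundary
condition on `u` is required. -/
lemma hasTrace_fold_of_height_eq_zero (h : Folding Ω T c ν) {u : L2 Ω} {G : L2Vec Ω}
    (hw : HasWeakGradient Ω u G) {Γ : Set Plane} (hΓm : MeasurableSet Γ)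
    (hΓ : ∀ x ∈ Γ, height c ν x = 0) : HasTrace T Γ (h.foldS (-1) u) (h.foldV (-1) G) 0 := by
  have mu := Lp.memLp u
  have mG := Lp.memLp G
  obtain ⟨e1, e2⟩ := h.fold_ae_eq (-1) u G
  obtain ⟨w, hH⟩ := exists_tendstoH1 h.isOpen h.convex (h.nonempty.mono h.half_subset) _ _ hw
  have hH' := h.tendstoH1_comp_mirror mu.1 mG.1 hH
  have l1 := tendsto_eLpNorm_add (fun n ↦ (hH.1 n).continuous.aestronglyMeasurable.sub mu.1)
    (fun n ↦ by
      rw [← smul_sub]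
      exact ((hH'.1 n).continuous.aestronglyMeasurable.sub (h.memLp_comp_mirror mu).1).const_smul _)
    hH.2.1 (tendsto_eLpNorm_smul (-1) hH'.2.1)
  have l2 := tendsto_eLpNorm_add
    (fun n ↦ (continuous_gradient (hH.1 n)).aestronglyMeasurable.sub mG.1)
    (fun n ↦ by
      rw [← smul_sub]
      exact ((continuous_gradient (hH'.1 n)).aestronglyMeasurable.sub
        (h.memLp_mirrorLin_comp_mirror mG).1).const_smul _)
    hH.2.2 (tendsto_eLpNorm_smul (-1) hH'.2.2)
  have hconv : TendstoH1 Ω (fun n ↦ w n - w n ∘ mirror c ν) _ _ :=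
    ⟨fun n ↦ (hH.1 n).sub (hH'.1 n), l1.congr fun n ↦ by rw [neg_one_smul, ← sub_eq_add_neg],
      l2.congr fun n ↦ by
        rw [gradient_sub_of_contDiff (hH.1 n) (hH'.1 n), neg_one_smul, ← sub_eq_add_neg]⟩
  have hfin := (hconv.mono h.half_subset).congr e1 e2
  refine ⟨_, hfin.1, hfin.2.1, hfin.2.2, tendsto_const_nhds.congr fun n ↦ ?_⟩
  rw [sub_zero, eq_comm, eLpNorm_congr_ae (g := 0), eLpNorm_zero]
  refine (ae_restrict_iff' hΓm).mpr (.of_forall fun x hx ↦ ?_)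
  simp [mirror_of_height_eq_zero (hΓ x hx)]

/-- Boundary conditions on `Ω` and on its half `T` correspond to each other for functions which are
even (`τ = 1`) or odd (`τ = -1`). -/
structure Compatible {ι κ : Type} (Ω T : Set Plane) (c ν : Plane) (τ : ℝ) (Γ : ι → Set Plane)
    (b : ι → BC) (Γ' : κ → Set Plane) (b' : κ → BC) : Prop where
  segment : ∀ k, ∃ p ∈ closure T, ∃ q ∈ closure T, Γ' k = segment ℝ p q
  ext_side : ∀ j, b j = BC.d → ∃ k, b' k = BC.d ∧ Γ j ⊆ Γ' k ∪ mirror c ν ⁻¹' Γ' k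
  fold_side : ∀ k, b' k = BC.d →
    (∃ j j', b j = BC.d ∧ b j' = BC.d ∧ Γ' k ⊆ Γ j ∧ Γ' k ⊆ mirror c ν ⁻¹' Γ j') ∨
      (τ = -1 ∧ ∀ x ∈ Γ' k, height c ν x = 0)
  mirror_side : τ = 1 ∨
    (τ = -1 ∧ ∃ k, b' k = BC.d ∧ ∀ x ∈ Ω, height c ν x = 0 → x ∈ Γ' k)

section Compatible

variable {ι κ : Type} {τ : ℝ} {Γ : ι → Set Plane} {b : ι → BC} {Γ' : κ → Set Plane} {b' : κ → BC}

lemma ext_mem_H1 (h : Folding Ω T c ν) (hc : Compatible Ω T c ν τ Γ b Γ' b') {u : L2 T}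
    {G : L2Vec T} (hu : (u, G) ∈ H1 T Γ' b') : (h.extS τ u, h.extV τ G) ∈ H1 Ω Γ b := by
  obtain ⟨h1, h2⟩ := hu
  have hw : HasWeakGradient Ω (h.extS τ u) (h.extV τ G) := h.hasWeakGradient_ext h1 (by
    rcases hc.mirror_side with h3 | ⟨-, k, hk, hk'⟩
    · exact Or.inl h3
    · exact Or.inr ⟨_, hk', h2 k hk⟩)
  refine ⟨hw, fun j hj ↦ ?_⟩
  obtain ⟨k, hk, hjk⟩ := hc.ext_side j hj
  obtain ⟨p, hp, q, hq, hpq⟩ := hc.segment k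
  have := h2 k hk
  rw [hpq] at this hjk
  exact h.hasTrace_ext hw hp hq this hjk

lemma fold_mem_H1 (h : Folding Ω T c ν) (hc : Compatible Ω T c ν τ Γ b Γ' b') {u : L2 Ω}
    {G : L2Vec Ω} (hu : (u, G) ∈ H1 Ω Γ b) : (h.foldS τ u, h.foldV τ G) ∈ H1 T Γ' b' := by
  obtain ⟨h1, h2⟩ := hu
  refine ⟨h.hasWeakGradient_fold τ h1, fun k hk ↦ ?_⟩
  rcases hc.fold_side k hk with ⟨j, j', hj, hj', h3, h4⟩ | ⟨rfl, h3⟩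
  · exact h.hasTrace_fold τ (h2 j hj) (h2 j' hj') h3 h4
  · obtain ⟨p, hp, q, hq, hpq⟩ := hc.segment k
    refine h.hasTrace_fold_of_height_eq_zero h1 ?_ h3
    rw [hpq]
    have : IsCompact (_root_.segment ℝ p q) := by
      rw [segment_eq_image']
      exact isCompact_Icc.image (by fun_prop)
    exact this.measurableSet

/-- By adjunction, testing the extension against `v` amounts to testing `u` against the folding of
`v`, which is admissible on `T`. -/
lemma ext_mem_eigenspace (h : Folding Ω T c ν) (hc : Compatible Ω T c ν τ Γ b Γ' b') {μ : ℝ}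
    {u : L2 T} (hu : u ∈ eigenspace T Γ' b' μ) : h.extS τ u ∈ eigenspace Ω Γ b μ := by
  obtain ⟨G, hG, hev⟩ := hu
  refine ⟨h.extV τ G, h.ext_mem_H1 hc hG, fun v H hv ↦ ?_⟩
  rw [extV, extS, h.inner_ext _ _ (mirrorLin_mirrorLin ν), h.inner_ext _ _ fun _ ↦ rfl]
  exact hev _ _ (h.fold_mem_H1 hc hv)

/-- The same adjunction in the other direction: test functions on `T` are extended to test functions
on `Ω`. -/
lemma fold_mem_eigenspace (h : Folding Ω T c ν) (hc : Compatible Ω T c ν τ Γ b Γ' b') {μ : ℝ}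
    {u : L2 Ω} (hu : u ∈ eigenspace Ω Γ b μ) : h.foldS τ u ∈ eigenspace T Γ' b' μ := by
  obtain ⟨G, hG, hev⟩ := hu
  refine ⟨h.foldV τ G, h.fold_mem_H1 hc hG, fun v H hv ↦ ?_⟩
  have := hev _ _ (h.ext_mem_H1 hc hv)
  rwa [real_inner_comm, real_inner_comm _ u, extV, extS, h.inner_ext _ _ (mirrorLin_mirrorLin ν),
    h.inner_ext _ _ fun _ ↦ rfl, real_inner_comm, real_inner_comm _ v] at this

end Compatible

lemma restrict_ae (h : Folding Ω T c ν) (u : L2 Ω) :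
    (restrictL2 h.half_subset u : Plane → ℝ) =ᵐ[vol T] u :=
  MemLp.coeFn_toLp _

lemma restrict_ext (h : Folding Ω T c ν) (τ : ℝ) (u : L2 T) :
    restrictL2 h.half_subset (h.extS τ u) = u :=
  Lp.ext ((h.restrict_ae _).trans (h.ext_ae _ τ u).1)

/-- The functions which are even (`τ = 1`) or odd (`τ = -1`) with respect to the reflection. -/
def symmetric (Ω : Set Plane) (c ν : Plane) (τ : ℝ) : Set (L2 Ω) :=
  {u | ∀ᵐ x ∂vol Ω, u (mirror c ν x) = τ * u x}

lemma mem_symmetric_iff (h : Folding Ω T c ν) {τ : ℝ} (hτ : τ * τ = 1) {u : L2 Ω} :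
    u ∈ symmetric Ω c ν τ ↔ ∀ᵐ x ∂vol T, u (mirror c ν x) = τ * u x := by
  refine h.ae_iff.trans ⟨fun hu ↦ hu.1, fun hu ↦ ⟨hu, ?_⟩⟩
  filter_upwards [hu] with x hx
  rw [mirror_mirror, hx, ← mul_assoc, hτ, one_mul]

lemma ext_mem_symmetric (h : Folding Ω T c ν) {τ : ℝ} (hτ : τ * τ = 1) (u : L2 T) :
    h.extS τ u ∈ symmetric Ω c ν τ := by
  rw [h.mem_symmetric_iff hτ]
  obtain ⟨a1, a2⟩ := h.ext_ae (LinearIsometryEquiv.refl ℝ ℝ) τ u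
  filter_upwards [a1, a2] with x b1 b2
  rw [b2, b1]
  rfl

lemma fold_of_mem_symmetric (h : Folding Ω T c ν) {τ : ℝ} (hτ : τ * τ = 1) {u : L2 Ω}
    (hu : u ∈ symmetric Ω c ν τ) : h.foldS τ u = (2 : ℝ) • restrictL2 h.half_subset u := by
  refine Lp.ext ?_
  filter_upwards [(h.mem_symmetric_iff hτ).mp hu,
    h.fold_ae (LinearIsometryEquiv.refl ℝ ℝ) τ u, h.restrict_ae u,
    Lp.coeFn_smul (2 : ℝ) (restrictL2 h.half_subset u)] with x b1 b2 b3 b4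
  rw [b2, b4, Pi.smul_apply, b3, LinearIsometryEquiv.coe_refl, id, b1, smul_eq_mul, smul_eq_mul,
    ← mul_assoc, hτ]
  ring

lemma ext_restrict (h : Folding Ω T c ν) {τ : ℝ} (hτ : τ * τ = 1) {u : L2 Ω}
    (hu : u ∈ symmetric Ω c ν τ) : h.extS τ (restrictL2 h.half_subset u) = u := by
  obtain ⟨a1, a2⟩ := h.ext_ae (LinearIsometryEquiv.refl ℝ ℝ) τ (restrictL2 h.half_subset u)
  refine h.ext_unique ?_ ?_
  · filter_upwards [a1, h.restrict_ae u] with x b1 b2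
    rw [b1, b2]
  · filter_upwards [a2, h.restrict_ae u, (h.mem_symmetric_iff hτ).mp hu] with x b1 b2 b3
    rw [b1, b3, b2]
    rfl

section Compatible

variable {ι κ : Type} {τ : ℝ} {Γ : ι → Set Plane} {b : ι → BC} {Γ' : κ → Set Plane} {b' : κ → BC}

lemma Compatible.mul_self (hc : Compatible Ω T c ν τ Γ b Γ' b') : τ * τ = 1 := by
  rcases hc.mirror_side with rfl | ⟨rfl, -⟩ <;> norm_num

/-- The reflection principle. -/
lemma bijOn_restrict (h : Folding Ω T c ν) (hc : Compatible Ω T c ν τ Γ b Γ' b') (μ : ℝ) :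
    Set.BijOn (restrictL2 h.half_subset)
      ((eigenspace Ω Γ b μ : Set (L2 Ω)) ∩ symmetric Ω c ν τ) (eigenspace T Γ' b' μ) := by
  refine ⟨fun u hu ↦ ?_, fun u hu v hv huv ↦ ?_, fun v hv ↦ ?_⟩
  -- The restriction of a symmetric eigenfunction solves the equation on `T` because it is half of
  -- its folding.
  · have := h.fold_mem_eigenspace hc hu.1
    rw [h.fold_of_mem_symmetric hc.mul_self hu.2] at this
    exact (Submodule.smul_mem_iff _ two_ne_zero).mp this
  · rw [← h.ext_restrict hc.mul_self hu.2, ← h.ext_restrict hc.mul_self hv.2, huv]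
  · exact ⟨h.extS τ v, ⟨h.ext_mem_eigenspace hc hv, h.ext_mem_symmetric hc.mul_self v⟩,
      h.restrict_ext τ v⟩

end Compatible

/-- The sum and difference of the two foldings are `2 u` and `2 u ∘ σ` on `T`. -/
lemma eq_zero_of_fold_eq_zero (h : Folding Ω T c ν) {u : L2 Ω} (h1 : h.foldS 1 u = 0)
    (h2 : h.foldS (-1) u = 0) : u = 0 := by
  have a1 := h.fold_ae (LinearIsometryEquiv.refl ℝ ℝ) 1 u
  have a2 := h.fold_ae (LinearIsometryEquiv.refl ℝ ℝ) (-1) u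
  obtain ⟨z1, z2⟩ := h.ae_iff.mp (Lp.coeFn_zero ℝ 2 (vol Ω))
  have z := Lp.coeFn_zero ℝ 2 (vol T)
  rw [foldS] at h1 h2
  rw [h1] at a1
  rw [h2] at a2
  refine h.ext_unique ?_ ?_
  · filter_upwards [a1, a2, z1, z] with x b1 b2 b3 b4
    rw [b4] at b1 b2
    rw [b3]
    simp at b1 b2 ⊢
    linarith
  · filter_upwards [a1, a2, z2, z] with x b1 b2 b3 b4
    rw [b4] at b1 b2
    rw [b3]
    simp at b1 b2 ⊢
    linarith

/-- The pair of even and odd foldings is a linear isomorphism onto the product, with inverse half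
the sum of the two extensions. No finite dimensionality enters, since ranks are cardinals. -/
lemma rank_eigenspace_eq (h : Folding Ω T c ν) {ι κ : Type} {Γ : ι → Set Plane} {b : ι → BC}
    {Γ' : κ → Set Plane} {b₁ b₂ : κ → BC} (hc₁ : Compatible Ω T c ν 1 Γ b Γ' b₁)
    (hc₂ : Compatible Ω T c ν (-1) Γ b Γ' b₂) (μ : ℝ) :
    Module.rank ℝ (eigenspace Ω Γ b μ) =
      Module.rank ℝ (eigenspace T Γ' b₁ μ) + Module.rank ℝ (eigenspace T Γ' b₂ μ) := by
  let f₁ : eigenspace Ω Γ b μ →ₗ[ℝ] eigenspace T Γ' b₁ μ :=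
    (h.foldS 1).restrict fun u hu ↦ h.fold_mem_eigenspace hc₁ hu
  let f₂ : eigenspace Ω Γ b μ →ₗ[ℝ] eigenspace T Γ' b₂ μ :=
    (h.foldS (-1)).restrict fun u hu ↦ h.fold_mem_eigenspace hc₂ hu
  have hinj : Function.Injective (f₁.prod f₂) := by
    rw [← LinearMap.ker_eq_bot, LinearMap.ker_eq_bot']
    intro u hu
    have h1 := congrArg (fun z ↦ (z.1 : L2 T)) hu
    have h2 := congrArg (fun z ↦ (z.2 : L2 T)) hu
    exact Subtype.ext (h.eq_zero_of_fold_eq_zero h1 h2)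
  have hsurj : Function.Surjective (f₁.prod f₂) := by
    rintro ⟨⟨v₁, hv₁⟩, ⟨v₂, hv₂⟩⟩
    refine ⟨(1 / 2 : ℝ) • (⟨_, h.ext_mem_eigenspace hc₁ hv₁⟩ + ⟨_, h.ext_mem_eigenspace hc₂ hv₂⟩),
      Prod.ext (Subtype.ext ?_) (Subtype.ext ?_)⟩
    · change h.foldS 1 ((1 / 2 : ℝ) • (h.extS 1 v₁ + h.extS (-1) v₂)) = v₁
      rw [map_smul, map_add, foldS, extS, extS, h.fold_ext _ _ fun _ ↦ rfl,
        h.fold_ext _ _ fun _ ↦ rfl]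
      module
    · change h.foldS (-1) ((1 / 2 : ℝ) • (h.extS 1 v₁ + h.extS (-1) v₂)) = v₂
      rw [map_smul, map_add, foldS, extS, extS, h.fold_ext _ _ fun _ ↦ rfl,
        h.fold_ext _ _ fun _ ↦ rfl]
      module
  rw [← rank_prod', (LinearEquiv.ofBijective _ ⟨hinj, hsurj⟩).rank_eq]

end Folding

/-! ### Geometry of the rhombus -/

lemma mem_convexHull_range_iff {k : ℕ} {v : Fin k → Plane} {x : Plane} :
    x ∈ convexHull ℝ (Set.range v) ↔
      ∃ w : Fin k → ℝ, (∀ i, 0 ≤ w i) ∧ ∑ i, w i = 1 ∧ ∑ i, w i • v i = x := by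
  constructor
  · intro hx
    refine convexHull_min (t := {x | ∃ w : Fin k → ℝ, (∀ i, 0 ≤ w i) ∧ ∑ i, w i = 1 ∧
      ∑ i, w i • v i = x}) ?_ ?_ hx
    · rintro _ ⟨i, rfl⟩
      refine ⟨Pi.single i 1, fun j ↦ ?_, by simp, by simp [Pi.single_apply]⟩
      by_cases h : j = i <;> simp [h]
    · rintro _ ⟨w, h0, h1, rfl⟩ _ ⟨w', h0', h1', rfl⟩ a b ha hb hab
      refine ⟨fun i ↦ a * w i + b * w' i, fun i ↦ ?_, ?_, ?_⟩
      · have := h0 i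
        have := h0' i
        positivity
      · rw [Finset.sum_add_distrib, ← Finset.mul_sum, ← Finset.mul_sum, h1, h1', mul_one, mul_one,
          hab]
      · simp only [add_smul, mul_smul, Finset.sum_add_distrib, Finset.smul_sum]
  · rintro ⟨w, h0, h1, rfl⟩
    exact (convex_convexHull ℝ _).sum_mem (fun i _ ↦ h0 i) h1
      fun i _ ↦ subset_convexHull ℝ _ ⟨i, rfl⟩

/-- The unit vector in the direction of the diagonal `D`. -/
noncomputable def unitD : Plane := !₂[√3 / 2, 1 / 2]

/-- The unit vector in the direction of the diagonal `M`. -/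
noncomputable def unitM : Plane := !₂[1 / 2, -(√3 / 2)]

/-- The point with coordinates `X`, `Y` with respect to the half diagonals. -/
noncomputable def pt (X Y : ℝ) : Plane := centre + (X • !₂[3 / 4, √3 / 4] + Y • !₂[1 / 4, -(√3 / 4)])

/-- The position of `dEnd i` on the diagonal `D`. -/
def signD : Fin 2 → ℝ := ![-1, 1]

/-- The position of `mEnd j` on the diagonal `M`. -/
def signM : Fin 2 → ℝ := ![1, -1]

lemma signD_eq (i : Fin 2) : signD i = 1 ∨ signD i = -1 := by
  fin_cases i <;> simp [signD]

lemma signM_eq (j : Fin 2) : signM j = 1 ∨ signM j = -1 := by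
  fin_cases j <;> simp [signM]

lemma sqrt_three_sq : √3 * √3 = 3 := Real.mul_self_sqrt (by norm_num)

lemma dEnd_eq (i : Fin 2) : dEnd i = pt (signD i) 0 := by
  ext l
  fin_cases i <;> fin_cases l <;> simp [dEnd, pt, signD, centre] <;> ring

lemma mEnd_eq (j : Fin 2) : mEnd j = pt 0 (signM j) := by
  ext l
  fin_cases j <;> fin_cases l <;> simp [mEnd, pt, signM, centre] <;> ring

lemma centre_eq : centre = pt 0 0 := by simp [pt]

lemma exists_eq_pt (x : Plane) : ∃ X Y, x = pt X Y := by
  -- Solution of the system `x 0 - 3/4 = (3X + Y)/4`, `(x 1 - √3/4)/√3 = (X - Y)/4`.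
  refine ⟨(x 0 - 3 / 4) + (x 1 - √3 / 4) / √3, (x 0 - 3 / 4) - 3 * ((x 1 - √3 / 4) / √3), ?_⟩
  have h3 : √3 ≠ 0 := by positivity
  ext l
  fin_cases l
  · simp [pt, centre]
    ring
  · simp [pt, centre]
    field_simp
    ring

/-- The half diagonals are orthogonal, of lengths `√3/2` and `1/2`, so distances to `M` and `D` are
the coordinates `|X|` and `|Y|` up to these factors. Note the exchange: `unitD` is the normal of
`M`, and `unitM` that of `D`. -/
lemma height_unitD (s X Y : ℝ) : height centre (s • unitD) (pt X Y) = s * (√3 / 2) * X := by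
  simp [height, unitD, pt, PiLp.inner_apply, Fin.sum_univ_two]
  ring

lemma height_unitM (s X Y : ℝ) : height centre (s • unitM) (pt X Y) = s * (1 / 2) * Y := by
  simp [height, unitM, pt, PiLp.inner_apply, Fin.sum_univ_two]
  linear_combination (s * (Y - X) / 8) * sqrt_three_sq

lemma norm_unitD {s : ℝ} (hs : s = 1 ∨ s = -1) : ‖s • unitD‖ = 1 := by
  have : ‖unitD‖ = 1 := by
    rw [EuclideanSpace.norm_eq, Real.sqrt_eq_one]
    simp [unitD, Fin.sum_univ_two]
    linear_combination (1 / 4) * sqrt_three_sq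
  rcases hs with rfl | rfl <;> simp [this]

lemma norm_unitM {s : ℝ} (hs : s = 1 ∨ s = -1) : ‖s • unitM‖ = 1 := by
  have : ‖unitM‖ = 1 := by
    rw [EuclideanSpace.norm_eq, Real.sqrt_eq_one]
    simp [unitM, Fin.sum_univ_two]
    linear_combination (1 / 4) * sqrt_three_sq
  rcases hs with rfl | rfl <;> simp [this]

lemma pt_injective {X Y X' Y' : ℝ} (h : pt X Y = pt X' Y') : X = X' ∧ Y = Y' := by
  have h1 := height_unitD 1 X Y
  have h2 := height_unitM 1 X Y
  rw [h, height_unitD] at h1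
  rw [h, height_unitM] at h2
  have h3 : √3 ≠ 0 := by positivity
  constructor
  · field_simp at h1
    linarith
  · linarith

lemma mirror_unitD {s : ℝ} (hs : s = 1 ∨ s = -1) (X Y : ℝ) :
    mirror centre (s • unitD) (pt X Y) = pt (-X) Y := by
  have e1 : pt X Y - centre = (s * (√3 / 2) * X) • (s • unitD) + (pt 0 Y - centre) := by
    ext l
    fin_cases l <;> rcases hs with rfl | rfl <;> simp [pt, unitD] <;>
      first | ring1 | linear_combination (-X / 4) * sqrt_three_sq
  have e2 : pt (-X) Y - centre = -((s * (√3 / 2) * X) • (s • unitD)) + (pt 0 Y - centre) := by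
    ext l
    fin_cases l <;> rcases hs with rfl | rfl <;> simp [pt, unitD] <;>
      first | ring1 | linear_combination (-X / 4) * sqrt_three_sq
  have h0 : inner ℝ (s • unitD) (pt 0 Y - centre) = 0 := by
    have := height_unitD s 0 Y
    rwa [mul_zero] at this
  rw [mirror, e1, map_add, map_smul, mirrorLin_normal, mirrorLin_of_inner_eq_zero h0, smul_neg,
    ← e2, sub_add_cancel]

lemma mirror_unitM {s : ℝ} (hs : s = 1 ∨ s = -1) (X Y : ℝ) :
    mirror centre (s • unitM) (pt X Y) = pt X (-Y) := by
  have e1 : pt X Y - centre = (s * (1 / 2) * Y) • (s • unitM) + (pt X 0 - centre) := by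
    ext l
    fin_cases l <;> rcases hs with rfl | rfl <;> simp [pt, unitM] <;> ring
  have e2 : pt X (-Y) - centre = -((s * (1 / 2) * Y) • (s • unitM)) + (pt X 0 - centre) := by
    ext l
    fin_cases l <;> rcases hs with rfl | rfl <;> simp [pt, unitM] <;> ring
  have h0 : inner ℝ (s • unitM) (pt X 0 - centre) = 0 := by
    have := height_unitM s X 0
    rwa [mul_zero] at this
  rw [mirror, e1, map_add, map_smul, mirrorLin_normal, mirrorLin_of_inner_eq_zero h0, smul_neg,
    ← e2, sub_add_cancel]

lemma sum_smul_pt {k : ℕ} (w X Y : Fin k → ℝ) (hw : ∑ i, w i = 1) :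
    ∑ i, w i • pt (X i) (Y i) = pt (∑ i, w i * X i) (∑ i, w i * Y i) := by
  simp only [pt, smul_add, Finset.sum_add_distrib, ← Finset.sum_smul, hw, one_smul, smul_smul]

lemma pt_mem_convexHull_iff {k : ℕ} {v : Fin k → Plane} (A B : Fin k → ℝ)
    (hv : ∀ i, v i = pt (A i) (B i)) (X Y : ℝ) :
    pt X Y ∈ convexHull ℝ (Set.range v) ↔
      ∃ w : Fin k → ℝ, (∀ i, 0 ≤ w i) ∧ ∑ i, w i = 1 ∧ ∑ i, w i * A i = X ∧ ∑ i, w i * B i = Y := by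
  rw [mem_convexHull_range_iff]
  refine exists_congr fun w ↦ and_congr_right fun _ ↦ and_congr_right fun hw ↦ ?_
  simp only [hv]
  rw [sum_smul_pt w A B hw]
  exact ⟨pt_injective, fun h ↦ by rw [h.1, h.2]⟩

/-- In half-diagonal coordinates the closed rhombus is the unit ball of the `ℓ¹` norm. -/
lemma pt_mem_rhombus_hull (X Y : ℝ) :
    pt X Y ∈ convexHull ℝ (Set.range rhombusV) ↔ |X| + |Y| ≤ 1 := by
  rw [pt_mem_convexHull_iff ![-1, 0, 1, 0] ![0, 1, 0, -1] (fun i ↦ by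
    fin_cases i
    exacts [dEnd_eq 0, mEnd_eq 0, dEnd_eq 1, mEnd_eq 1])]
  simp only [Fin.sum_univ_four, Fin.forall_fin_succ]
  constructor
  · rintro ⟨w, hw, h1, rfl, rfl⟩
    simp at hw h1 ⊢
    obtain ⟨h2, h3, h4, h5⟩ := hw
    rcases abs_cases (-w 0 + w 2) with h | h <;> rcases abs_cases (w 1 + -w 3) with h' | h' <;>
      linarith
  · intro h
    -- Each vertex receives the negative or positive part of its coordinate, and the slack `1 - |X|
    -- - |Y|` is shared equally among the four.
    refine ⟨![(|X| - X) / 2 + (1 - |X| - |Y|) / 4, (|Y| + Y) / 2 + (1 - |X| - |Y|) / 4,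
      (|X| + X) / 2 + (1 - |X| - |Y|) / 4, (|Y| - Y) / 2 + (1 - |X| - |Y|) / 4], ?_⟩
    have := le_abs_self X
    have := neg_abs_le X
    have := le_abs_self Y
    have := neg_abs_le Y
    simp
    refine ⟨⟨?_, ?_, ?_, ?_⟩, ?_, ?_, ?_⟩ <;> linarith

lemma pt_mem_equi_hull (i : Fin 2) (X Y : ℝ) :
    pt X Y ∈ convexHull ℝ (Set.range (equiV i)) ↔ |X| + |Y| ≤ 1 ∧ 0 ≤ signD i * X := by
  rw [pt_mem_convexHull_iff ![0, signD i, 0] ![1, 0, -1] (fun l ↦ by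
    fin_cases l
    exacts [mEnd_eq 0, dEnd_eq i, mEnd_eq 1])]
  simp only [Fin.sum_univ_three, Fin.forall_fin_succ]
  constructor
  · rintro ⟨w, hw, h1, rfl, rfl⟩
    simp at hw h1 ⊢
    obtain ⟨h2, h3, h4⟩ := hw
    rcases signD_eq i with hs | hs <;> rcases abs_cases (w 0 + -w 2) with h' | h' <;> rw [hs] <;>
      simp [abs_of_nonneg h3, h3] <;> linarith
  · rintro ⟨h, h'⟩
    -- The weight of `dEnd i` is forced to be `|X|`; the other two have sum `1 - |X|` and difference
    -- `Y`.
    refine ⟨![(1 - signD i * X + Y) / 2, signD i * X, (1 - signD i * X - Y) / 2], ?_⟩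
    have := le_abs_self Y
    have := neg_abs_le Y
    rcases signD_eq i with hs | hs <;> rw [hs] at h' ⊢
    · rw [abs_of_nonneg (by linarith)] at h
      simp
      refine ⟨⟨?_, ?_, ?_⟩, ?_, ?_⟩ <;> linarith
    · rw [abs_of_nonpos (by linarith)] at h
      simp
      refine ⟨⟨?_, ?_, ?_⟩, ?_, ?_⟩ <;> linarith

lemma pt_mem_hemi_hull (i j : Fin 2) (X Y : ℝ) :
    pt X Y ∈ convexHull ℝ (Set.range (hemiV i j)) ↔
      (|X| + |Y| ≤ 1 ∧ 0 ≤ signD i * X) ∧ 0 ≤ signM j * Y := by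
  rw [pt_mem_convexHull_iff ![0, signD i, 0] ![signM j, 0, 0] (fun l ↦ by
    fin_cases l
    exacts [mEnd_eq j, dEnd_eq i, centre_eq])]
  simp only [Fin.sum_univ_three, Fin.forall_fin_succ]
  constructor
  · rintro ⟨w, hw, h1, rfl, rfl⟩
    simp at hw h1 ⊢
    obtain ⟨h2, h3, h4⟩ := hw
    rcases signD_eq i with hs | hs <;> rcases signM_eq j with ht | ht <;> rw [hs, ht] <;>
      simp [abs_of_nonneg h2, abs_of_nonneg h3, h2, h3] <;> linarith
  · rintro ⟨⟨h, h'⟩, h''⟩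
    refine ⟨![signM j * Y, signD i * X, 1 - signD i * X - signM j * Y], ?_⟩
    have := le_abs_self X
    have := neg_abs_le X
    have := le_abs_self Y
    have := neg_abs_le Y
    rcases signD_eq i with hs | hs <;> rcases signM_eq j with ht | ht <;> rw [hs] at h' ⊢ <;>
      rw [ht] at h'' ⊢ <;> simp <;> refine ⟨⟨?_, ?_, ?_⟩, ?_⟩ <;> linarith

/-- A nonzero affine function is an open map, so taking the interior commutes with the preimage. -/
lemma interior_height_nonneg {c ν : Plane} (hν : ‖ν‖ = 1) :
    interior {x | 0 ≤ height c ν x} = {x | 0 < height c ν x} := by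
  have hne : innerSL ℝ ν ≠ 0 := fun h ↦ by
    have : innerSL ℝ ν ν = 0 := by rw [h]; rfl
    rw [innerSL_apply_apply, real_inner_self_eq_norm_sq, hν] at this
    norm_num at this
  have ho : IsOpenMap (height c ν) :=
    (ContinuousLinearMap.isOpenMap_of_ne_zero _ hne).comp (Homeomorph.subRight c).isOpenMap
  have := ho.preimage_interior_eq_interior_preimage (continuous_height c ν) (Set.Ici 0)
  rw [interior_Ici] at this
  exact this.symm

lemma mirror_mem_interior {c ν : Plane} {S : Set Plane} (h : ∀ x ∈ S, mirror c ν x ∈ S)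
    {x : Plane} (hx : x ∈ interior S) : mirror c ν x ∈ interior S := by
  have e : mirror c ν ⁻¹' S = S :=
    Set.ext fun y ↦ ⟨fun hy ↦ by simpa using h _ hy, h y⟩
  have := (mirrorHomeo c ν).preimage_interior S
  change mirror c ν ⁻¹' interior S = interior (mirror c ν ⁻¹' S) at this
  rw [e] at this
  rw [← this] at hx
  exact hx

lemma isBounded_polygon {k : ℕ} [NeZero k] (v : Fin k → Plane) :
    Bornology.IsBounded (polygon v) :=
  (((Set.finite_range v).isCompact_convexHull ℝ).isBounded).subset interior_subset

/-- Everything is checked on closed hulls, where membership is a system of inequalities, and then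
passed to interiors. -/
lemma folding_of_hull {k l : ℕ} [NeZero k] [NeZero l] {v : Fin k → Plane} {v' : Fin l → Plane}
    {c ν : Plane} (hν : ‖ν‖ = 1)
    (hm : ∀ x ∈ convexHull ℝ (Set.range v), mirror c ν x ∈ convexHull ℝ (Set.range v))
    (hh : ∀ x, x ∈ convexHull ℝ (Set.range v') ↔
      x ∈ convexHull ℝ (Set.range v) ∧ 0 ≤ height c ν x)
    (hne : (polygon v').Nonempty) : Folding (polygon v) (polygon v') c ν where
  norm_normal := hν
  isOpen := isOpen_interior
  convex := (convex_convexHull ℝ _).interior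
  isBounded := isBounded_polygon v
  mirror_mem _ hx := mirror_mem_interior hm hx
  half_eq := by
    have : convexHull ℝ (Set.range v') = convexHull ℝ (Set.range v) ∩ {x | 0 ≤ height c ν x} :=
      Set.ext hh
    rw [polygon, this, interior_inter, interior_height_nonneg hν]
    rfl
  nonempty := hne

lemma hemi_nonempty (i j : Fin 2) : (polygon (hemiV i j)).Nonempty := by
  -- The factors `2 / √3` and `2` undo the scaling of the heights, so that `U` is the open triangle
  -- given by strict inequalities in `|X|` and `|Y|`.
  set U : Set Plane := {x | 0 < height centre (signD i • unitD) x} ∩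
    ({x | 0 < height centre (signM j • unitM) x} ∩
    {x | height centre (signD i • unitD) x * (2 / √3) + height centre (signM j • unitM) x * 2 < 1})
    with hU
  have ho : IsOpen U := by
    have c1 := continuous_height centre (signD i • unitD)
    have c2 := continuous_height centre (signM j • unitM)
    exact (isOpen_lt continuous_const c1).inter ((isOpen_lt continuous_const c2).inter
      (isOpen_lt ((c1.mul continuous_const).add (c2.mul continuous_const)) continuous_const))
  have h3 : 0 < √3 := by positivity
  have hmem : ∀ X Y, pt X Y ∈ U ↔
      0 < signD i * X ∧ 0 < signM j * Y ∧ signD i * X + signM j * Y < 1 := fun X Y ↦ by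
    have e1 : signD i * (√3 / 2) * X = (√3 / 2) * (signD i * X) := by ring
    have e2 : signM j * (1 / 2) * Y = (1 / 2) * (signM j * Y) := by ring
    have e3 : √3 / 2 * (signD i * X) * (2 / √3) + 1 / 2 * (signM j * Y) * 2 =
        signD i * X + signM j * Y := by
      field_simp
    simp only [hU, Set.mem_inter_iff, Set.mem_ofPred_eq, height_unitD, height_unitM, e1, e2, e3]
    rw [mul_pos_iff_of_pos_left (show 0 < √3 / 2 by positivity),
      mul_pos_iff_of_pos_left (show (0 : ℝ) < 1 / 2 by norm_num)]
  have hsub : U ⊆ convexHull ℝ (Set.range (hemiV i j)) := fun x hx ↦ by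
    obtain ⟨X, Y, rfl⟩ := exists_eq_pt x
    obtain ⟨h1, h2, h4⟩ := (hmem X Y).mp hx
    rw [pt_mem_hemi_hull]
    refine ⟨⟨?_, h1.le⟩, h2.le⟩
    have e1 : |X| = signD i * X := by
      rcases signD_eq i with hs | hs <;> rw [hs] at h1 ⊢
      · rw [abs_of_pos (by linarith)]; ring
      · rw [abs_of_neg (by linarith)]; ring
    have e2 : |Y| = signM j * Y := by
      rcases signM_eq j with hs | hs <;> rw [hs] at h2 ⊢
      · rw [abs_of_pos (by linarith)]; ring
      · rw [abs_of_neg (by linarith)]; ring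
    rw [e1, e2]
    exact h4.le
  refine ⟨pt (signD i / 4) (signM j / 4), interior_maximal hsub ho ((hmem _ _).mpr ?_)⟩
  rcases signD_eq i with hs | hs <;> rcases signM_eq j with ht | ht <;> rw [hs, ht] <;> norm_num

lemma hemi_subset_equi (i j : Fin 2) : polygon (hemiV i j) ⊆ polygon (equiV i) := by
  refine interior_mono fun x hx ↦ ?_
  obtain ⟨X, Y, rfl⟩ := exists_eq_pt x
  rw [pt_mem_hemi_hull] at hx
  exact (pt_mem_equi_hull i X Y).mpr hx.1

lemma foldingM (i : Fin 2) : Folding rhombus (polygon (equiV i)) centre (signD i • unitD) := by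
  refine folding_of_hull (norm_unitD (signD_eq i)) (fun x hx ↦ ?_) (fun x ↦ ?_)
    ((hemi_nonempty i 0).mono (hemi_subset_equi i 0))
  · obtain ⟨X, Y, rfl⟩ := exists_eq_pt x
    rw [mirror_unitD (signD_eq i), pt_mem_rhombus_hull, abs_neg]
    exact (pt_mem_rhombus_hull X Y).mp hx
  · obtain ⟨X, Y, rfl⟩ := exists_eq_pt x
    rw [pt_mem_equi_hull, pt_mem_rhombus_hull, height_unitD, mul_right_comm,
      mul_nonneg_iff_of_pos_right (show 0 < √3 / 2 by positivity)]

/-- The second mirror folds the equilateral triangle rather than the rhombus; the sign orients the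
normal towards the chosen half. -/
lemma foldingD (i j : Fin 2) :
    Folding (polygon (equiV i)) (polygon (hemiV i j)) centre (signM j • unitM) := by
  refine folding_of_hull (norm_unitM (signM_eq j)) (fun x hx ↦ ?_) (fun x ↦ ?_)
    (hemi_nonempty i j)
  · obtain ⟨X, Y, rfl⟩ := exists_eq_pt x
    rw [mirror_unitM (signM_eq j), pt_mem_equi_hull, abs_neg]
    exact (pt_mem_equi_hull i X Y).mp hx
  · obtain ⟨X, Y, rfl⟩ := exists_eq_pt x
    rw [pt_mem_hemi_hull, pt_mem_equi_hull, height_unitM, mul_right_comm (signM j),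
      mul_nonneg_iff_of_pos_right (show (0 : ℝ) < 1 / 2 by norm_num)]

lemma vertex_mem_closure {k : ℕ} [NeZero k] {v : Fin k → Plane} (h : (polygon v).Nonempty)
    (i : Fin k) : v i ∈ closure (polygon v) := by
  rw [polygon, (convex_convexHull ℝ _).closure_interior_eq_closure_of_nonempty_interior h]
  exact subset_closure (subset_convexHull ℝ _ ⟨i, rfl⟩)

lemma mirror_preimage_segment (c ν p q : Plane) :
    mirror c ν ⁻¹' segment ℝ p q = segment ℝ (mirror c ν p) (mirror c ν q) := by
  rw [← image_mirror_eq_preimage]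
  have e : mirror c ν = (((mirrorLin ν).toLinearEquiv : Plane →ₗ[ℝ] Plane).toAffineMap +
      AffineMap.const ℝ Plane (c - mirrorLin ν c) : Plane →ᵃ[ℝ] Plane) := by
    ext1 x
    simp [mirror]
    abel
  rw [e]
  exact image_segment ℝ _ p q

lemma mirror_dEnd (i i' : Fin 2) : mirror centre (signD i • unitD) (dEnd i') = dEnd (1 - i') := by
  rw [dEnd_eq, mirror_unitD (signD_eq i), dEnd_eq]
  congr 1
  fin_cases i' <;> simp [signD]

lemma mirror_mEnd (i j : Fin 2) : mirror centre (signD i • unitD) (mEnd j) = mEnd j := by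
  rw [mEnd_eq, mirror_unitD (signD_eq i), neg_zero]

lemma mirror_dEnd' (j i : Fin 2) : mirror centre (signM j • unitM) (dEnd i) = dEnd i := by
  rw [dEnd_eq, mirror_unitM (signM_eq j), neg_zero]

lemma mirror_mEnd' (j j' : Fin 2) : mirror centre (signM j • unitM) (mEnd j') = mEnd (1 - j') := by
  rw [mEnd_eq, mirror_unitM (signM_eq j), mEnd_eq]
  congr 1
  fin_cases j' <;> simp [signM]

lemma mirror_centre' (j : Fin 2) : mirror centre (signM j • unitM) centre = centre := by
  simp [mirror]

lemma height_M (i : Fin 2) {x : Plane} (hx : x ∈ segment ℝ (mEnd 1) (mEnd 0)) :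
    height centre (signD i • unitD) x = 0 := by
  obtain ⟨a, b, -, -, hab, rfl⟩ := hx
  have h1 : height centre (signD i • unitD) (mEnd 1) = 0 := by rw [mEnd_eq, height_unitD, mul_zero]
  have h0 : height centre (signD i • unitD) (mEnd 0) = 0 := by rw [mEnd_eq, height_unitD, mul_zero]
  have e : a • mEnd 1 + b • mEnd 0 - centre = a • (mEnd 1 - centre) + b • (mEnd 0 - centre) := by
    rw [← eq_sub_iff_add_eq] at hab
    rw [hab]
    module
  rw [height, e, inner_add_right, real_inner_smul_right, real_inner_smul_right]
  simp only [height] at h0 h1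
  rw [h0, h1]
  ring

lemma height_D (j i : Fin 2) {x : Plane} (hx : x ∈ segment ℝ (dEnd i) centre) :
    height centre (signM j • unitM) x = 0 := by
  obtain ⟨a, b, -, -, hab, rfl⟩ := hx
  have h1 : height centre (signM j • unitM) (dEnd i) = 0 := by rw [dEnd_eq, height_unitM, mul_zero]
  have e : a • dEnd i + b • centre - centre = a • (dEnd i - centre) := by
    rw [← eq_sub_iff_add_eq] at hab
    rw [hab]
    module
  rw [height, e, real_inner_smul_right]
  simp only [height] at h1
  rw [h1, mul_zero]

lemma mem_M_of_height_eq_zero (i : Fin 2) {x : Plane} (hx : x ∈ rhombus)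
    (h : height centre (signD i • unitD) x = 0) : x ∈ segment ℝ (mEnd 1) (mEnd 0) := by
  obtain ⟨X, Y, rfl⟩ := exists_eq_pt x
  have h1 := (pt_mem_rhombus_hull X Y).mp (interior_subset hx)
  have hX : X = 0 := by
    rw [height_unitD, mul_eq_zero, mul_eq_zero] at h
    rcases h with (h | h) | h
    · rcases signD_eq i with hs | hs <;> rw [hs] at h <;> norm_num at h
    · have : 0 < √3 := by positivity
      linarith
    · exact h
  subst hX
  rw [abs_zero, zero_add, abs_le] at h1
  refine ⟨(1 - Y) / 2, (1 + Y) / 2, by linarith, by linarith, by ring, ?_⟩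
  rw [mEnd_eq, mEnd_eq]
  simp only [pt, signM, Matrix.cons_val_zero, Matrix.cons_val_one]
  module

lemma mem_D_of_height_eq_zero (i j : Fin 2) {x : Plane} (hx : x ∈ polygon (equiV i))
    (h : height centre (signM j • unitM) x = 0) : x ∈ segment ℝ (dEnd i) centre := by
  obtain ⟨X, Y, rfl⟩ := exists_eq_pt x
  obtain ⟨h1, h2⟩ := (pt_mem_equi_hull i X Y).mp (interior_subset hx)
  have hY : Y = 0 := by
    rw [height_unitM, mul_eq_zero, mul_eq_zero] at h
    rcases h with (h | h) | h
    · rcases signM_eq j with hs | hs <;> rw [hs] at h <;> norm_num at h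
    · norm_num at h
    · exact h
  subst hY
  have h3 : signD i * X ≤ 1 := by
    rw [abs_zero, add_zero, abs_le] at h1
    rcases signD_eq i with hs | hs <;> rw [hs] <;> linarith
  refine ⟨signD i * X, 1 - signD i * X, h2, by linarith, by ring, ?_⟩
  rw [dEnd_eq]
  simp only [pt]
  rcases signD_eq i with hs | hs <;> rw [hs] <;> module

lemma M_subset (j : Fin 2) :
    segment ℝ (mEnd 1) (mEnd 0) ⊆ segment ℝ centre (mEnd j) ∪ segment ℝ centre (mEnd (1 - j)) := by
  have key : segment ℝ (mEnd 1) (mEnd 0) ⊆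
      segment ℝ centre (mEnd 0) ∪ segment ℝ centre (mEnd 1) := by
    rintro x ⟨a, b, ha, hb, hab, rfl⟩
    rcases le_total a b with h | h
    -- The point has coordinates `X = 0`, `Y = b - a`, and the sign of `Y` decides the half of `M`.
    · refine Or.inl ⟨1 - (b - a), b - a, by linarith, by linarith, by ring, ?_⟩
      rw [mEnd_eq, mEnd_eq]
      simp only [pt, signM, Matrix.cons_val_zero, Matrix.cons_val_one]
      rw [← eq_sub_iff_add_eq] at hab
      rw [hab]
      module
    · refine Or.inr ⟨1 - (a - b), a - b, by linarith, by linarith, by ring, ?_⟩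
      rw [mEnd_eq, mEnd_eq]
      simp only [pt, signM, Matrix.cons_val_zero, Matrix.cons_val_one]
      rw [← eq_sub_iff_add_eq] at hab
      rw [hab]
      module
  fin_cases j
  · exact key
  · rw [Set.union_comm] at key
    exact key

lemma half_M_subset (j : Fin 2) :
    segment ℝ centre (mEnd j) ⊆ segment ℝ (mEnd 1) (mEnd 0) := by
  refine (convex_segment _ _).segment_subset ⟨1 / 2, 1 / 2, by norm_num, by norm_num, by norm_num,
    ?_⟩ ?_
  · rw [mEnd_eq, mEnd_eq]
    simp only [pt, signM, Matrix.cons_val_zero, Matrix.cons_val_one]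
    module
  · fin_cases j
    exacts [right_mem_segment ℝ _ _, left_mem_segment ℝ _ _]

lemma eq_or_eq_one_sub (i i' : Fin 2) : i' = i ∨ i' = 1 - i := by
  revert i i'
  decide

lemma one_sub_one_sub (i : Fin 2) : 1 - (1 - i) = i := by
  revert i
  decide

lemma exists_rhombus_side (i l : Fin 2) : ∃ j, side rhombusV j = segment ℝ (mEnd l) (dEnd i) := by
  fin_cases i <;> fin_cases l
  exacts [⟨0, segment_symm ℝ _ _⟩, ⟨3, rfl⟩, ⟨1, rfl⟩, ⟨2, segment_symm ℝ _ _⟩]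

lemma rhombus_side_eq (j : Fin 4) : ∃ i l, side rhombusV j = segment ℝ (mEnd l) (dEnd i) := by
  fin_cases j
  exacts [⟨0, 0, segment_symm ℝ _ _⟩, ⟨1, 0, rfl⟩, ⟨1, 1, segment_symm ℝ _ _⟩, ⟨0, 1, rfl⟩]

lemma exists_equi_side (i l : Fin 2) : ∃ k, side (equiV i) k = segment ℝ (mEnd l) (dEnd i) ∧
    ∀ a c : BC, ![a, a, c] k = a := by
  fin_cases l
  exacts [⟨0, rfl, fun _ _ ↦ rfl⟩, ⟨1, segment_symm ℝ _ _, fun _ _ ↦ rfl⟩]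

lemma equi_side_eq (i : Fin 2) (k : Fin 3) :
    (∃ l, side (equiV i) k = segment ℝ (mEnd l) (dEnd i) ∧ ∀ a c : BC, ![a, a, c] k = a) ∨
      (side (equiV i) k = segment ℝ (mEnd 1) (mEnd 0) ∧ ∀ a c : BC, ![a, a, c] k = c) := by
  fin_cases k
  exacts [Or.inl ⟨0, rfl, fun _ _ ↦ rfl⟩, Or.inl ⟨1, segment_symm ℝ _ _, fun _ _ ↦ rfl⟩,
    Or.inr ⟨rfl, fun _ _ ↦ rfl⟩]

lemma BC.eps_eq (b : BC) : (b.eps = 1 ∧ b = BC.n) ∨ (b.eps = -1 ∧ b = BC.d) := by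
  cases b
  exacts [Or.inr ⟨rfl, rfl⟩, Or.inl ⟨rfl, rfl⟩]

lemma BC.eps_d_ne {b : BC} (h : b = BC.d) : b.eps = -1 := by
  rw [h]
  rfl

/-! ### Boundary conditions under the two foldings -/

/-- The mirror `M` fixes its end points and exchanges those of `D`, so every side of the rhombus is
a side of the triangle or the reflection of one. Side `2` of the triangle is the mirror, where the
parity dictates the condition `c`. -/
lemma compatibleM (i : Fin 2) (a c : BC) :
    Folding.Compatible rhombus (polygon (equiV i)) centre (signD i • unitD) c.eps (side rhombusV)
      (fun _ ↦ a) (side (equiV i)) ![a, a, c] where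
  segment k := ⟨_, vertex_mem_closure (foldingM i).nonempty k, _,
    vertex_mem_closure (foldingM i).nonempty (k + 1), rfl⟩
  ext_side j hj := by
    obtain ⟨i', l, hl⟩ := rhombus_side_eq j
    obtain ⟨k, hk, hk'⟩ := exists_equi_side i l
    refine ⟨k, (hk' a c).trans hj, ?_⟩
    rw [hl, hk, mirror_preimage_segment, mirror_mEnd, mirror_dEnd]
    rcases eq_or_eq_one_sub i i' with rfl | rfl
    exacts [Set.subset_union_left, Set.subset_union_right]
  fold_side k hk := by
    rcases equi_side_eq i k with ⟨l, hl, hl'⟩ | ⟨hl, hl'⟩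
    · rw [hl'] at hk
      obtain ⟨j, hj⟩ := exists_rhombus_side i l
      obtain ⟨j', hj'⟩ := exists_rhombus_side (1 - i) l
      refine Or.inl ⟨j, j', hk, hk, (hl.trans hj.symm).le, ?_⟩
      rw [hj', hl, mirror_preimage_segment, mirror_mEnd, mirror_dEnd, one_sub_one_sub]
    · rw [hl'] at hk
      refine Or.inr ⟨BC.eps_d_ne hk, fun x hx ↦ height_M i (hl ▸ hx)⟩
  mirror_side := by
    rcases c.eps_eq with ⟨h, -⟩ | ⟨h, h'⟩
    · exact Or.inl h
    · exact Or.inr ⟨h, 2, h', fun x hx h0 ↦ mem_M_of_height_eq_zero i hx h0⟩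

/-- The mirror `D` exchanges the first two sides of the equilateral triangle and maps `M` to itself,
exchanging its halves; the condition `c` on `M` is thus inherited by a half. Side `1` of the small
triangle is the mirror, with the condition `b` given by the parity. -/
lemma compatibleD (i j : Fin 2) (a b c : BC) :
    Folding.Compatible (polygon (equiV i)) (polygon (hemiV i j)) centre (signM j • unitM) b.eps
      (side (equiV i)) ![a, a, c] (side (hemiV i j)) ![a, b, c] where
  segment k := ⟨_, vertex_mem_closure (foldingD i j).nonempty k, _,
    vertex_mem_closure (foldingD i j).nonempty (k + 1), rfl⟩
  ext_side k hk := by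
    rcases equi_side_eq i k with ⟨l, hl, hl'⟩ | ⟨hl, hl'⟩
    · rw [hl'] at hk
      refine ⟨0, hk, ?_⟩
      change _ ⊆ segment ℝ (mEnd j) (dEnd i) ∪ mirror centre _ ⁻¹' segment ℝ (mEnd j) (dEnd i)
      rw [hl, mirror_preimage_segment, mirror_mEnd', mirror_dEnd']
      rcases eq_or_eq_one_sub j l with rfl | rfl
      exacts [Set.subset_union_left, Set.subset_union_right]
    · rw [hl'] at hk
      refine ⟨2, hk, ?_⟩
      change _ ⊆ segment ℝ centre (mEnd j) ∪ mirror centre _ ⁻¹' segment ℝ centre (mEnd j)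
      rw [hl, mirror_preimage_segment, mirror_mEnd', mirror_centre']
      exact M_subset j
  fold_side k hk := by
    fin_cases k
    · obtain ⟨l, hl, hl'⟩ := exists_equi_side i j
      obtain ⟨l', hm, hm'⟩ := exists_equi_side i (1 - j)
      refine Or.inl ⟨l, l', (hl' a c).trans hk, (hm' a c).trans hk, hl.symm.le, ?_⟩
      change segment ℝ (mEnd j) (dEnd i) ⊆ _
      rw [hm, mirror_preimage_segment, mirror_mEnd', mirror_dEnd', one_sub_one_sub]
    · exact Or.inr ⟨BC.eps_d_ne hk, fun x hx ↦ height_D j i hx⟩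
    · refine Or.inl ⟨2, 2, hk, hk, half_M_subset j, ?_⟩
      change segment ℝ centre (mEnd j) ⊆ mirror centre _ ⁻¹' segment ℝ (mEnd 1) (mEnd 0)
      rw [mirror_preimage_segment, mirror_mEnd', mirror_mEnd']
      have h := half_M_subset j
      rw [segment_symm ℝ (mEnd 1)] at h
      exact h
  mirror_side := by
    rcases b.eps_eq with ⟨h, -⟩ | ⟨h, h'⟩
    · exact Or.inl h
    · exact Or.inr ⟨h, 1, h', fun x hx h0 ↦ mem_D_of_height_eq_zero i j hx h0⟩

/-! ### The reflection principle for the rhombus -/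

/-- Any point is a point of `M` displaced by a multiple of the half diagonal orthogonal to `M`, and
both maps reverse this displacement. -/
lemma reflM_eq {s : ℝ} (hs : s = 1 ∨ s = -1) : reflM = mirror centre (s • unitD) := by
  ext1 x
  obtain ⟨X, Y, rfl⟩ := exists_eq_pt x
  have hp : pt 0 Y ∈ line[ℝ, mEnd 0, mEnd 1] := by
    have : pt 0 Y = AffineMap.lineMap (mEnd 0) (mEnd 1) ((1 - Y) / 2) := by
      rw [mEnd_eq, mEnd_eq, AffineMap.lineMap_apply]
      simp only [pt, signM, Matrix.cons_val_zero, Matrix.cons_val_one, vsub_eq_sub, vadd_eq_add]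
      module
    rw [this]
    exact AffineMap.lineMap_mem_affineSpan_pair _ _ _
  have hv : X • (!₂[3 / 4, √3 / 4] : Plane) ∈ (line[ℝ, mEnd 0, mEnd 1]).directionᗮ := by
    rw [direction_affineSpan, vectorSpan_pair, Submodule.mem_orthogonal_singleton_iff_inner_right]
    simp [mEnd, PiLp.inner_apply, Fin.sum_univ_two]
    linear_combination (-X / 8) * sqrt_three_sq
  have h := EuclideanGeometry.reflection_orthogonal_vadd hp hv
  rw [mirror_unitD hs, reflM]
  have e1 : pt X Y = X • (!₂[3 / 4, √3 / 4] : Plane) +ᵥ pt 0 Y := by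
    simp only [pt, vadd_eq_add]
    module
  have e2 : pt (-X) Y = -(X • (!₂[3 / 4, √3 / 4] : Plane)) +ᵥ pt 0 Y := by
    simp only [pt, vadd_eq_add]
    module
  rw [e1, e2]
  exact h

lemma reflD_eq {s : ℝ} (hs : s = 1 ∨ s = -1) : reflD = mirror centre (s • unitM) := by
  ext1 x
  obtain ⟨X, Y, rfl⟩ := exists_eq_pt x
  have hp : pt X 0 ∈ line[ℝ, dEnd 0, dEnd 1] := by
    have : pt X 0 = AffineMap.lineMap (dEnd 0) (dEnd 1) ((1 + X) / 2) := by
      rw [dEnd_eq, dEnd_eq, AffineMap.lineMap_apply]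
      simp only [pt, signD, Matrix.cons_val_zero, Matrix.cons_val_one, vsub_eq_sub, vadd_eq_add]
      module
    rw [this]
    exact AffineMap.lineMap_mem_affineSpan_pair _ _ _
  have hv : Y • (!₂[1 / 4, -(√3 / 4)] : Plane) ∈ (line[ℝ, dEnd 0, dEnd 1]).directionᗮ := by
    rw [direction_affineSpan, vectorSpan_pair, Submodule.mem_orthogonal_singleton_iff_inner_right]
    simp [dEnd, PiLp.inner_apply, Fin.sum_univ_two]
    linear_combination (Y / 8) * sqrt_three_sq
  have h := EuclideanGeometry.reflection_orthogonal_vadd hp hv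
  rw [mirror_unitM hs, reflD]
  have e1 : pt X Y = Y • (!₂[1 / 4, -(√3 / 4)] : Plane) +ᵥ pt X 0 := by
    simp only [pt, vadd_eq_add]
    module
  have e2 : pt X (-Y) = -(Y • (!₂[1 / 4, -(√3 / 4)] : Plane)) +ᵥ pt X 0 := by
    simp only [pt, vadd_eq_add]
    module
  rw [e1, e2]
  exact h

lemma bijOn_equi (i : Fin 2) (a c : BC) (μ : ℝ) :
    Set.BijOn (restrictL2 (equi_subset i)) ((rhombusEigenspace a μ : Set (L2 rhombus)) ∩ symM c.eps)
      (polygonEigenspace (equiV i) ![a, a, c] μ) := by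
  have := (foldingM i).bijOn_restrict (compatibleM i a c) μ
  rw [Folding.symmetric, ← reflM_eq (signD_eq i)] at this
  exact this

lemma mirror_comm {s t : ℝ} (hs : s = 1 ∨ s = -1) (ht : t = 1 ∨ t = -1) (x : Plane) :
    mirror centre (s • unitD) (mirror centre (t • unitM) x) =
      mirror centre (t • unitM) (mirror centre (s • unitD) x) := by
  obtain ⟨X, Y, rfl⟩ := exists_eq_pt x
  rw [mirror_unitM ht, mirror_unitD hs, mirror_unitD hs, mirror_unitM ht]

/-- Since the mirrors commute, `D`-parity of an `M`-symmetric function on one equilateral triangle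
carries over to the reflected triangle. -/
lemma restrict_mem_symmetric_iff (i j : Fin 2) {σ τ : ℝ} {u : L2 rhombus}
    (hu : ∀ᵐ x ∂vol rhombus, u (reflM x) = τ * u x) :
    restrictL2 (equi_subset i) u ∈ Folding.symmetric (polygon (equiV i)) centre (signM j • unitM) σ ↔
      ∀ᵐ x ∂vol rhombus, u (reflD x) = σ * u x := by
  have hr := (foldingM i).restrict_ae u
  have hq := (foldingD i j).measurePreserving_mirror.quasiMeasurePreserving
  have hr' := hq.ae hr
  rw [reflM_eq (signD_eq i)] at hu
  have hu1 := ((foldingM i).ae_iff.mp hu).1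
  have hu2 := hq.ae hu1
  rw [reflD_eq (signM_eq j), (foldingM i).ae_iff]
  have key : restrictL2 (equi_subset i) u ∈
      Folding.symmetric (polygon (equiV i)) centre (signM j • unitM) σ ↔
      ∀ᵐ x ∂vol (polygon (equiV i)), u (mirror centre (signM j • unitM) x) = σ * u x := by
    constructor
    · intro h
      filter_upwards [h, hr, hr'] with x h1 h2 h3
      rw [← h2, ← h3]
      exact h1
    · intro h
      change ∀ᵐ x ∂_, _
      filter_upwards [h, hr, hr'] with x h1 h2 h3
      rw [show restrictL2 (equi_subset i) u x = u x from h2]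
      exact h3.trans h1
  rw [key]
  refine ⟨fun h ↦ ⟨h, ?_⟩, fun h ↦ h.1⟩
  filter_upwards [h, hu1, hu2] with x h1 h2 h3
  rw [← mirror_comm (signD_eq i) (signM_eq j), h3, h1, h2]
  ring

/-- Restriction to the small triangle is the composition of two restrictions, and the first one
matches the doubly symmetric functions with the `D`-symmetric ones on the equilateral triangle. -/
lemma bijOn_hemi (i j : Fin 2) (a b c : BC) (μ : ℝ) :
    Set.BijOn (restrictL2 (hemi_subset i j))
      ((rhombusEigenspace a μ : Set (L2 rhombus)) ∩ symDM b.eps c.eps)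
      (polygonEigenspace (hemiV i j) ![a, b, c] μ) := by
  have h1 := bijOn_equi i a c μ
  have h2 := (foldingD i j).bijOn_restrict (compatibleD i j a b c) μ
  have h3 : Set.BijOn (restrictL2 (equi_subset i))
      ((rhombusEigenspace a μ : Set (L2 rhombus)) ∩ symDM b.eps c.eps)
      ((polygonEigenspace (equiV i) ![a, a, c] μ : Set (L2 (polygon (equiV i)))) ∩
        Folding.symmetric (polygon (equiV i)) centre (signM j • unitM) b.eps) := by
    refine ⟨fun u hu ↦ ⟨h1.mapsTo ⟨hu.1, hu.2.2⟩,
      (restrict_mem_symmetric_iff i j hu.2.2).mpr hu.2.1⟩,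
      h1.injOn.mono (Set.inter_subset_inter_right _ fun u hu ↦ hu.2), fun v hv ↦ ?_⟩
    obtain ⟨u, hu, rfl⟩ := h1.surjOn hv.1
    exact ⟨u, ⟨hu.1, (restrict_mem_symmetric_iff i j hu.2).mp hv.2, hu.2⟩, rfl⟩
  refine (h2.comp h3).congr fun u _ ↦ Lp.ext ?_
  have e1 : (restrictL2 (hemi_subset i j) u : Plane → ℝ) =ᵐ[vol (polygon (hemiV i j))] u :=
    MemLp.coeFn_toLp _
  have e2 := (foldingD i j).restrict_ae (restrictL2 (equi_subset i) u)
  have e3 := ((foldingD i j).ae_iff.mp ((foldingM i).restrict_ae u)).1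
  filter_upwards [e1, e2, e3] with x b1 b2 b3
  rw [b1]
  exact b2.trans b3

lemma restrictL2_zero {T Ω : Set Plane} (h : T ⊆ Ω) : restrictL2 h 0 = 0 := by
  refine Lp.ext ?_
  have e1 : (restrictL2 h 0 : Plane → ℝ) =ᵐ[vol T] (0 : L2 Ω) := MemLp.coeFn_toLp _
  have e2 := ae_mono (Measure.restrict_mono h le_rfl) (Lp.coeFn_zero ℝ 2 (vol Ω))
  filter_upwards [e1, e2, Lp.coeFn_zero ℝ 2 (vol T)] with x b1 b2 b3
  rw [b1, b2, b3]

lemma ne_singleton_zero_iff_of_bijOn {V W : Type*} [AddCommGroup V] [AddCommGroup W] [Module ℝ W]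
    {f : V → W} (hf : f 0 = 0) {A : Set V} {B : Submodule ℝ W} (h : Set.BijOn f A B)
    (h0 : (0 : V) ∈ A) : A ≠ {0} ↔ B ≠ ⊥ := by
  refine not_congr ⟨fun hA ↦ ?_, fun hB ↦ ?_⟩
  · rw [← SetLike.coe_set_eq, ← h.image_eq, hA, Set.image_singleton, hf]
    rfl
  · refine Set.eq_singleton_iff_unique_mem.mpr ⟨h0, fun u hu ↦ h.injOn hu h0 ?_⟩
    have := h.mapsTo hu
    rw [hB] at this
    rw [hf]
    exact this

/-- Elements of `L²` are classes: a null exceptional set must pull back to a null set for the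
composition to vanish almost everywhere. -/
lemma zero_ae_eq_mul {R : Plane → Plane} (hR : Measure.QuasiMeasurePreserving R (vol rhombus)
    (vol rhombus)) (τ : ℝ) :
    ∀ᵐ x ∂vol rhombus, (0 : L2 rhombus) (R x) = τ * (0 : L2 rhombus) x := by
  have e := Lp.coeFn_zero ℝ 2 (vol rhombus)
  filter_upwards [e, hR.ae e] with x b1 b2
  rw [b1, b2]
  simp

lemma zero_mem_symM (τ : ℝ) : (0 : L2 rhombus) ∈ symM τ := by
  rw [symM, reflM_eq (signD_eq 0)]
  exact zero_ae_eq_mul (foldingM 0).measurePreserving_mirror.quasiMeasurePreserving τ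

lemma measurePreserving_reflD : MeasurePreserving reflD (vol rhombus) (vol rhombus) := by
  rw [reflD_eq (signM_eq 0)]
  have h := (measurePreserving_mirror centre (signM 0 • unitM)).restrict_preimage
    (isOpen_interior (s := convexHull ℝ (Set.range rhombusV))).measurableSet
  have hm : ∀ x ∈ rhombus, mirror centre (signM 0 • unitM) x ∈ rhombus := fun x hx ↦
    mirror_mem_interior (fun y hy ↦ by
      obtain ⟨X, Y, rfl⟩ := exists_eq_pt y
      rw [mirror_unitM (signM_eq 0), pt_mem_rhombus_hull, abs_neg]
      exact (pt_mem_rhombus_hull X Y).mp hy) hx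
  have e : mirror centre (signM 0 • unitM) ⁻¹' rhombus = rhombus :=
    Set.ext fun y ↦ ⟨fun hy ↦ by simpa using hm _ hy, hm y⟩
  change MeasurePreserving _ (vol (mirror centre (signM 0 • unitM) ⁻¹' rhombus)) _ at h
  rwa [e] at h

lemma zero_mem_symDM (σ τ : ℝ) : (0 : L2 rhombus) ∈ symDM σ τ :=
  ⟨zero_ae_eq_mul measurePreserving_reflD.quasiMeasurePreserving σ, zero_mem_symM τ⟩

/-- Multiplicities add once at `M` and once more at `D` in each of the two resulting terms. -/
lemma mult_rhombus_eq (i j : Fin 2) (a : BC) (μ : ℝ) :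
    polygonMult rhombusV (fun _ ↦ a) μ =
      ∑ b : BC, ∑ c : BC, polygonMult (hemiV i j) ![a, b, c] μ := by
  have h1 : polygonMult rhombusV (fun _ ↦ a) μ = polygonMult (equiV i) ![a, a, BC.n] μ +
      polygonMult (equiV i) ![a, a, BC.d] μ :=
    (foldingM i).rank_eigenspace_eq (compatibleM i a BC.n) (compatibleM i a BC.d) μ
  have h2 : ∀ c, polygonMult (equiV i) ![a, a, c] μ = polygonMult (hemiV i j) ![a, BC.n, c] μ +
      polygonMult (hemiV i j) ![a, BC.d, c] μ := fun c ↦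
    (foldingD i j).rank_eigenspace_eq (compatibleD i j a BC.n c) (compatibleD i j a BC.d c) μ
  have hs : ∀ f : BC → Cardinal, ∑ b, f b = f BC.d + f BC.n := fun f ↦
    Finset.sum_pair (by decide)
  rw [h1, h2, h2, hs, hs, hs]
  ring

end EquilateralRhombus

theorem mainTheorem6 (a : BC) (μ : ℝ) :
    (∀ i : Fin 2,
      ((rhombusEigenspace a μ : Set (L2 rhombus)) ∩ symM 1 ≠ {0} ↔
        μ ∈ polygonSpectrum (equiV i) ![a, a, BC.n]) ∧
      Set.BijOn (restrictL2 (equi_subset i))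
        ((rhombusEigenspace a μ : Set (L2 rhombus)) ∩ symM 1)
        (polygonEigenspace (equiV i) ![a, a, BC.n] μ)) ∧
    (∀ i : Fin 2,
      ((rhombusEigenspace a μ : Set (L2 rhombus)) ∩ symM (-1) ≠ {0} ↔
        μ ∈ polygonSpectrum (equiV i) ![a, a, BC.d]) ∧
      Set.BijOn (restrictL2 (equi_subset i))
        ((rhombusEigenspace a μ : Set (L2 rhombus)) ∩ symM (-1))
        (polygonEigenspace (equiV i) ![a, a, BC.d] μ)) ∧
    (∀ (b c : BC) (i j : Fin 2),
      ((rhombusEigenspace a μ : Set (L2 rhombus)) ∩ symDM b.eps c.eps ≠ {0} ↔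
        μ ∈ polygonSpectrum (hemiV i j) ![a, b, c]) ∧
      Set.BijOn (restrictL2 (hemi_subset i j))
        ((rhombusEigenspace a μ : Set (L2 rhombus)) ∩ symDM b.eps c.eps)
        (polygonEigenspace (hemiV i j) ![a, b, c] μ)) ∧
    (∀ i j : Fin 2,
      polygonMult rhombusV (fun _ ↦ a) μ =
        ∑ b : BC, ∑ c : BC, polygonMult (hemiV i j) ![a, b, c] μ) := by
  -- The signs `BC.n.eps` and `BC.d.eps` reduce definitionally to `1` and `-1`.
  refine ⟨fun i ↦ ⟨?_, bijOn_equi i a BC.n μ⟩, fun i ↦ ⟨?_, bijOn_equi i a BC.d μ⟩,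
    fun b c i j ↦ ⟨?_, bijOn_hemi i j a b c μ⟩, fun i j ↦ mult_rhombus_eq i j a μ⟩
  · exact ne_singleton_zero_iff_of_bijOn (restrictL2_zero _) (bijOn_equi i a BC.n μ)
      ⟨Submodule.zero_mem _, zero_mem_symM _⟩
  · exact ne_singleton_zero_iff_of_bijOn (restrictL2_zero _) (bijOn_equi i a BC.d μ)
      ⟨Submodule.zero_mem _, zero_mem_symM _⟩
  · exact ne_singleton_zero_iff_of_bijOn (restrictL2_zero _) (bijOn_hemi i j a b c μ)
      ⟨Submodule.zero_mem _, zero_mem_symDM _ _⟩
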